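/- Let $K$ be a field and let $T$ be a finite tree or, more generally, a finite forest, whose vertex set $V=\{x_1,\dots,x_n\}$ is regarded as a set of indeterminates. Let $R=K[x_1,\dots,x_n]$ and let $I\subset R$ be the edge ideal of $T$, generated by the monomials $xy$ with $\{x,y\}$ an edge of $T$. Fix a root in every connected component of $T$ (so just one root if $T$ is a tree), let the rank of a vertex be its distance from the root of its component, and fix a total order on $V$ such that $x>y$ whenever $x,y$ lie in the same component and $x$ has smaller rank than $y$. Order monomials lexicographically with respect to this order. *Symbols.* A symbol $u=(\mu_1,\dots,\mu_r)$ is a subset of the set of edge monomials, listed in decreasing order $\mu_1>\dots>\mu_r$; its length is $|u|=r$ (the empty symbol has length $0$), and $\mathrm{gr}(u)\in\mathbb Z^n$ is the exponent vector of $\mathrm{lcm}(u)$. Let $x,y,z,w$ be four distinct vertices with $xy,zw\in u$, $xy>zw$ and $xz\in I$; then $xz$ is called the bridge between $xy$ and $zw$. It is a bridge of $u$ if $xz\in u$. The monomials $xy$ and $zw$ form a gap of $u$, with bridge $xz$, if $xz\notin u$, no element of $u$ other than $zw$ is divisible by $w$, and no element of $u$ smaller than $zw$ is divisible by $y$. *$F$-admissible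 symbols.* A symbol is $F$-admissible if it contains no gap and arises as follows: select vertices $h_1>\dots>h_t$, no two of them adjacent; take all edge monomials divisible by some $h_i$; simultaneously delete from this list every $\mu$ that is divisible by some $h_i$ and is not coprime to some element of the list divisible by some $h_k$ with $k>i$; take any subset of what remains. Let $F_r$ be the free $R$-module on the $F$-admissible symbols of length $r$, the generator $u$ having multidegree $\mathrm{gr}(u)$. *Matching.* Let $G_X$ be the directed graph on all symbols with an edge $u\to u'$ whenever $u'\subset u$ and $|u'|=|u|-1$. For such an edge put $[u:u']=(-1)^{j+1}$ if $u'$ is obtained by omitting the $j$-th element of $u$. A symbol is of type 1 if it has a gap whose bridge is not greater than any bridge of the symbol. Let $A$ be the set of edges $u\to u'$ such that $u'$ is of type 1 and $u$ is obtained from $u'$ by inserting the smallest among the bridges of the gaps of $u'$. Let $G_X^A$ be the graph obtained from $G_X$ by reversing the edges in $A$. A gradient path is a directed path $P$ in $G^A_X$ (possibly of length $0$); $m(P)$ is the product of the weights of its steps, the weight of a step $u\to u'$ being $[u:u']$ if the edge is not reversed, and the weight of a reversed step $u'\to u$ being $-[u:u']$. For $r\ge1$ define $\partial_r:F_r\to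 F_{r-1}$ by $$\partial_r(u)=\sum_{\substack{u'\subset u\\|u'|=r-1}}[u:u']\sum_{\substack{u''\ F\text{-admissible}\\|u''|=r-1}}\ \sum_{\substack{P\text{ gradient path}\\ \text{from }u'\text{ to }u''}}m(P)\,\underline{x}^{\,\mathrm{gr}(u)-\mathrm{gr}(u'')}\,u''.$$ **Theorem.** $A$ is an acyclic matching (every symbol lies on at most one edge of $A$, and $G_X^A$ has no directed cycle), and the symbols that lie on no edge of $A$ are exactly the $F$-admissible ones. Moreover $(F_r,\partial_r)$, with the augmentation $F_0=R\to R/I$, is a minimal $\mathbb Z^n$-graded free resolution of $R/I$: it is exact, its maps are homogeneous of degree $0$, and $\partial_r(F_r)\subseteq(x_1,\dots,x_n)F_{r-1}$ for all $r\ge1$. It is cellular: there is a $\mathbb Z^n$-graded CW complex (the degree of any open cell that meets a closed cell $\bar e$ is at most the degree of $e$) whose cells of dimension $r-1$ correspond, with their degrees, to the $F$-admissible symbols of length $r$ for $r\ge1$, the empty cell corresponding to the empty symbol, and such that, for suitable orientations of the cells, $\partial_r(u)=\sum_{u''}[u:u'']_{\mathrm{CW}}\,\underline{x}^{\mathrm{gr}(u)-\mathrm{gr}(u'')}u''$,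 where $[u:u'']_{\mathrm{CW}}$ are the incidence numbers of the augmented cellular chain complex. -/

import Mathlib

/-! ### Multigraded complexes of free modules over a polynomial ring -/

namespace ForestResolution

universe u v w

section Generic

open MvPolynomial

variable {K : Type v} [Field K] {V : Type w}

/-- An element of the free module on a set `B` of generators, a generator `b` having multidegree
`deg b`, is homogeneous of multidegree `m` if every term of its coefficient at `b` has exponent `e`
with `e + deg b = m`. -/
def IsHomogeneousElt {B : Type u} (deg : B → V →₀ ℕ) (m : V →₀ ℕ)
    (f : B →₀ MvPolynomial V K) : Prop :=
  ∀ b, ∀ e ∈ (f b).support, e + deg b = m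

/-- The sequence `⋯ → F₂ → F₁ → F₀ → R/I → 0`, where `F r` is the free module on `B r`, a generator
`b` having multidegree `deg r b`, is a minimal multigraded free resolution of `R/I`: it is exact,
all its maps are homogeneous of degree `0`, and every differential maps `F (r + 1)` into the
multiple of `F r` by the ideal generated by the variables. -/
structure IsMinimalGradedFreeResolution (I : Ideal (MvPolynomial V K)) {B : ℕ → Type u}
    (deg : ∀ r, B r → V →₀ ℕ)
    (d : ∀ r, (B (r + 1) →₀ MvPolynomial V K) →ₗ[MvPolynomial V K] (B r →₀ MvPolynomial V K))
    (ε : (B 0 →₀ MvPolynomial V K) →ₗ[MvPolynomial V K] (MvPolynomial V K ⧸ I)) : Prop where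
  finite : ∀ r, Finite (B r)
  surjective : Function.Surjective ε
  exact_zero : Function.Exact (d 0) ε
  exact_succ : ∀ r, Function.Exact (d (r + 1)) (d r)
  homogeneous : ∀ r m f, IsHomogeneousElt (deg (r + 1)) m f → IsHomogeneousElt (deg r) m (d r f)
  homogeneous_aug : ∀ m f, IsHomogeneousElt (deg 0) m f →
    ∃ c : K, ε f = Ideal.Quotient.mk I (monomial m c)
  minimal : ∀ r, LinearMap.range (d r) ≤
    (Ideal.span (Set.range (X : V → MvPolynomial V K))) •
      (⊤ : Submodule (MvPolynomial V K) (B r →₀ MvPolynomial V K))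

end Generic

/-! ### Singular chains and cellular resolutions -/

section Cellular

/-- The `i`-th face inclusion of the standard simplex of dimension `n` into that of dimension
`n + 1`. -/
noncomputable def face (n : ℕ) (i : Fin (n + 2)) :
    C(stdSimplex ℝ (Fin (n + 1)), stdSimplex ℝ (Fin (n + 2))) :=
  ⟨stdSimplex.map i.succAbove, stdSimplex.continuous_map _⟩

/-- Singular `n`-chains with integer coefficients. -/
abbrev SingularChain (X : Type u) [TopologicalSpace X] (n : ℕ) : Type u :=
  C(stdSimplex ℝ (Fin (n + 1)), X) →₀ ℤ

/-- The boundary map on singular chains. -/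
noncomputable def singularBoundary (X : Type u) [TopologicalSpace X] (n : ℕ) :
    SingularChain X (n + 1) →ₗ[ℤ] SingularChain X n :=
  Finsupp.linearCombination ℤ fun s : C(stdSimplex ℝ (Fin (n + 2)), X) =>
    ∑ i : Fin (n + 2), Finsupp.single (s.comp (face n i)) ((-1 : ℤ) ^ (i : ℕ))

/-- The singular `n`-chains of `X` that lie in the subspace `A`. -/
def chainsIn {X : Type u} [TopologicalSpace X] (A : Set X) (n : ℕ) :
    Submodule ℤ (SingularChain X n) :=
  Finsupp.supported ℤ ℤ {s : C(stdSimplex ℝ (Fin (n + 1)), X) | Set.range s ⊆ A}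

/-- The characteristic map of an `n`-cell of a CW complex, regarded as a singular simplex by means
of a homeomorphism `θ` from the standard simplex to the model cell. -/
noncomputable def charSimplex {X : Type u} [TopologicalSpace X]
    [Topology.CWComplex (Set.univ : Set X)] (n : ℕ)
    (θ : stdSimplex ℝ (Fin (n + 1)) ≃ₜ Metric.closedBall (0 : Fin n → ℝ) 1)
    (e : Topology.RelCWComplex.cell (Set.univ : Set X) n) : C(stdSimplex ℝ (Fin (n + 1)), X) :=
  ⟨fun p => Topology.RelCWComplex.map n e (θ p : Fin n → ℝ),
    (Topology.RelCWComplex.continuousOn n e).comp_continuous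
      (continuous_subtype_val.comp θ.continuous) fun p => (θ p).2⟩

open MvPolynomial in
/-- The complex of free modules on the sets `B r`, with multidegrees `deg` and differentials `d`,
is cellular: it is the complex supported on a multigraded CW complex `X` whose cells of dimension
`n` correspond to `B (n + 1)`, the only element of `B 0` being the empty cell.

The multigrading is order-preserving: if the open cell `e'` meets the closed cell `e`, then the
degree of `e'` is at most the degree of `e`. The integers `inc r b b'` are the incidence numbers of
`X`: for an `(n + 1)`-cell `e`, the singular boundary of the characteristic simplex of `e` and the
combination of the characteristic simplices of the `n`-cells with these coefficients represent
the same class in `H_n(X^n, X^(n - 1))`, i.e. they differ by the boundary of a chain of the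
`n`-skeleton plus a chain of the `(n - 1)`-skeleton. The incidence number of a `0`-cell and the
empty cell is `1`. The differential is obtained from the incidence numbers by homogenization. -/
def IsCellular {K : Type v} [Field K] {V : Type w} {B : ℕ → Type u}
    (deg : ∀ r, B r → V →₀ ℕ)
    (d : ∀ r, (B (r + 1) →₀ MvPolynomial V K) →ₗ[MvPolynomial V K] (B r →₀ MvPolynomial V K)) :
    Prop :=
  ∃ (X : Type u) (_ : TopologicalSpace X) (_ : T2Space X)
    (_ : Topology.CWComplex (Set.univ : Set X))
    (label : ∀ n, Topology.RelCWComplex.cell (Set.univ : Set X) n ≃ B (n + 1))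
    (_ : Unique (B 0))
    (θ : ∀ n, stdSimplex ℝ (Fin (n + 1)) ≃ₜ Metric.closedBall (0 : Fin n → ℝ) 1)
    (inc : ∀ r, B (r + 1) → (B r →₀ ℤ)),
    (∀ m n (e : Topology.RelCWComplex.cell (Set.univ : Set X) m)
        (e' : Topology.RelCWComplex.cell (Set.univ : Set X) n),
      (Topology.RelCWComplex.closedCell m e ∩ Topology.RelCWComplex.openCell n e').Nonempty →
        deg (n + 1) (label n e') ≤ deg (m + 1) (label m e)) ∧
    (∀ b : B 1, inc 0 b = Finsupp.single default 1) ∧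
    (∀ n (e : Topology.RelCWComplex.cell (Set.univ : Set X) (n + 1)),
      singularBoundary X n (Finsupp.single (charSimplex (n + 1) (θ (n + 1)) e) 1) -
          (inc (n + 1) (label (n + 1) e)).mapDomain
            (fun b' => charSimplex n (θ n) ((label n).symm b')) ∈
        (chainsIn (Topology.RelCWComplex.skeletonLT (Set.univ : Set X) (n + 1 : ℕ) : Set X)
            (n + 1)).map (singularBoundary X n) ⊔
          chainsIn (Topology.RelCWComplex.skeletonLT (Set.univ : Set X) (n : ℕ) : Set X) n) ∧
    (∀ r (b : B (r + 1)), ∀ b' ∈ (inc r b).support, deg r b' ≤ deg (r + 1) b) ∧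
    ∀ r (b : B (r + 1)), d r (Finsupp.single b 1) =
      (inc r b).sum fun b' k =>
        Finsupp.single b' (monomial (deg (r + 1) b - deg r b') (k : K))

end Cellular

/-! ### Edge ideals, symbols and gaps -/

section Combinatorics

variable {V : Type u} [LinearOrder V]

/-- The rank of a vertex: its distance from the root chosen in its connected component. -/
noncomputable def rank (G : SimpleGraph V) (root : G.ConnectedComponent → V) (x : V) : ℕ :=
  G.dist (root (G.connectedComponentMk x)) x

/-- The linear order of `V` is thought of as an arrangement of the vertices in a sequence;
`x < y` means that `x` precedes `y` in the sequence, i.e. that the indeterminate `x` is *greater*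
than the indeterminate `y`. The sequence is required to list the vertices of each connected
component by increasing distance from a root of that component. -/
def IsRankArrangement (G : SimpleGraph V) (root : G.ConnectedComponent → V) : Prop :=
  (∀ c, G.connectedComponentMk (root c) = c) ∧
    ∀ x y, G.Reachable x y → rank G root x < rank G root y → x < y

open MvPolynomial in
/-- The edge ideal of a graph. -/
noncomputable def edgeIdeal (K : Type v) [Field K] (G : SimpleGraph V) : Ideal (MvPolynomial V K) :=
  Ideal.span {p | ∃ x y, G.Adj x y ∧ p = X x * X y}

variable {G : SimpleGraph V}

/-- The exponent vector of the edge monomial of `μ`. -/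
noncomputable def edgeExp (μ : G.edgeSet) : V →₀ ℕ :=
  ∑ x ∈ (μ : Sym2 V).toFinset, Finsupp.single x 1

/-- `μ` is smaller than `ν` in the lexicographic order on monomials for which a vertex is greater
than all the vertices that come after it in the arrangement. -/
def Smaller (μ ν : G.edgeSet) : Prop :=
  toLex (edgeExp μ) < toLex (edgeExp ν)

variable (G) in
/-- A symbol: a subsequence of the decreasing sequence of all edge monomials, given by the set of
its elements. -/
abbrev EdgeSymbol : Type u := Finset G.edgeSet

/-- The multidegree of a symbol: the exponent vector of the lcm of its elements. -/
noncomputable def gr (u : EdgeSymbol G) : V →₀ ℕ := u.sup edgeExp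

/-- `μ = xy` and `ν = zw` are elements of `u` with four distinct vertices, `μ` is greater than `ν`,
and `β = xz` is an edge: the bridge between `μ` and `ν`. -/
def IsBridged (u : EdgeSymbol G) (x y z w : V) (μ ν β : G.edgeSet) : Prop :=
  [x, y, z, w].Nodup ∧ (μ : Sym2 V) = s(x, y) ∧ (ν : Sym2 V) = s(z, w) ∧ (β : Sym2 V) = s(x, z) ∧
    μ ∈ u ∧ ν ∈ u ∧ Smaller ν μ

/-- `μ = xy` and `ν = zw` form a gap in `u` with bridge `β = xz`. -/
def IsGap (u : EdgeSymbol G) (x y z w : V) (μ ν β : G.edgeSet) : Prop :=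
  IsBridged u x y z w μ ν β ∧ β ∉ u ∧
    (∀ κ ∈ u, w ∈ (κ : Sym2 V) → κ = ν) ∧
    ∀ κ ∈ u, Smaller κ ν → y ∉ (κ : Sym2 V)

/-- `β` is the bridge of one of the gaps of `u`. -/
def IsGapBridge (u : EdgeSymbol G) (β : G.edgeSet) : Prop :=
  ∃ x y z w μ ν, IsGap u x y z w μ ν β

/-- `β` is a bridge of `u`, i.e. an element of `u` that is the bridge between two elements
of `u`. -/
def IsBridgeOf (u : EdgeSymbol G) (β : G.edgeSet) : Prop :=
  β ∈ u ∧ ∃ x y z w μ ν, IsBridged u x y z w μ ν β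

/-! ### The selection procedure -/

open scoped Classical in
/-- All edge monomials that are divisible by one of the selected vertices. -/
noncomputable def picked [Fintype V] (B : Finset V) : EdgeSymbol G :=
  Finset.univ.filter fun μ => ∃ h ∈ B, h ∈ (μ : Sym2 V)

open scoped Classical in
/-- What remains of `picked B` after the cancellation of every monomial that is divisible by a
selected vertex `h` and is not coprime to a monomial of the symbol divisible by a selected vertex
`k` coming after `h`. -/
noncomputable def surviving [Fintype V] (B : Finset V) : EdgeSymbol G :=
  (picked B).filter fun μ =>
    ¬ ∃ h ∈ B, ∃ k ∈ B, h < k ∧ h ∈ (μ : Sym2 V) ∧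
      ∃ ν ∈ picked (G := G) B, k ∈ (ν : Sym2 V) ∧ ∃ x, x ∈ (μ : Sym2 V) ∧ x ∈ (ν : Sym2 V)

/-- A symbol is almost `F`-admissible if it is a subsymbol of `surviving B` for some set `B` of
pairwise non-adjacent vertices. -/
def IsAlmostFAdmissible [Fintype V] (u : EdgeSymbol G) : Prop :=
  ∃ B : Finset V, (∀ h ∈ B, ∀ k ∈ B, ¬ G.Adj h k) ∧ u ⊆ surviving B

/-- A symbol is `F`-admissible if it is almost `F`-admissible and contains no gap. -/
def IsFAdmissible [Fintype V] (u : EdgeSymbol G) : Prop :=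
  IsAlmostFAdmissible u ∧ ¬ ∃ β, IsGapBridge u β

variable (G) in
/-- The `F`-admissible symbols of length `r`. -/
abbrev FSymbol [Fintype V] (r : ℕ) : Type u :=
  {u : EdgeSymbol G // IsFAdmissible u ∧ u.card = r}

/-! ### The matching and the Morse differentials -/

/-- The edges `u → u'` of the directed graph of the simplicial complex of all symbols. -/
def IsFacet (u u' : EdgeSymbol G) : Prop := u' ⊆ u ∧ u.card = u'.card + 1

/-- Symbols of type 1: those containing a gap that is not followed by any bridge, i.e. such that
no bridge of the symbol is smaller than the bridge of the gap. -/
def IsTypeOne (u : EdgeSymbol G) : Prop :=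
  ∃ β, IsGapBridge u β ∧ ∀ κ, IsBridgeOf u κ → ¬ Smaller κ β

/-- The set `A` of directed edges `u → u'` such that `u'` is of type 1 and `u` is obtained from `u'`
by inserting the smallest among the bridges of the gaps of `u'`. -/
def InA (u u' : EdgeSymbol G) : Prop :=
  IsTypeOne u' ∧ ∃ β, IsGapBridge u' β ∧ (∀ γ, IsGapBridge u' γ → γ = β ∨ Smaller β γ) ∧
    u = insert β u'

/-- The directed graph obtained by reversing the edges that belong to `A`. -/
def GradientStep (a b : EdgeSymbol G) : Prop :=
  (IsFacet a b ∧ ¬ InA a b) ∨ InA b a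

variable (G) in
/-- `A` is an acyclic matching: its elements are edges of the directed graph of the complex of
symbols, every symbol lies on at most one of them, and the directed graph obtained by
reversing them has no directed cycle. -/
def IsAcyclicMatching : Prop :=
  (∀ u u' : EdgeSymbol G, InA u u' → IsFacet u u') ∧
  (∀ u u' v v' : EdgeSymbol G, InA u u' → InA v v' →
    (u = v ∨ u = v' ∨ u' = v ∨ u' = v') → u = v ∧ u' = v') ∧
  ∀ u : EdgeSymbol G, ¬ Relation.TransGen GradientStep u u

open scoped Classical in
/-- The incidence number of `u'` in the simplicial boundary of `u`: the sign `(-1) ^ (j + 1)` if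
`u'` is obtained from `u` by omitting its `j`-th element (in decreasing order), and `0` if `u'` is
not obtained in this way. -/
noncomputable def incidence (u u' : EdgeSymbol G) : ℤ :=
  ∑ μ ∈ u, if u' = u.erase μ then (-1) ^ (u.filter fun ν => Smaller μ ν).card else 0

open scoped Classical in
/-- The weight of a directed edge of the graph with reversed edges. -/
noncomputable def stepWeight (a b : EdgeSymbol G) : ℤ :=
  if InA b a then -incidence b a else incidence a b

/-- The product of the weights of the steps of a path, given as the list of its vertices. -/
noncomputable def pathWeight (l : List (EdgeSymbol G)) : ℤ :=
  (List.zipWith stepWeight l l.tail).prod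

open scoped Classical in
/-- The gradient paths from `a` to `b`: directed paths in the graph with reversed edges, given as
lists of distinct vertices. -/
noncomputable def gradientPaths [Fintype V] (a b : EdgeSymbol G) :
    Finset {l : List (EdgeSymbol G) // l.Nodup} :=
  Finset.univ.filter fun l =>
    l.1.head? = some a ∧ l.1.getLast? = some b ∧ l.1.IsChain GradientStep

open scoped Classical in
open MvPolynomial in
variable (G) in
/-- The differential `F (r + 1) → F r`, by the gradient path formula. -/
noncomputable def differential [Fintype V] (K : Type v) [Field K] (r : ℕ) :
    (FSymbol G (r + 1) →₀ MvPolynomial V K) →ₗ[MvPolynomial V K]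
      (FSymbol G r →₀ MvPolynomial V K) :=
  Finsupp.linearCombination (MvPolynomial V K) fun u : FSymbol G (r + 1) =>
    ∑ u' ∈ u.1.powersetCard r, ∑ u'' : FSymbol G r, ∑ P ∈ gradientPaths u' u''.1,
      Finsupp.single u''
        (monomial (gr u.1 - gr u''.1) ((incidence u.1 u' * pathWeight P.1 : ℤ) : K))

variable (G) in
/-- The augmentation `F 0 = R → R/I`, which maps the generator to the class of `1`. -/
noncomputable def augmentation [Fintype V] (K : Type v) [Field K] :
    (FSymbol G 0 →₀ MvPolynomial V K) →ₗ[MvPolynomial V K]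
      (MvPolynomial V K ⧸ edgeIdeal K G) :=
  Finsupp.linearCombination (MvPolynomial V K) fun _ => 1

end Combinatorics

end ForestResolution

/-!
A fixed root in each component makes every vertex have at most one neighbour that precedes it, its
parent (`IsRankArrangement.hasUniqueParents`); this is all that is used of the forest. A bridge
then joins a vertex `x` to a child `z`, and lies between an edge from `z` to a child and another
edge at `x`.

*Matching.* The pivot of a symbol is the smallest among its bridges and the bridges of its gaps.
Toggling it, i.e. inserting or removing it, changes neither the pivot (`IsPivot.of_agreeOff`) nor
the multidegree (`IsPivot.gr_insert`), and the matching `A` consists of exactly these toggles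
(`inA_iff`). It is acyclic, since along an inclusion of symbols with the same multidegree the
pivot can only become smaller (`exists_isPivot_of_subset`); this gives a function on symbols that
is strictly monotone except on matched pairs (`symbolHeight_lt`). Symbols without a pivot are
disjoint unions of stars whose centres can be selected by the procedure that defines
`F`-admissibility (`isFAdmissible_iff`), and they are determined by their multidegrees
(`eq_of_gr_eq`).

*Resolution.* A matching of the subsets of a finite set by toggling a pivot is treated abstractly
as a `PivotMatching`. Counting its gradient paths gives a chain map (`flowMap`) from the chain
complex of the simplex to the Morse complex, spanned by the critical faces. The kernel of this map
is spanned by the larger faces of the matched pairs and their boundaries, hence contractible, and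
the Morse complex inherits exactness from the simplex (`morse_exact`). In a fixed multidegree `m`
the complex of the free modules `F r` is the Morse complex of the full simplex on the edges whose
monomials divide `m`, to which the matching restricts because toggling preserves multidegrees.
This proves exactness (`exact_homogenizedMap`, `exact_differential`); minimality holds because
distinct admissible symbols have distinct multidegrees.

*Cell structure.* A point in the interior of a simplex of a matched pair is moved by a retraction
of the larger simplex of the pair to the union of its proper faces other than the smaller one.
Repeating this leads to a point in the interior of a critical face (`collapse`). The quotient of
the simplex by the fibres of this map is compact, and it is Hausdorff because the relation is
closed: closures of its restrictions to products of open simplices are pulled back along the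
retractions, by induction on the heights (`closure_collapsePairs_subset`). The open critical faces
are mapped homeomorphically to the open cells of a CW structure (`collapsedCWComplex`). In the
quotient the larger face of a matched pair is contained in a skeleton of smaller dimension, so its
boundary vanishes in the homology of successive skeleta; these relations express every face by
critical ones in the same way as the gradient paths do (`flowDefect_mem_nullChains`), and the
incidence numbers are the coefficients of the differentials.
-/

namespace ForestResolution

universe u v w

/-! ### Matchings that toggle a pivot -/

section Matching

/-- A matching on the finite subsets of `E` that pairs `S` with the set obtained by inserting or
removing a distinguished element, the pivot of `S`; the sets without a pivot are unmatched, or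
critical. The function `height` is monotone for inclusion and takes the same value on a set and a
proper subset only if they are matched with one another: this is acyclicity. -/
structure PivotMatching (E : Type u) [LinearOrder E] where
  /-- The element whose insertion or removal gives the partner of a set. -/
  pivot : Finset E → Option E
  /-- A function that strictly increases along all inclusions but those of matched pairs. -/
  height : Finset E → ℕ
  pivot_insert : ∀ {S z}, pivot S = some z → pivot (insert z S) = some z
  pivot_erase : ∀ {S z}, pivot S = some z → pivot (S.erase z) = some z
  erase_nonempty : ∀ {S z}, pivot S = some z → (S.erase z).Nonempty
  height_insert : ∀ {S z}, pivot S = some z → height (insert z S) = height (S.erase z)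
  height_lt : ∀ {S T}, S ⊂ T → (∀ z, pivot T = some z → S ≠ T.erase z) → height S < height T

variable {E : Type u} [LinearOrder E]

/-- The sign of the face `u.erase e` in the boundary of the simplex `u`, whose vertices are listed
in increasing order. -/
def faceSign (u : Finset E) (e : E) : ℤ := (-1) ^ (u.filter (· < e)).card

lemma faceSign_mul_self (u : Finset E) (e : E) : faceSign u e * faceSign u e = 1 := by
  unfold faceSign
  rw [← pow_add, ← two_mul, pow_mul]
  simp

lemma faceSign_erase_of_lt {u : Finset E} {a b : E} (h : a < b) :
    faceSign (u.erase b) a = faceSign u a := by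
  unfold faceSign
  congr 2
  ext x
  simp only [Finset.mem_filter, Finset.mem_erase]
  constructor
  · rintro ⟨⟨_, h1⟩, h2⟩
    exact ⟨h1, h2⟩
  · rintro ⟨h1, h2⟩
    exact ⟨⟨(h2.trans h).ne, h1⟩, h2⟩

lemma faceSign_erase_of_gt {u : Finset E} {a b : E} (h : a < b) (ha : a ∈ u) :
    faceSign (u.erase a) b = -faceSign u b := by
  unfold faceSign
  have : (u.filter (· < b)) = insert a ((u.erase a).filter (· < b)) := by
    ext x
    simp only [Finset.mem_filter, Finset.mem_erase, Finset.mem_insert]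
    by_cases hx : x = a
    · subst hx; simp [ha, h]
    · simp [hx]
  rw [this, Finset.card_insert_of_notMem (by simp), pow_succ]
  ring

lemma faceSign_anticomm {u : Finset E} {a b : E} (hab : a ≠ b) (ha : a ∈ u) (hb : b ∈ u) :
    faceSign u a * faceSign (u.erase a) b = -(faceSign u b * faceSign (u.erase b) a) := by
  rcases lt_or_gt_of_ne hab with h | h
  · rw [faceSign_erase_of_lt h, faceSign_erase_of_gt h ha]; ring
  · rw [faceSign_erase_of_lt h, faceSign_erase_of_gt h hb]; ring

namespace PivotMatching

variable (M : PivotMatching E)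

/-- A set without a pivot is critical. -/
def Critical (S : Finset E) : Prop := M.pivot S = none

/-- The larger set of a matched pair. -/
def Upper (S : Finset E) : Prop := ∃ z ∈ S, M.pivot S = some z

/-- The smaller set of a matched pair. -/
def Lower (S : Finset E) : Prop := ∃ z, z ∉ S ∧ M.pivot S = some z

lemma critical_or_upper_or_lower (S : Finset E) : M.Critical S ∨ M.Upper S ∨ M.Lower S := by
  unfold Critical Upper Lower
  rcases h : M.pivot S with _ | z
  · exact Or.inl rfl
  · by_cases hz : z ∈ S
    · exact Or.inr (Or.inl ⟨z, hz, rfl⟩)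
    · exact Or.inr (Or.inr ⟨z, hz, rfl⟩)

/-- A set `D` of vertices such that the full simplex on `D` is a union of critical sets and matched
pairs. -/
def Respects (D : Finset E) : Prop := ∀ ⦃S z⦄, M.pivot S = some z → S.erase z ⊆ D → z ∈ D

variable {M}

lemma height_erase_lt_of_upper {S : Finset E} {z e : E} (h : M.pivot S = some z) (he : e ∈ S)
    (hne : e ≠ z) : M.height (S.erase e) < M.height S := by
  refine M.height_lt (Finset.erase_ssubset he) fun y hy => ?_
  rw [h] at hy
  obtain rfl := Option.some.inj hy
  intro heq
  have : e ∈ S.erase z := Finset.mem_erase.2 ⟨hne, he⟩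
  rw [← heq] at this
  simp at this

lemma height_eq_of_upper {S : Finset E} {z : E} (h : M.pivot S = some z) (hz : z ∈ S) :
    M.height S = M.height (S.erase z) := by
  simpa [Finset.insert_eq_of_mem hz] using M.height_insert h

lemma height_eq_of_lower {S : Finset E} {z : E} (h : M.pivot S = some z) (hz : z ∉ S) :
    M.height (insert z S) = M.height S := by
  simpa [Finset.erase_eq_of_notMem hz] using M.height_insert h

variable (M)

/-- The properties that characterize the total weights `Γ a b` of the gradient paths from a set `a`
to a critical set `b` of the same size. -/
structure IsFlow (Γ : Finset E → Finset E → ℤ) : Prop where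
  critical : ∀ {a b}, M.Critical a → M.Critical b → a.card = b.card → Γ a b = if a = b then 1 else 0
  upper : ∀ {a b}, M.Upper a → M.Critical b → a.card = b.card → Γ a b = 0
  boundary : ∀ {u b}, M.Upper u → M.Critical b → u.card = b.card + 1 →
    ∑ e ∈ u, faceSign u e * Γ (u.erase e) b = 0

/-- The coefficients of the Morse differential. -/
def morseIncidence (Γ : Finset E → Finset E → ℤ) (u b : Finset E) : ℤ :=
  ∑ e ∈ u, faceSign u e * Γ (u.erase e) b

end PivotMatching

end Matching

/-! ### The Morse complex of a pivot matching on a simplex -/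

section Algebra

open Finsupp PivotMatching

variable {E : Type u} [LinearOrder E] (K : Type v) [CommRing K]

/-- The augmented simplicial boundary map on the free module on all finite subsets of `E`. -/
noncomputable def simplexBoundary : (Finset E →₀ K) →ₗ[K] (Finset E →₀ K) :=
  Finsupp.linearCombination K fun u => ∑ e ∈ u, single (u.erase e) (faceSign u e : K)

lemma simplexBoundary_single (u : Finset E) :
    simplexBoundary K (single u 1) = ∑ e ∈ u, single (u.erase e) (faceSign u e : K) := by
  simp [simplexBoundary]

lemma simplexBoundary_simplexBoundary (z : Finset E →₀ K) :
    simplexBoundary K (simplexBoundary K z) = 0 := by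
  suffices h : simplexBoundary K ∘ₗ simplexBoundary K = (0 : (Finset E →₀ K) →ₗ[K] _) from
    LinearMap.congr_fun h z
  refine Finsupp.lhom_ext' fun u => LinearMap.ext_ring ?_
  simp only [LinearMap.comp_apply, Finsupp.lsingle_apply, LinearMap.zero_apply]
  rw [simplexBoundary_single, map_sum]
  have h : ∀ e ∈ u, simplexBoundary K (single (u.erase e) (faceSign u e : K)) =
      ∑ f ∈ u.erase e, single ((u.erase e).erase f)
        ((faceSign u e * faceSign (u.erase e) f : ℤ) : K) := by
    intro e _
    rw [← mul_one (faceSign u e : K), ← smul_eq_mul, ← Finsupp.smul_single, map_smul,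
      simplexBoundary_single, Finset.smul_sum]
    simp
  rw [Finset.sum_congr rfl h, Finset.sum_sigma']
  refine Finset.sum_involution (fun p _ => ⟨p.2, p.1⟩) ?_ ?_ ?_ ?_
  · rintro ⟨e, f⟩ hp
    simp only [Finset.mem_sigma, Finset.mem_erase] at hp
    rw [Finset.erase_right_comm, ← Finsupp.single_add,
      faceSign_anticomm (Ne.symm hp.2.1) hp.1 hp.2.2]
    simp
  · rintro ⟨e, f⟩ hp _ h
    simp only [Finset.mem_sigma, Finset.mem_erase] at hp
    exact hp.2.1 (by simpa using congrArg Sigma.fst h)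
  · rintro ⟨e, f⟩ hp
    simp only [Finset.mem_sigma, Finset.mem_erase] at hp ⊢
    exact ⟨hp.2.2, Ne.symm hp.2.1, hp.1⟩
  · rintro ⟨e, f⟩ _
    rfl

variable (M : PivotMatching E)

/-- Chains on the sets of size `r` contained in `D` and satisfying `P`. -/
def chainsOn (D : Finset E) (r : ℕ) (P : Finset E → Prop) : Submodule K (Finset E →₀ K) :=
  Finsupp.supported K K {u | u ⊆ D ∧ u.card = r ∧ P u}

variable {K}

lemma single_mem_chainsOn {D : Finset E} {r : ℕ} {P : Finset E → Prop} {u : Finset E} (hD : u ⊆ D)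
    (hr : u.card = r) (hP : P u) (c : K) : single u c ∈ chainsOn K D r P :=
  Finsupp.single_mem_supported K c ⟨hD, hr, hP⟩

lemma linearCombination_mem_of_mem_chainsOn {W : Type*} [AddCommGroup W] [Module K W]
    {f : Finset E → W} {D : Finset E} {r : ℕ} {P : Finset E → Prop} {N : Submodule K W}
    (h : ∀ u, u ⊆ D → u.card = r → P u → f u ∈ N) {z : Finset E →₀ K}
    (hz : z ∈ chainsOn K D r P) : Finsupp.linearCombination K f z ∈ N := by
  rw [Finsupp.linearCombination_apply]
  refine Submodule.sum_mem _ fun u hu => Submodule.smul_mem _ _ ?_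
  obtain ⟨h1, h2, h3⟩ := (Finsupp.mem_supported K z).1 hz hu
  exact h u h1 h2 h3

lemma map_mem_of_mem_chainsOn {W : Type*} [AddCommGroup W] [Module K W]
    (f : (Finset E →₀ K) →ₗ[K] W) {D : Finset E} {r : ℕ} {P : Finset E → Prop} {N : Submodule K W}
    (h : ∀ u, u ⊆ D → u.card = r → P u → f (single u 1) ∈ N) {z : Finset E →₀ K}
    (hz : z ∈ chainsOn K D r P) : f z ∈ N := by
  have : f = Finsupp.linearCombination K fun u => f (single u 1) := by
    refine Finsupp.lhom_ext' fun u => LinearMap.ext_ring ?_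
    simp
  rw [this]
  exact linearCombination_mem_of_mem_chainsOn h hz

lemma simplexBoundary_mem {D : Finset E} {r : ℕ} {z : Finset E →₀ K} {P : Finset E → Prop}
    (hz : z ∈ chainsOn K D (r + 1) P) :
    simplexBoundary K z ∈ chainsOn K D r fun _ => True := by
  refine linearCombination_mem_of_mem_chainsOn (fun u hD hr _ => ?_) hz
  refine Submodule.sum_mem _ fun e he => single_mem_chainsOn ?_ ?_ trivial _
  · exact (Finset.erase_subset _ _).trans hD
  · rw [Finset.card_erase_of_mem he, hr, Nat.add_sub_cancel]

lemma chainsOn_mono {D : Finset E} {r : ℕ} {P Q : Finset E → Prop} (h : ∀ u, P u → Q u) :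
    chainsOn K D r P ≤ chainsOn K D r Q :=
  Finsupp.supported_mono fun _ hu => ⟨hu.1, hu.2.1, h _ hu.2.2⟩

/-- A full simplex is acyclic: coning off with one of its vertices is a contraction. -/
lemma exists_simplexBoundary_eq {D : Finset E} {r : ℕ} {z : Finset E →₀ K}
    (hz : z ∈ chainsOn K D (r + 1) fun _ => True) (h0 : simplexBoundary K z = 0) :
    ∃ t ∈ chainsOn K D (r + 2) (fun _ => True), simplexBoundary K t = z := by
  classical
  rcases D.eq_empty_or_nonempty with rfl | ⟨e, he⟩
  · refine ⟨0, Submodule.zero_mem _, ?_⟩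
    have : z = 0 := by
      rw [← Finsupp.support_eq_empty, Finset.eq_empty_iff_forall_notMem]
      intro u hu
      obtain ⟨h1, h2, -⟩ := (Finsupp.mem_supported K z).1 hz hu
      rw [Finset.subset_empty.1 h1] at h2
      simp at h2
    simp [this]
  let s : (Finset E →₀ K) →ₗ[K] (Finset E →₀ K) := Finsupp.linearCombination K fun u =>
    if e ∈ u then 0 else single (insert e u) (faceSign (insert e u) e : K)
  have hs : ∀ u, s (single u 1) =
      if e ∈ u then 0 else single (insert e u) (faceSign (insert e u) e : K) := by
    intro u; simp [s]
  have hs' : ∀ u (c : K), s (single u c) = c • s (single u 1) := by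
    intro u c
    rw [← map_smul]; simp
  have hd' : ∀ (u : Finset E) (c : K),
      simplexBoundary K (single u c) = c • simplexBoundary K (single u 1) := by
    intro u c
    rw [← map_smul]; simp
  -- `s` is a contracting homotopy: inserting `e` and applying the boundary in either order adds up
  -- to the identity.
  have key : simplexBoundary K ∘ₗ s + s ∘ₗ simplexBoundary K = LinearMap.id := by
    refine Finsupp.lhom_ext' fun u => LinearMap.ext_ring ?_
    simp only [LinearMap.comp_apply, Finsupp.lsingle_apply, LinearMap.add_apply, LinearMap.id_apply]
    rw [simplexBoundary_single, map_sum]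
    by_cases hu : e ∈ u
    · rw [hs, if_pos hu, map_zero, zero_add, Finset.sum_eq_single_of_mem e hu]
      · rw [hs', hs, if_neg (by simp), Finset.insert_erase hu]
        simp only [Finsupp.smul_single, smul_eq_mul]
        rw [← Int.cast_mul, faceSign_mul_self, Int.cast_one]
      · intro f _ hfe
        rw [hs', hs, if_pos (Finset.mem_erase.2 ⟨Ne.symm hfe, hu⟩), smul_zero]
    · rw [hs, if_neg hu, hd', simplexBoundary_single, Finset.sum_insert hu, smul_add,
        Finset.erase_insert hu, add_assoc, Finset.smul_sum, ← Finset.sum_add_distrib]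
      rw [Finset.sum_eq_zero, add_zero]
      · simp only [Finsupp.smul_single, smul_eq_mul]
        rw [← Int.cast_mul, faceSign_mul_self, Int.cast_one]
      · intro f hf
        have hfe : f ≠ e := fun h => hu (h ▸ hf)
        rw [hs', hs, if_neg (by simp [hu]), Finset.erase_insert_of_ne (Ne.symm hfe)]
        simp only [Finsupp.smul_single, smul_eq_mul]
        rw [← Finsupp.single_add, ← Int.cast_mul, ← Int.cast_mul, ← Int.cast_add]
        have h1 := faceSign_anticomm hfe (Finset.mem_insert_of_mem hf) (Finset.mem_insert_self e u)
        rw [Finset.erase_insert hu, Finset.erase_insert_of_ne (Ne.symm hfe)] at h1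
        have h2 := faceSign_mul_self (insert e u) e
        have h3 := faceSign_mul_self (insert e u) f
        have : faceSign (insert e u) e * faceSign (insert e u) f +
            faceSign u f * faceSign (insert e (u.erase f)) e = 0 := by
          linear_combination (faceSign u f * faceSign (insert e u) f) * h1 -
            (faceSign u f * faceSign (insert e (u.erase f)) e) * h3 -
            faceSign (insert e u) f * faceSign (insert e u) e * faceSign_mul_self u f
        rw [this]; simp
  refine ⟨s z, linearCombination_mem_of_mem_chainsOn (fun u hD hr _ => ?_) hz, ?_⟩
  · split_ifs with h
    · exact Submodule.zero_mem _
    · exact single_mem_chainsOn (Finset.insert_subset he hD)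
        (by rw [Finset.card_insert_of_notMem h, hr]) trivial _
  · have := LinearMap.congr_fun key z
    simpa [h0] using this

end Algebra

section MorseComplex

open Finsupp PivotMatching

variable {E : Type u} [LinearOrder E] [Fintype E] (K : Type v) [CommRing K]
variable (M : PivotMatching E) (Γ : Finset E → Finset E → ℤ)

open scoped Classical in
/-- The map that sends a set to the combination of critical sets with coefficients given by `Γ`. -/
noncomputable def flowMap : (Finset E →₀ K) →ₗ[K] (Finset E →₀ K) :=
  Finsupp.linearCombination K fun a =>
    ∑ b with M.Critical b ∧ b.card = a.card, single b (Γ a b : K)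

variable {K M Γ}

open scoped Classical in
lemma flowMap_single (a : Finset E) :
    flowMap K M Γ (single a 1) =
      ∑ b with M.Critical b ∧ b.card = a.card, single b (Γ a b : K) := by
  simp [flowMap]

lemma flowMap_of_critical (hΓ : M.IsFlow Γ) {a : Finset E} (ha : M.Critical a) :
    flowMap K M Γ (single a 1) = single a 1 := by
  classical
  rw [flowMap_single, Finset.sum_eq_single_of_mem a (by simp [ha])]
  · rw [hΓ.critical ha ha rfl, if_pos rfl, Int.cast_one]
  · intro b hb hne
    rw [Finset.mem_filter] at hb
    rw [hΓ.critical ha hb.2.1 hb.2.2.symm, if_neg (Ne.symm hne), Int.cast_zero, single_zero]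

lemma flowMap_of_upper (hΓ : M.IsFlow Γ) {a : Finset E} (ha : M.Upper a) :
    flowMap K M Γ (single a 1) = 0 := by
  classical
  rw [flowMap_single]
  refine Finset.sum_eq_zero fun b hb => ?_
  rw [Finset.mem_filter] at hb
  rw [hΓ.upper ha hb.2.1 hb.2.2.symm, Int.cast_zero, single_zero]

open scoped Classical in
lemma flowMap_simplexBoundary_single {u : Finset E} {r : ℕ} (hu : u.card = r + 1) :
    flowMap K M Γ (simplexBoundary K (single u 1)) =
      ∑ b with M.Critical b ∧ b.card = r, single b (morseIncidence Γ u b : K) := by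
  rw [simplexBoundary_single, map_sum]
  have : ∀ e ∈ u, flowMap K M Γ (single (u.erase e) (faceSign u e : K)) =
      ∑ b with M.Critical b ∧ b.card = r,
        single b ((faceSign u e * Γ (u.erase e) b : ℤ) : K) := by
    intro e he
    have : single (u.erase e) (faceSign u e : K) = (faceSign u e : K) • single (u.erase e) 1 := by
      simp
    rw [this, map_smul, flowMap_single, Finset.smul_sum, Finset.card_erase_of_mem he, hu,
      Nat.add_sub_cancel]
    refine Finset.sum_congr rfl fun b _ => ?_
    simp
  rw [Finset.sum_congr rfl this, Finset.sum_comm]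
  refine Finset.sum_congr rfl fun b _ => ?_
  rw [morseIncidence, Int.cast_sum, Finsupp.single_finsetSum]

lemma flowMap_simplexBoundary_of_upper (hΓ : M.IsFlow Γ) {u : Finset E} (hu : M.Upper u) :
    flowMap K M Γ (simplexBoundary K (single u 1)) = 0 := by
  classical
  obtain ⟨z, hz, -⟩ := id hu
  obtain ⟨r, hr⟩ := Nat.exists_eq_succ_of_ne_zero (Finset.card_ne_zero_of_mem hz)
  rw [flowMap_simplexBoundary_single hr]
  refine Finset.sum_eq_zero fun b hb => ?_
  rw [Finset.mem_filter] at hb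
  rw [morseIncidence, hΓ.boundary hu hb.2.1 (by omega), Int.cast_zero, single_zero]

/-- The flow never leaves a set of vertices respected by the matching. -/
lemma flow_eq_zero_of_not_subset (hΓ : M.IsFlow Γ) {D : Finset E} (hD : M.Respects D)
    {a b : Finset E} (ha : a ⊆ D) (hb : M.Critical b) (hab : a.card = b.card) (hbD : ¬ b ⊆ D) :
    Γ a b = 0 := by
  induction h : M.height a using Nat.strong_induction_on generalizing a with
  | _ n ih =>
  rcases M.critical_or_upper_or_lower a with hc | hu | ⟨z, hz, hp⟩
  · rw [hΓ.critical hc hb hab, if_neg]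
    rintro rfl
    exact hbD ha
  · exact hΓ.upper hu hb hab
  · have hzD : z ∈ D := hD hp ((Finset.erase_subset _ _).trans ha)
    have hp' := M.pivot_insert hp
    have := hΓ.boundary ⟨z, Finset.mem_insert_self z a, hp'⟩ hb
      (by rw [Finset.card_insert_of_notMem hz, hab])
    rw [Finset.sum_eq_single_of_mem z (Finset.mem_insert_self z a), Finset.erase_insert hz] at this
    · exact (mul_eq_zero.1 this).resolve_left fun h0 => by
        simpa [h0] using faceSign_mul_self (insert z a) z
    · intro e he hez
      rw [ih _ _ _ _ rfl, mul_zero]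
      · rw [← h, ← height_eq_of_lower hp hz]
        exact height_erase_lt_of_upper hp' he hez
      · exact (Finset.erase_subset _ _).trans (Finset.insert_subset hzD ha)
      · rw [Finset.card_erase_of_mem he, Finset.card_insert_of_notMem hz, hab,
          Nat.add_sub_cancel]

lemma flowMap_mem (hΓ : M.IsFlow Γ) {D : Finset E} (hD : M.Respects D) {r : ℕ}
    {z : Finset E →₀ K} {P : Finset E → Prop} (hz : z ∈ chainsOn K D r P) :
    flowMap K M Γ z ∈ chainsOn K D r M.Critical := by
  classical
  refine linearCombination_mem_of_mem_chainsOn (fun a ha hr _ => ?_) hz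
  refine Submodule.sum_mem _ fun b hb => ?_
  rw [Finset.mem_filter] at hb
  by_cases hbD : b ⊆ D
  · exact single_mem_chainsOn hbD (hb.2.2.trans hr) hb.2.1 _
  · rw [flow_eq_zero_of_not_subset hΓ hD ha hb.2.1 hb.2.2.symm hbD, Int.cast_zero, single_zero]
    exact Submodule.zero_mem _

/-- Every chain is the sum of a chain of critical sets, a chain of upper sets, and the boundary of
a chain of upper sets. -/
lemma chainsOn_le_sup {D : Finset E} (hD : M.Respects D) (r : ℕ) :
    chainsOn K D r (fun _ => True) ≤ chainsOn K D r M.Critical ⊔ (chainsOn K D r M.Upper ⊔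
      (chainsOn K D (r + 1) M.Upper).map (simplexBoundary K)) := by
  set N := chainsOn K D r M.Critical ⊔ (chainsOn K D r M.Upper ⊔
      (chainsOn K D (r + 1) M.Upper).map (simplexBoundary K)) with hN
  have key : ∀ a, a ⊆ D → a.card = r → single a (1 : K) ∈ N := by
    intro a ha har
    induction h : M.height a using Nat.strong_induction_on generalizing a with
    | _ n ih =>
    rcases M.critical_or_upper_or_lower a with hc | hu | ⟨z, hz, hp⟩
    · exact Submodule.mem_sup_left (single_mem_chainsOn ha har hc 1)
    · exact Submodule.mem_sup_right (Submodule.mem_sup_left (single_mem_chainsOn ha har hu 1))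
    · have hzD : z ∈ D := hD hp ((Finset.erase_subset _ _).trans ha)
      have hp' := M.pivot_insert hp
      have hmem := Finset.mem_insert_self z a
      have hsub := Finset.insert_subset hzD ha
      have hcard : (insert z a).card = r + 1 := by rw [Finset.card_insert_of_notMem hz, har]
      have h1 : simplexBoundary K (single (insert z a) 1) ∈ N :=
        Submodule.mem_sup_right (Submodule.mem_sup_right (Submodule.mem_map_of_mem
          (single_mem_chainsOn hsub hcard ⟨z, hmem, hp'⟩ 1)))
      rw [simplexBoundary_single, ← Finset.add_sum_erase _ _ hmem, Finset.erase_insert hz] at h1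
      have h2 : ∑ e ∈ a, single ((insert z a).erase e) (faceSign (insert z a) e : K) ∈ N := by
        refine Submodule.sum_mem _ fun e he => ?_
        have hez : e ≠ z := fun h => hz (h ▸ he)
        have he' := Finset.mem_insert_of_mem (a := e) (b := z) he
        have : single ((insert z a).erase e) (faceSign (insert z a) e : K) =
            (faceSign (insert z a) e : K) • single ((insert z a).erase e) 1 := by simp
        rw [this]
        refine Submodule.smul_mem _ _ (ih _ ?_ _ ?_ ?_ rfl)
        · rw [← h, ← height_eq_of_lower hp hz]
          exact height_erase_lt_of_upper hp' he' hez
        · exact (Finset.erase_subset _ _).trans hsub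
        · rw [Finset.card_erase_of_mem he', hcard, Nat.add_sub_cancel]
      have h3 := N.smul_mem (faceSign (insert z a) z : K) ((N.add_mem_iff_left h2).1 h1)
      rwa [Finsupp.smul_single, smul_eq_mul, ← Int.cast_mul, faceSign_mul_self,
        Int.cast_one] at h3
  intro z hz
  exact map_mem_of_mem_chainsOn LinearMap.id (fun u h1 h2 _ => key u h1 h2) hz

lemma flowMap_eq_self (hΓ : M.IsFlow Γ) {D : Finset E} {r : ℕ} {c : Finset E →₀ K}
    (hc : c ∈ chainsOn K D r M.Critical) : flowMap K M Γ c = c := by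
  have := map_mem_of_mem_chainsOn (flowMap K M Γ - LinearMap.id) (N := ⊥)
    (fun u _ _ hu => by simp [flowMap_of_critical hΓ hu]) hc
  simpa [sub_eq_zero] using this

lemma flowMap_upper_eq_zero (hΓ : M.IsFlow Γ) {D : Finset E} {r : ℕ} {a : Finset E →₀ K}
    (ha : a ∈ chainsOn K D r M.Upper) : flowMap K M Γ a = 0 := by
  simpa using map_mem_of_mem_chainsOn (flowMap K M Γ) (N := ⊥)
    (fun u _ _ hu => by simp [flowMap_of_upper hΓ hu]) ha

lemma flowMap_simplexBoundary_upper_eq_zero (hΓ : M.IsFlow Γ) {D : Finset E} {r : ℕ}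
    {a : Finset E →₀ K} (ha : a ∈ chainsOn K D r M.Upper) :
    flowMap K M Γ (simplexBoundary K a) = 0 := by
  simpa using map_mem_of_mem_chainsOn (flowMap K M Γ ∘ₗ simplexBoundary K) (N := ⊥)
    (fun u _ _ hu => by simp [flowMap_simplexBoundary_of_upper hΓ hu]) ha

/-- The flow is a chain map to the Morse complex, whose differential is `flowMap ∘ boundary`. -/
lemma flowMap_simplexBoundary_flowMap (hΓ : M.IsFlow Γ) {D : Finset E} (hD : M.Respects D) {r : ℕ}
    {z : Finset E →₀ K} (hz : z ∈ chainsOn K D r fun _ => True) :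
    flowMap K M Γ (simplexBoundary K (flowMap K M Γ z)) =
      flowMap K M Γ (simplexBoundary K z) := by
  obtain ⟨c, hc, y, hy, rfl⟩ := Submodule.mem_sup.1 (chainsOn_le_sup hD r hz)
  obtain ⟨a, ha, y', ⟨b, hb, rfl⟩, rfl⟩ := Submodule.mem_sup.1 hy
  simp only [map_add, flowMap_eq_self hΓ hc, flowMap_upper_eq_zero hΓ ha,
    flowMap_simplexBoundary_upper_eq_zero hΓ ha, flowMap_simplexBoundary_upper_eq_zero hΓ hb,
    simplexBoundary_simplexBoundary, map_zero]

/-- The boundary map is injective on chains of upper sets: the partner of an upper set of maximal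
height in the chain does not cancel. -/
lemma eq_zero_of_simplexBoundary_eq_zero {D : Finset E} {r : ℕ}
    {a : Finset E →₀ K} (ha : a ∈ chainsOn K D r M.Upper) (h0 : simplexBoundary K a = 0) :
    a = 0 := by
  classical
  by_contra hne
  obtain ⟨u, hu, hmax⟩ := a.support.exists_max_image M.height (Finsupp.support_nonempty_iff.2 hne)
  obtain ⟨-, -, z, hz, hp⟩ := (Finsupp.mem_supported K a).1 ha hu
  have h1 : simplexBoundary K a (u.erase z) = a u * (faceSign u z : K) := by
    rw [simplexBoundary, Finsupp.linearCombination_apply, Finsupp.sum, Finsupp.finsetSum_apply,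
      Finset.sum_eq_single_of_mem u hu]
    · rw [Finsupp.smul_apply, smul_eq_mul, Finsupp.finsetSum_apply,
        Finset.sum_eq_single_of_mem z hz, single_eq_same]
      intro e he hez
      refine single_eq_of_ne fun h => hez ?_
      by_contra hne
      have : z ∈ u.erase e := Finset.mem_erase.2 ⟨Ne.symm hne, hz⟩
      rw [← h] at this
      simp at this
    · intro v hv hvu
      rw [Finsupp.smul_apply, smul_eq_mul, Finsupp.finsetSum_apply, Finset.sum_eq_zero, mul_zero]
      intro e he
      refine single_eq_of_ne fun h => ?_
      have hlt : M.height (v.erase e) < M.height v := by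
        refine M.height_lt (Finset.erase_ssubset he) fun y hy heq => hvu ?_
        rw [← h] at heq
        have h2 : M.pivot (v.erase y) = some y := M.pivot_erase hy
        rw [← heq, M.pivot_erase hp, Option.some.injEq] at h2
        subst h2
        obtain ⟨-, -, x, hx, hpx⟩ := (Finsupp.mem_supported K a).1 ha hv
        rw [hpx, Option.some.injEq] at hy
        subst hy
        rw [← Finset.insert_erase hx, ← heq, Finset.insert_erase hz]
      rw [← h, ← height_eq_of_upper hp hz] at hlt
      exact absurd (hmax v hv) (not_le.2 hlt)
  rw [h0, Finsupp.zero_apply] at h1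
  refine (Finsupp.mem_support_iff.1 hu) ?_
  have h2 := congrArg (· * (faceSign u z : K)) h1
  simp only [zero_mul] at h2
  rw [mul_assoc, ← Int.cast_mul, faceSign_mul_self, Int.cast_one, mul_one] at h2
  exact h2.symm

/-- The Morse complex of a full simplex is exact in positive lengths: the kernel of the flow is a
contractible subcomplex, so exactness is inherited from the simplex. -/
theorem morse_exact (hΓ : M.IsFlow Γ) {D : Finset E} (hD : M.Respects D) {r : ℕ}
    {x : Finset E →₀ K} (hx : x ∈ chainsOn K D (r + 1) M.Critical)
    (h0 : flowMap K M Γ (simplexBoundary K x) = 0) :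
    ∃ y ∈ chainsOn K D (r + 2) M.Critical, flowMap K M Γ (simplexBoundary K y) = x := by
  obtain ⟨c, hc, y, hy, hw⟩ := Submodule.mem_sup.1 (chainsOn_le_sup hD r (simplexBoundary_mem hx))
  obtain ⟨a, ha, y', ⟨b, hb, rfl⟩, rfl⟩ := Submodule.mem_sup.1 hy
  have hc0 : c = 0 := by
    rw [← flowMap_eq_self hΓ hc, ← h0, ← hw]
    simp [flowMap_upper_eq_zero hΓ ha, flowMap_simplexBoundary_upper_eq_zero hΓ hb]
  have ha0 : a = 0 := by
    refine eq_zero_of_simplexBoundary_eq_zero ha ?_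
    have := congrArg (simplexBoundary K) hw
    simpa [simplexBoundary_simplexBoundary, hc0] using this
  obtain ⟨t, ht, hxt⟩ := exists_simplexBoundary_eq (K := K) (z := x - b)
    (Submodule.sub_mem _ (chainsOn_mono (fun _ _ => trivial) hx)
      (chainsOn_mono (fun _ _ => trivial) hb))
    (by rw [map_sub, ← hw, hc0, ha0]; simp)
  refine ⟨flowMap K M Γ t, flowMap_mem hΓ hD ht, ?_⟩
  rw [flowMap_simplexBoundary_flowMap hΓ hD ht, hxt, map_sub, flowMap_eq_self hΓ hx,
    flowMap_upper_eq_zero hΓ hb, sub_zero]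

theorem morse_comp_eq_zero (hΓ : M.IsFlow Γ) {D : Finset E} (hD : M.Respects D) {r : ℕ}
    {x : Finset E →₀ K} {P : Finset E → Prop} (hx : x ∈ chainsOn K D (r + 1) P) :
    flowMap K M Γ (simplexBoundary K (flowMap K M Γ (simplexBoundary K x))) = 0 := by
  rw [flowMap_simplexBoundary_flowMap hΓ hD (simplexBoundary_mem hx),
    simplexBoundary_simplexBoundary, map_zero]

end MorseComplex

section Vertices

variable {V : Type u} [LinearOrder V] {G : SimpleGraph V}

/-- Every vertex has at most one neighbour that precedes it. -/
def HasUniqueParents (G : SimpleGraph V) : Prop :=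
  ∀ ⦃x x' z⦄, G.Adj x z → G.Adj x' z → x < z → x' < z → x = x'

/-- In a forest whose vertices are arranged by increasing rank, the only neighbour preceding a
vertex is the last-but-one vertex of the unique path from the root. -/
lemma IsRankArrangement.hasUniqueParents (hG : G.IsAcyclic) {root : G.ConnectedComponent → V}
    (hroot : IsRankArrangement G root) : HasUniqueParents G := by
  intro x x' z hx hx' hlt hlt'
  obtain ⟨hr, hrank⟩ := hroot
  have key : ∀ y, G.Adj y z → y < z →
      ∃ p : G.Path (root (G.connectedComponentMk z)) z, p.1.penultimate = y := by
    intro y hy hyz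
    have hcomp : G.connectedComponentMk y = G.connectedComponentMk z :=
      SimpleGraph.ConnectedComponent.sound hy.reachable
    have hreach : G.Reachable (root (G.connectedComponentMk z)) y :=
      SimpleGraph.ConnectedComponent.exact ((hr _).trans hcomp.symm)
    obtain ⟨p, hp, hlen⟩ := hreach.exists_path_of_dist
    have hle : ¬ rank G root z < rank G root y := fun h =>
      absurd (hrank z y hy.reachable.symm h) (not_lt.2 hyz.le)
    have hz : z ∉ p.support := by
      intro hz
      apply hle
      unfold rank
      rw [hcomp, ← hlen]
      refine lt_of_le_of_lt (SimpleGraph.dist_le (p.takeUntil z hz)) ?_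
      exact SimpleGraph.Walk.length_takeUntil_lt_length hz hy.ne'
    exact ⟨⟨p.concat hy, hp.concat hz hy⟩, by simp⟩
  obtain ⟨p, rfl⟩ := key x hx hlt
  obtain ⟨q, rfl⟩ := key x' hx' hlt'
  rw [(hG.subsingleton_path _ _).elim p q]

/-! ### The lexicographic order on the edges -/

lemma edgeExp_apply (μ : G.edgeSet) (v : V) :
    edgeExp μ v = if v ∈ (μ : Sym2 V) then 1 else 0 := by
  classical
  simp [edgeExp, Finsupp.finsetSum_apply, Finsupp.single_apply]

lemma edgeExp_injective : Function.Injective (edgeExp : G.edgeSet → V →₀ ℕ) := by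
  intro μ ν h
  refine Subtype.ext (Sym2.ext fun v => ?_)
  have := DFunLike.congr_fun h v
  rw [edgeExp_apply, edgeExp_apply] at this
  by_cases h1 : v ∈ (μ : Sym2 V) <;> by_cases h2 : v ∈ (ν : Sym2 V) <;> simp_all

/-- The order in which the edge monomials are listed: `μ < ν` means that the monomial of `μ` is
greater than that of `ν`. This is not the order that the type of edges inherits from `Sym2`. -/
@[reducible] noncomputable def edgeOrder (G : SimpleGraph V) : LinearOrder G.edgeSet :=
  { PartialOrder.lift (fun μ : G.edgeSet => OrderDual.toDual (toLex (edgeExp μ)))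
      (fun _ _ h => edgeExp_injective (toLex.injective (OrderDual.toDual.injective h))) with
    le_total := fun μ ν => le_total (OrderDual.toDual (toLex (edgeExp μ))) _
    toDecidableLE := Classical.decRel _
    toDecidableEq := inferInstance }

lemma smaller_iff {μ ν : G.edgeSet} {a b c d : V} (hμ : (μ : Sym2 V) = s(a, b))
    (hν : (ν : Sym2 V) = s(c, d)) (hab : a < b) (hcd : c < d) :
    Smaller ν μ ↔ a < c ∨ (a = c ∧ b < d) := by
  have sub : ∀ {μ ν : G.edgeSet} {a b c d : V}, (μ : Sym2 V) = s(a, b) →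
      (ν : Sym2 V) = s(c, d) → a < b → c < d → (a < c ∨ (a = c ∧ b < d)) → Smaller ν μ := by
    intro μ ν a b c d hμ hν hab hcd h
    rw [Smaller, Finsupp.Lex.lt_iff]
    rcases h with h | ⟨rfl, h⟩
    · refine ⟨a, fun j hj => ?_, ?_⟩
      · simp [edgeExp_apply, hμ, hν, hj.ne, (hj.trans hab).ne, (hj.trans h).ne,
          ((hj.trans h).trans hcd).ne]
      · simp [edgeExp_apply, hμ, hν, h.ne, (h.trans hcd).ne]
    · refine ⟨b, fun j hj => ?_, ?_⟩
      · simp [edgeExp_apply, hμ, hν, hj.ne, (hj.trans h).ne]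
      · simp [edgeExp_apply, hμ, hν, h.ne, hab.ne']
  refine ⟨fun h => ?_, sub hμ hν hab hcd⟩
  by_contra hcon
  rcases lt_trichotomy a c with h1 | h1 | h1
  · exact hcon (Or.inl h1)
  · rcases lt_trichotomy b d with h2 | h2 | h2
    · exact hcon (Or.inr ⟨h1, h2⟩)
    · have : μ = ν := Subtype.ext (by rw [hμ, hν, h1, h2])
      rw [Smaller, this] at h
      exact lt_irrefl _ h
    · exact lt_asymm (a := toLex (edgeExp ν)) h (sub hν hμ hcd hab (Or.inr ⟨h1.symm, h2⟩))
  · exact lt_asymm (a := toLex (edgeExp ν)) h (sub hν hμ hcd hab (Or.inl h1))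

lemma exists_lt_eq (μ : G.edgeSet) : ∃ a b, a < b ∧ G.Adj a b ∧ (μ : Sym2 V) = s(a, b) := by
  obtain ⟨⟨a, b⟩, h⟩ := μ
  have hadj : G.Adj a b := h
  rcases lt_or_gt_of_ne hadj.ne with hlt | hlt
  · exact ⟨a, b, hlt, hadj, rfl⟩
  · exact ⟨b, a, hlt, hadj.symm, Sym2.eq_swap⟩

/-! ### Bridges and gaps in terms of vertices -/

/-- The edge `ab` belongs to `u`. -/
def HasEdge (u : EdgeSymbol G) (a b : V) : Prop := ∃ μ ∈ u, (μ : Sym2 V) = s(a, b)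

lemma HasEdge.symm {u : EdgeSymbol G} {a b : V} (h : HasEdge u a b) : HasEdge u b a := by
  obtain ⟨μ, h1, h2⟩ := h
  exact ⟨μ, h1, h2.trans Sym2.eq_swap⟩

lemma HasEdge.adj {u : EdgeSymbol G} {a b : V} (h : HasEdge u a b) : G.Adj a b := by
  obtain ⟨μ, -, h2⟩ := h
  have := μ.2
  rwa [h2, SimpleGraph.mem_edgeSet] at this

lemma HasEdge.mono {u t : EdgeSymbol G} (hut : u ⊆ t) {a b : V} (h : HasEdge u a b) :
    HasEdge t a b := by
  obtain ⟨μ, h1, h2⟩ := h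
  exact ⟨μ, hut h1, h2⟩

lemma hasEdge_iff {u : EdgeSymbol G} {μ : G.edgeSet} {a b : V} (h : (μ : Sym2 V) = s(a, b)) :
    HasEdge u a b ↔ μ ∈ u := by
  constructor
  · rintro ⟨ν, h1, h2⟩
    rwa [Subtype.ext (h.trans h2.symm)]
  · exact fun hμ => ⟨μ, hμ, h⟩

/-- For `x` the parent of `z`: the edge `xz` lies between an edge from `z` to a child and another
edge at `x`. -/
def Bridged (u : EdgeSymbol G) (x z : V) : Prop :=
  ∃ w y, z < w ∧ HasEdge u z w ∧ y ≠ z ∧ HasEdge u x y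

/-- For `x` the parent of `z`: the edge from `z` to a child `w` and an edge `xy` satisfy the
conditions for a gap with bridge `xz`, apart from the absence of `xz`. -/
def GapAt (u : EdgeSymbol G) (x z : V) : Prop :=
  ∃ w y, z < w ∧ HasEdge u z w ∧ (∀ t, HasEdge u w t → t = z) ∧ y ≠ z ∧ HasEdge u x y ∧
    (y < z ∨ ∀ t, HasEdge u y t → t = x)

/-- The edge from `x` to its child `z` is a bridge of `u` or the bridge of a gap of `u`. -/
def CandAt (u : EdgeSymbol G) (x z : V) : Prop :=
  (HasEdge u x z ∧ Bridged u x z) ∨ (¬ HasEdge u x z ∧ GapAt u x z)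

lemma GapAt.bridged {u : EdgeSymbol G} {x z : V} (h : GapAt u x z) : Bridged u x z := by
  obtain ⟨w, y, h1, h2, -, h3, h4, -⟩ := h
  exact ⟨w, y, h1, h2, h3, h4⟩

/-- The pair `(x', z')` comes after `(x, z)` in the lexicographic order. -/
def Later (x z x' z' : V) : Prop := x < x' ∨ (x = x' ∧ z < z')

/-- The order of the two outer monomials forces the bridge `xz` and the edge `zw` to point away
from the root. -/
lemma IsBridged.lt_lt (hP : HasUniqueParents G) {u : EdgeSymbol G} {x y z w : V} {μ ν β : G.edgeSet}
    (h : IsBridged u x y z w μ ν β) : x < z ∧ z < w := by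
  obtain ⟨hnd, hμ, hν, hβ, -, -, hs⟩ := h
  simp only [List.nodup_cons, List.mem_cons, List.not_mem_nil, not_or, or_false] at hnd
  obtain ⟨⟨hxy, hxz, hxw⟩, ⟨hyz, hyw⟩, hzw, -⟩ := hnd
  have aμ : G.Adj x y := by have := μ.2; rwa [hμ, SimpleGraph.mem_edgeSet] at this
  have aν : G.Adj z w := by have := ν.2; rwa [hν, SimpleGraph.mem_edgeSet] at this
  have aβ : G.Adj x z := by have := β.2; rwa [hβ, SimpleGraph.mem_edgeSet] at this
  have h1 : x < z := by
    by_contra hcon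
    have hzx := lt_of_le_of_ne (not_lt.1 hcon) (Ne.symm hxz)
    have hyx : x < y := by
      by_contra hcon'
      have hyx := lt_of_le_of_ne (not_lt.1 hcon') (Ne.symm hxy)
      exact hyz (hP aμ.symm aβ.symm hyx hzx)
    rcases lt_or_gt_of_ne hzw with h' | h'
    · rcases (smaller_iff hμ hν hyx h').1 hs with h'' | ⟨h'', -⟩
      · exact lt_asymm h'' hzx
      · exact hxz h''
    · rw [Sym2.eq_swap] at hν
      rcases (smaller_iff hμ hν hyx h').1 hs with h'' | ⟨h'', -⟩
      · exact lt_asymm h'' (h'.trans hzx)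
      · exact hxw h''
  refine ⟨h1, ?_⟩
  by_contra hcon
  exact hxw (hP aβ aν.symm h1 (lt_of_le_of_ne (not_lt.1 hcon) (Ne.symm hzw)))

lemma smaller_of_lt_lt {x y z w : V} {μ ν : G.edgeSet} (hμ : (μ : Sym2 V) = s(x, y))
    (hν : (ν : Sym2 V) = s(z, w)) (hxz : x < z) (hzw : z < w) : Smaller ν μ := by
  have aμ : G.Adj x y := by have := μ.2; rwa [hμ, SimpleGraph.mem_edgeSet] at this
  rcases lt_or_gt_of_ne aμ.ne with h | h
  · exact (smaller_iff hμ hν h hzw).2 (Or.inl hxz)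
  · exact (smaller_iff (hμ.trans Sym2.eq_swap) hν h hzw).2 (Or.inl (h.trans hxz))

/-- Conversely, edges directed in this way form a path of four distinct vertices. -/
lemma isBridged_of_lt (hP : HasUniqueParents G) {u : EdgeSymbol G} {x y z w : V}
    {μ ν β : G.edgeSet} (hμ : (μ : Sym2 V) = s(x, y)) (hν : (ν : Sym2 V) = s(z, w))
    (hβ : (β : Sym2 V) = s(x, z)) (hμu : μ ∈ u) (hνu : ν ∈ u) (hxz : x < z) (hzw : z < w)
    (hyz : y ≠ z) : IsBridged u x y z w μ ν β := by
  have aμ : G.Adj x y := by have := μ.2; rwa [hμ, SimpleGraph.mem_edgeSet] at this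
  have aν : G.Adj z w := by have := ν.2; rwa [hν, SimpleGraph.mem_edgeSet] at this
  refine ⟨?_, hμ, hν, hβ, hμu, hνu, smaller_of_lt_lt hμ hν hxz hzw⟩
  have hyw : y ≠ w := by
    rintro rfl
    exact hxz.ne (hP aμ aν (hxz.trans hzw) hzw)
  simp [aμ.ne, hxz.ne, (hxz.trans hzw).ne, hyz, hyw, hzw.ne]

lemma isBridgeOf_iff (hP : HasUniqueParents G) {u : EdgeSymbol G} {β : G.edgeSet} {x z : V}
    (hβ : (β : Sym2 V) = s(x, z)) (hxz : x < z) :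
    IsBridgeOf u β ↔ HasEdge u x z ∧ Bridged u x z := by
  rw [hasEdge_iff hβ, IsBridgeOf]
  refine and_congr_right fun _ => ⟨?_, ?_⟩
  · rintro ⟨x', y, z', w, μ, ν, h⟩
    obtain ⟨h1, h2⟩ := h.lt_lt hP
    obtain ⟨hnd, hμ, hν, hβ', hμu, hνu, -⟩ := h
    obtain ⟨rfl, rfl⟩ : x = x' ∧ z = z' := by
      rcases Sym2.eq_iff.1 (hβ.symm.trans hβ') with h | ⟨rfl, rfl⟩
      · exact h
      · exact absurd h1 (lt_asymm hxz)
    refine ⟨w, y, h2, ⟨ν, hνu, hν⟩, ?_, ⟨μ, hμu, hμ⟩⟩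
    rintro rfl
    simp at hnd
  · rintro ⟨w, y, hzw, ⟨ν, hνu, hν⟩, hyz, ⟨μ, hμu, hμ⟩⟩
    exact ⟨x, y, z, w, μ, ν, isBridged_of_lt hP hμ hν hβ hμu hνu hxz hzw hyz⟩

/-- The conditions for a gap in terms of the tree: for `y < z` all edges at `y` are greater than
`zw`, so the last condition is void, and for `z < y` it says that `xy` is the only edge at `y`. -/
lemma isGapBridge_iff (hP : HasUniqueParents G) {u : EdgeSymbol G} {β : G.edgeSet} {x z : V}
    (hβ : (β : Sym2 V) = s(x, z)) (hxz : x < z) :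
    IsGapBridge u β ↔ ¬ HasEdge u x z ∧ GapAt u x z := by
  rw [hasEdge_iff hβ, IsGapBridge]
  constructor
  · rintro ⟨x', y, z', w, μ, ν, h, hβu, hw, hy⟩
    obtain ⟨h1, h2⟩ := h.lt_lt hP
    obtain ⟨hnd, hμ, hν, hβ', hμu, hνu, -⟩ := h
    obtain ⟨rfl, rfl⟩ : x = x' ∧ z = z' := by
      rcases Sym2.eq_iff.1 (hβ.symm.trans hβ') with h | ⟨rfl, rfl⟩
      · exact h
      · exact absurd h1 (lt_asymm hxz)
    have hyz : y ≠ z := by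
      rintro rfl
      simp at hnd
    refine ⟨hβu, w, y, h2, ⟨ν, hνu, hν⟩, ?_, hyz, ⟨μ, hμu, hμ⟩, ?_⟩
    · rintro t ⟨κ, hκu, hκ⟩
      have := hw κ hκu (by simp [hκ])
      subst this
      rcases Sym2.eq_iff.1 (hκ.symm.trans hν) with ⟨h3, h4⟩ | ⟨-, h⟩
      · exact absurd h3 h2.ne'
      · exact h
    · by_contra hcon
      push Not at hcon
      obtain ⟨hzy, t, ⟨κ, hκu, hκ⟩, htx⟩ := hcon
      have hzy' := lt_of_le_of_ne hzy (Ne.symm hyz)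
      have aμ : G.Adj x y := by have := μ.2; rwa [hμ, SimpleGraph.mem_edgeSet] at this
      have aκ : G.Adj y t := by have := κ.2; rwa [hκ, SimpleGraph.mem_edgeSet] at this
      have hyt : y < t := by
        by_contra hcon
        have := lt_of_le_of_ne (not_lt.1 hcon) aκ.ne'
        exact htx (hP aμ aκ.symm (hxz.trans hzy') this).symm
      exact hy κ hκu ((smaller_iff hν hκ h2 hyt).2 (Or.inl hzy')) (by simp [hκ])
  · rintro ⟨hβu, w, y, hzw, ⟨ν, hνu, hν⟩, hw, hyz, ⟨μ, hμu, hμ⟩, hy⟩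
    refine ⟨x, y, z, w, μ, ν, isBridged_of_lt hP hμ hν hβ hμu hνu hxz hzw hyz, hβu, ?_, ?_⟩
    · intro κ hκu hκ
      obtain ⟨t, ht⟩ := hκ
      have := hw t ⟨κ, hκu, ht⟩
      subst this
      exact Subtype.ext (ht.trans (Sym2.eq_swap.trans hν.symm))
    · rintro κ hκu hκν ⟨t, ht⟩
      rcases hy with hy | hy
      · refine lt_asymm (a := toLex (edgeExp κ)) hκν (smaller_of_lt_lt ht hν hy hzw)
      · have := hy t ⟨κ, hκu, ht⟩
        subst this
        exact lt_asymm (a := toLex (edgeExp κ)) hκν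
          (smaller_of_lt_lt (ht.trans Sym2.eq_swap) hν hxz hzw)

lemma candAt_iff (hP : HasUniqueParents G) {u : EdgeSymbol G} {β : G.edgeSet} {x z : V}
    (hβ : (β : Sym2 V) = s(x, z)) (hxz : x < z) :
    IsGapBridge u β ∨ IsBridgeOf u β ↔ CandAt u x z := by
  rw [isGapBridge_iff hP hβ hxz, isBridgeOf_iff hP hβ hxz, CandAt, or_comm]

end Vertices

section Vertices

variable {V : Type u} [LinearOrder V] {G : SimpleGraph V}

/-! ### The last candidate of a symbol -/

/-- Two neighbours of `a`, the first of which is its parent: the second one is a child. -/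
lemma HasUniqueParents.lt_of_ne (hP : HasUniqueParents G) {p a b : V} (hp : G.Adj p a) (hpa : p < a)
    (hb : G.Adj a b) (hne : b ≠ p) : a < b := by
  by_contra hcon
  exact hne (hP hb.symm hp (lt_of_le_of_ne (not_lt.1 hcon) hb.ne') hpa)

/-- If no later edge is a bridge, then removing a bridge creates a gap. -/
lemma Bridged.gapAt (hP : HasUniqueParents G) {u : EdgeSymbol G} {x z : V} (hE : HasEdge u x z)
    (hxz : x < z) (hB : Bridged u x z)
    (hlast : ∀ x' z', HasEdge u x' z' → x' < z' → Bridged u x' z' → ¬ Later x z x' z') :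
    GapAt u x z := by
  obtain ⟨w, y, hzw, hw, hyz, hy⟩ := hB
  refine ⟨w, y, hzw, hw, fun t ht => ?_, hyz, hy, ?_⟩
  · by_contra hne
    exact hlast z w hw hzw ⟨t, x, hP.lt_of_ne hw.adj hzw ht.adj hne, ht, (hxz.trans hzw).ne,
      hE.symm⟩ (Or.inl hxz)
  · by_contra hcon
    push Not at hcon
    obtain ⟨hzy, t, ht, htx⟩ := hcon
    have hzy := lt_of_le_of_ne hzy (Ne.symm hyz)
    exact hlast x y hy (hxz.trans hzy) ⟨t, z, hP.lt_of_ne hy.adj (hxz.trans hzy) ht.adj htx, ht,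
      hzy.ne, hE⟩ (Or.inr ⟨rfl, hzy⟩)

/-- The symbols `u` and `u'` differ at most in the edge `xz`. -/
def AgreeOff (u u' : EdgeSymbol G) (x z : V) : Prop :=
  ∀ a b, ¬ (a = x ∧ b = z) → ¬ (a = z ∧ b = x) → (HasEdge u a b ↔ HasEdge u' a b)

lemma AgreeOff.symm {u u' : EdgeSymbol G} {x z : V} (h : AgreeOff u u' x z) : AgreeOff u' u x z :=
  fun a b h1 h2 => (h a b h1 h2).symm

lemma GapAt.of_agreeOff {u u' : EdgeSymbol G} {x z : V} (h : AgreeOff u u' x z) (hxz : x < z)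
    (hg : GapAt u x z) : GapAt u' x z := by
  obtain ⟨w, y, hzw, hw, hw', hyz, hy, hy'⟩ := hg
  have hyx := hy.adj.ne'
  refine ⟨w, y, hzw, (h z w ?_ ?_).1 hw, fun t ht => hw' t ((h w t ?_ ?_).2 ht), hyz,
    (h x y ?_ ?_).1 hy, hy'.imp_right fun hy' t ht => hy' t ((h y t ?_ ?_).2 ht)⟩
  all_goals rintro ⟨h1, h2⟩; order

/-- Toggling an edge `xz` that satisfies the condition for a gap creates no later candidate. -/
lemma CandAt.of_agreeOff (hP : HasUniqueParents G) {u u' : EdgeSymbol G} {x z x' z' : V}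
    (h : AgreeOff u u' x z) (hadj : G.Adj x z) (hxz : x < z) (hg : GapAt u x z) (hxz' : x' < z')
    (hl : Later x z x' z') (hc : CandAt u' x' z') : CandAt u x' z' := by
  have hle : x ≤ x' := hl.elim le_of_lt fun h => h.1.le
  have hE : HasEdge u x' z' ↔ HasEdge u' x' z' := by
    refine h _ _ ?_ ?_
    · rintro ⟨rfl, rfl⟩
      rcases hl with hl | ⟨-, hl⟩ <;> exact lt_irrefl _ hl
    · rintro ⟨rfl, rfl⟩
      order
  obtain ⟨w, y, hzw, hw, hw', hyz, hy, hy'⟩ := hg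
  -- The only edge of the candidate that may be missing from `u` is the toggled one, in the position
  -- of `x'y'`; if it is, then `xy` takes its place for `x' = x`, and `zw` for `x' = z`.
  rcases hc with ⟨hc, w', y', hzw', hE', hyz', hy1'⟩ |
    ⟨hc, w', y', hzw', hE', hw1', hyz', hy1', hy2'⟩
  · refine Or.inl ⟨hE.2 hc, ?_⟩
    have hE'' : HasEdge u z' w' := (h _ _ (by rintro ⟨rfl, rfl⟩; order)
      (by rintro ⟨rfl, rfl⟩; order)).2 hE'
    by_cases h1 : x' = x ∧ y' = z
    · obtain ⟨rfl, rfl⟩ := h1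
      have hlt : y' < z' := hl.elim (fun h => absurd h (lt_irrefl _)) And.right
      refine ⟨w', y, hzw', hE'', ?_, hy⟩
      rintro rfl
      rcases hy' with hy' | hy'
      · order
      · have := hy' w' hE''
        order
    · by_cases h2 : x' = z ∧ y' = x
      · obtain ⟨rfl, rfl⟩ := h2
        refine ⟨w', w, hzw', hE'', ?_, hw⟩
        rintro rfl
        have := hw' _ hE''
        order
      · exact ⟨w', y', hzw', hE'', hyz', (h _ _ h1 h2).2 hy1'⟩
  · refine Or.inr ⟨fun h => hc (hE.1 h), ?_⟩
    have hE'' : HasEdge u z' w' := (h _ _ (by rintro ⟨rfl, rfl⟩; order)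
      (by rintro ⟨rfl, rfl⟩; order)).2 hE'
    have hwt : ∀ t, HasEdge u w' t → t = z' := by
      intro t ht
      refine hw1' t ((h _ _ ?_ ?_).1 ht)
      · rintro ⟨rfl, rfl⟩
        order
      · rintro ⟨rfl, rfl⟩
        have := hP hadj hE''.adj hxz hzw'
        order
    by_cases h1 : x' = x ∧ y' = z
    · obtain ⟨rfl, rfl⟩ := h1
      have hlt : y' < z' := hl.elim (fun h => absurd h (lt_irrefl _)) And.right
      refine ⟨w', y, hzw', hE'', hwt, ?_, hy, hy'.imp_left fun h => h.trans hlt⟩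
      rintro rfl
      exact hc (hE.1 hy)
    · by_cases h2 : x' = z ∧ y' = x
      · obtain ⟨rfl, rfl⟩ := h2
        refine ⟨w', w, hzw', hE'', hwt, ?_, hw, Or.inr hw'⟩
        rintro rfl
        exact hc (hE.1 hw)
      · refine ⟨w', y', hzw', hE'', hwt, hyz', (h _ _ h1 h2).2 hy1', ?_⟩
        by_cases hlt : y' < z'
        · exact Or.inl hlt
        · refine Or.inr fun t ht => hy2'.resolve_left hlt t ((h _ _ ?_ ?_).1 ht)
          · rintro ⟨rfl, rfl⟩
            order
          · rintro ⟨rfl, rfl⟩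
            have h3 : x' ≠ t := fun h => h1 ⟨h, rfl⟩
            rcases lt_or_gt_of_ne hy1'.adj.ne with h4 | h4
            · exact h3 (hP hy1'.adj hadj h4 hxz)
            · order

/-- The last candidate moves backwards when a symbol is enlarged without changing its support. -/
lemma CandAt.exists_of_subset (hP : HasUniqueParents G) {u t : EdgeSymbol G} (hut : u ⊆ t)
    (hsupp : ∀ a b, HasEdge t a b → ∃ c, HasEdge u a c) {x z : V} (hxz : x < z)
    (hc : CandAt u x z) :
    CandAt t x z ∨ ∃ x' z', x' < z' ∧ HasEdge t x' z' ∧ CandAt t x' z' ∧ Later x z x' z' := by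
  by_cases hE : HasEdge t x z
  · refine Or.inl (Or.inl ⟨hE, ?_⟩)
    have : Bridged u x z := hc.elim And.right fun h => h.2.bridged
    obtain ⟨w, y, h1, h2, h3, h4⟩ := this
    exact ⟨w, y, h1, h2.mono hut, h3, h4.mono hut⟩
  · have hg : GapAt u x z := hc.elim (fun h => absurd (h.1.mono hut) hE) And.right
    obtain ⟨w, y, hzw, hw, hw', hyz, hy, hy'⟩ := hg
    by_cases hwt : ∀ s, HasEdge t w s → s = z
    · by_cases hyt : y < z ∨ ∀ s, HasEdge t y s → s = x
      · exact Or.inl (Or.inr ⟨hE, w, y, hzw, hw.mono hut, hwt, hyz, hy.mono hut, hyt⟩)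
      · push Not at hyt
        obtain ⟨hzy, s, hs, hsx⟩ := hyt
        have hzy := lt_of_le_of_ne hzy (Ne.symm hyz)
        have hys := hP.lt_of_ne hy.adj (hxz.trans hzy) hs.adj hsx
        have hus : ¬ HasEdge u y s := fun h => hsx (hy'.resolve_left hzy.not_gt s h)
        obtain ⟨q, hq⟩ := hsupp s y hs.symm
        have hqy : q ≠ y := by
          rintro rfl
          exact hus hq.symm
        exact Or.inr ⟨y, s, hys, hs, Or.inl ⟨hs, q, x, hP.lt_of_ne hs.adj hys hq.adj hqy,
          hq.mono hut, ((hxz.trans hzy).trans hys).ne, (hy.mono hut).symm⟩,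
          Or.inl (hxz.trans hzy)⟩
    · push Not at hwt
      obtain ⟨s, hs, hsz⟩ := hwt
      have hws := hP.lt_of_ne hw.adj hzw hs.adj hsz
      have hus : ¬ HasEdge u w s := fun h => hsz (hw' s h)
      obtain ⟨q, hq⟩ := hsupp s w hs.symm
      have hqw : q ≠ w := by
        rintro rfl
        exact hus hq.symm
      exact Or.inr ⟨w, s, hws, hs, Or.inl ⟨hs, q, z, hP.lt_of_ne hs.adj hws hq.adj hqw,
        hq.mono hut, (hzw.trans hws).ne, (hw.mono hut).symm⟩, Or.inl (hxz.trans hzw)⟩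

/-- Symbols without candidates that have the same support cannot differ first, counted from the
end, in an edge that belongs to `u` and not to `t`. -/
lemma hasEdge_of_no_cand (hP : HasUniqueParents G) {u t : EdgeSymbol G}
    (hsupp : ∀ a b, HasEdge u a b → ∃ c, HasEdge t a c)
    (hu : ∀ x z, G.Adj x z → x < z → ¬ CandAt u x z)
    (ht : ∀ x z, G.Adj x z → x < z → ¬ CandAt t x z) {x z : V} (hxz : x < z)
    (hlater : ∀ x' z', x' < z' → Later x z x' z' → (HasEdge u x' z' ↔ HasEdge t x' z'))
    (hE : HasEdge u x z) : HasEdge t x z := by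
  by_contra hEt
  obtain ⟨w, hw⟩ := hsupp z x hE.symm
  have hwx : w ≠ x := by
    rintro rfl
    exact hEt hw.symm
  have hzw := hP.lt_of_ne hE.adj hxz hw.adj hwx
  obtain ⟨y, hy⟩ := hsupp x z hE
  have hyz : y ≠ z := by
    rintro rfl
    exact hEt hy
  have hwu := (hlater z w hzw (Or.inl hxz)).2 hw
  refine ht x z hE.adj hxz (Or.inr ⟨hEt, w, y, hzw, hw, fun s hs => ?_, hyz, hy, ?_⟩)
  · by_contra hsz
    have hws := hP.lt_of_ne hw.adj hzw hs.adj hsz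
    have hs' := (hlater w s hws (Or.inl (hxz.trans hzw))).2 hs
    exact hu z w hw.adj hzw (Or.inl ⟨hwu, s, x, hws, hs', (hxz.trans hzw).ne, hE.symm⟩)
  · by_contra hcon
    push Not at hcon
    have hzy := lt_of_le_of_ne hcon.1 (Ne.symm hyz)
    have hyu := (hlater x y (hxz.trans hzy) (Or.inr ⟨rfl, hzy⟩)).2 hy
    exact hu x z hE.adj hxz (Or.inl ⟨hE, w, y, hzw, hwu, hyz, hyu⟩)

end Vertices

section Pivot

variable {V : Type u} [LinearOrder V] {G : SimpleGraph V}

attribute [local instance] edgeOrder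

/-! ### The pivot of a symbol -/

lemma hasEdge_insert {u : EdgeSymbol G} {β : G.edgeSet} {a b : V} :
    HasEdge (insert β u) a b ↔ (β : Sym2 V) = s(a, b) ∨ HasEdge u a b := by
  simp [HasEdge]

lemma agreeOff_insert {u : EdgeSymbol G} {β : G.edgeSet} {x z : V} (hβ : (β : Sym2 V) = s(x, z)) :
    AgreeOff u (insert β u) x z := by
  intro a b h1 h2
  rw [hasEdge_insert, or_iff_right]
  rw [hβ, Sym2.eq_iff]
  rintro (⟨rfl, rfl⟩ | ⟨rfl, rfl⟩) <;> simp at h1 h2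

lemma agreeOff_erase {u : EdgeSymbol G} {β : G.edgeSet} {x z : V} (hβ : (β : Sym2 V) = s(x, z)) :
    AgreeOff u (u.erase β) x z := by
  by_cases h : β ∈ u
  · have := (agreeOff_insert (u := u.erase β) hβ).symm
    rwa [Finset.insert_erase h] at this
  · rw [Finset.erase_eq_of_notMem h]
    exact fun _ _ _ _ => Iff.rfl

/-- `β` is the smallest monomial among the bridges of `u` and the bridges of gaps of `u`. -/
def IsPivot (u : EdgeSymbol G) (β : G.edgeSet) : Prop :=
  (IsGapBridge u β ∨ IsBridgeOf u β) ∧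
    ∀ γ, IsGapBridge u γ ∨ IsBridgeOf u γ → γ = β ∨ Smaller β γ

lemma isPivot_iff (hP : HasUniqueParents G) {u : EdgeSymbol G} {β : G.edgeSet} {x z : V}
    (hβ : (β : Sym2 V) = s(x, z)) (hxz : x < z) :
    IsPivot u β ↔ CandAt u x z ∧
      ∀ x' z', G.Adj x' z' → x' < z' → CandAt u x' z' → ¬ Later x z x' z' := by
  rw [IsPivot, candAt_iff hP hβ hxz]
  refine and_congr_right fun _ => ⟨fun h x' z' hadj hxz' hc hl => ?_, fun h γ hγ => ?_⟩
  · set γ : G.edgeSet := ⟨s(x', z'), hadj⟩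
    have hγ : (γ : Sym2 V) = s(x', z') := rfl
    have hs := (smaller_iff hβ hγ hxz hxz').2 hl
    rcases h γ ((candAt_iff hP hγ hxz').2 hc) with h | h
    · rw [h] at hs
      exact lt_irrefl _ hs
    · exact lt_asymm (a := toLex (edgeExp β)) h hs
  · obtain ⟨x', z', hxz', hadj, hγ'⟩ := exists_lt_eq γ
    rcases (edgeOrder G).le_total γ β with hle | hle
    · rcases @eq_or_lt_of_le _ (edgeOrder G).toPartialOrder _ _ hle with h' | h'
      · exact Or.inl h'
      · exact Or.inr h'
    · rcases @eq_or_lt_of_le _ (edgeOrder G).toPartialOrder _ _ hle with h' | h'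
      · exact Or.inl h'.symm
      · exact absurd ((smaller_iff hβ hγ' hxz hxz').1 h')
          (h x' z' hadj hxz' ((candAt_iff hP hγ' hxz').1 hγ))

lemma IsPivot.gapAt (hP : HasUniqueParents G) {u : EdgeSymbol G} {β : G.edgeSet} {x z : V}
    (hβ : (β : Sym2 V) = s(x, z)) (hxz : x < z) (h : IsPivot u β) : GapAt u x z := by
  obtain ⟨hc, hl⟩ := (isPivot_iff hP hβ hxz).1 h
  rcases hc with ⟨hE, hB⟩ | ⟨-, hg⟩
  · exact hB.gapAt hP hE hxz fun x' z' hE' hlt hB' => hl x' z' hE'.adj hlt (Or.inl ⟨hE', hB'⟩)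
  · exact hg

lemma IsPivot.of_agreeOff (hP : HasUniqueParents G) {u u' : EdgeSymbol G} {β : G.edgeSet} {x z : V}
    (hβ : (β : Sym2 V) = s(x, z)) (hxz : x < z) (ha : AgreeOff u u' x z) (h : IsPivot u β) :
    IsPivot u' β := by
  have hg := h.gapAt hP hβ hxz
  have hg' := hg.of_agreeOff ha hxz
  have hadj : G.Adj x z := by have := β.2; rwa [hβ, SimpleGraph.mem_edgeSet] at this
  rw [isPivot_iff hP hβ hxz] at h ⊢
  refine ⟨?_, fun x' z' hadj' hxz' hc hl =>
    h.2 x' z' hadj' hxz' (hc.of_agreeOff hP ha hadj hxz hg hxz' hl) hl⟩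
  by_cases hE : HasEdge u' x z
  · exact Or.inl ⟨hE, hg'.bridged⟩
  · exact Or.inr ⟨hE, hg'⟩

lemma IsPivot.insert (hP : HasUniqueParents G) {u : EdgeSymbol G} {β : G.edgeSet}
    (h : IsPivot u β) : IsPivot (insert β u) β := by
  obtain ⟨x, z, hxz, -, hβ⟩ := exists_lt_eq β
  exact h.of_agreeOff hP hβ hxz (agreeOff_insert hβ)

lemma IsPivot.erase (hP : HasUniqueParents G) {u : EdgeSymbol G} {β : G.edgeSet}
    (h : IsPivot u β) : IsPivot (u.erase β) β := by
  obtain ⟨x, z, hxz, -, hβ⟩ := exists_lt_eq β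
  exact h.of_agreeOff hP hβ hxz (agreeOff_erase hβ)

lemma IsPivot.unique {u : EdgeSymbol G} {β γ : G.edgeSet} (hβ : IsPivot u β) (hγ : IsPivot u γ) :
    β = γ := by
  rcases hβ.2 γ hγ.1 with h | h
  · exact h.symm
  · rcases hγ.2 β hβ.1 with h' | h'
    · exact h'
    · exact absurd h' (lt_asymm (a := toLex (edgeExp β)) h)

lemma exists_isPivot [Finite V] {u : EdgeSymbol G} {β : G.edgeSet}
    (h : IsGapBridge u β ∨ IsBridgeOf u β) : ∃ γ, IsPivot u γ := by
  obtain ⟨γ, hγ, hmax⟩ := Set.exists_max_image {β | IsGapBridge u β ∨ IsBridgeOf u β} id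
    (Set.toFinite _) ⟨β, h⟩
  refine ⟨γ, hγ, fun δ hδ => ?_⟩
  exact @eq_or_lt_of_le _ (edgeOrder G).toPartialOrder _ _ (hmax δ hδ)

open scoped Classical in
/-- The pivot of a symbol, if the symbol has a bridge or a gap. -/
noncomputable def symbolPivot (u : EdgeSymbol G) : Option G.edgeSet :=
  if h : ∃ β, IsPivot u β then some h.choose else none

lemma symbolPivot_eq_some {u : EdgeSymbol G} {β : G.edgeSet} :
    symbolPivot u = some β ↔ IsPivot u β := by
  unfold symbolPivot
  split_ifs with h
  · rw [Option.some.injEq]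
    constructor
    · rintro rfl
      exact h.choose_spec
    · exact fun hβ => h.choose_spec.unique hβ
  · simpa using fun hβ => h ⟨β, hβ⟩

lemma symbolPivot_eq_none [Finite V] {u : EdgeSymbol G} :
    symbolPivot u = none ↔ ∀ β, ¬ IsGapBridge u β ∧ ¬ IsBridgeOf u β := by
  rw [Option.eq_none_iff_forall_ne_some]
  simp only [ne_eq, symbolPivot_eq_some]
  constructor
  · intro h β
    rw [← not_or]
    intro hβ
    obtain ⟨γ, hγ⟩ := exists_isPivot hβ
    exact h γ hγ
  · intro h β hβ
    exact hβ.1.elim (h β).1 (h β).2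

lemma symbolPivot_eq_none_iff_candAt [Finite V] (hP : HasUniqueParents G) {u : EdgeSymbol G} :
    symbolPivot u = none ↔ ∀ x z, G.Adj x z → x < z → ¬ CandAt u x z := by
  rw [symbolPivot_eq_none]
  constructor
  · intro h x z hadj hxz hc
    have := (candAt_iff (β := ⟨s(x, z), hadj⟩) hP rfl hxz).2 hc
    exact this.elim (h _).1 (h _).2
  · intro h β
    obtain ⟨x, z, hxz, hadj, hβ⟩ := exists_lt_eq β
    rw [← not_or, candAt_iff hP hβ hxz]
    exact h x z hadj hxz

/-! ### Multidegrees of symbols -/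

lemma gr_apply (u : EdgeSymbol G) (v : V) [Decidable (∃ μ ∈ u, v ∈ (μ : Sym2 V))] :
    gr u v = if ∃ μ ∈ u, v ∈ (μ : Sym2 V) then 1 else 0 := by
  have h : gr u v = u.sup fun μ => edgeExp μ v :=
    Finset.apply_sup_eq_sup_comp (fun f : V →₀ ℕ => f v) (fun f g => Finsupp.sup_apply f g v) rfl
  rw [h]
  split_ifs with hv
  · obtain ⟨μ, hμ, hv⟩ := hv
    refine le_antisymm (Finset.sup_le fun ν _ => ?_) ?_
    · rw [edgeExp_apply]; split_ifs <;> simp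
    · refine le_trans ?_ (Finset.le_sup hμ)
      rw [edgeExp_apply, if_pos hv]
  · rw [← Nat.bot_eq_zero, Finset.sup_eq_bot_iff]
    intro ν hν
    rw [edgeExp_apply, if_neg fun h => hv ⟨ν, hν, h⟩, Nat.bot_eq_zero]

lemma exists_mem_iff_hasEdge {u : EdgeSymbol G} {v : V} :
    (∃ μ ∈ u, v ∈ (μ : Sym2 V)) ↔ ∃ c, HasEdge u v c := by
  constructor
  · rintro ⟨μ, hμ, c, hc⟩
    exact ⟨c, μ, hμ, hc⟩
  · rintro ⟨c, μ, hμ, hc⟩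
    exact ⟨μ, hμ, c, hc⟩

lemma gr_mono {u t : EdgeSymbol G} (h : u ⊆ t) : gr u ≤ gr t := Finset.sup_mono h

lemma gr_le_gr_iff {u t : EdgeSymbol G} :
    gr u ≤ gr t ↔ ∀ a b, HasEdge u a b → ∃ c, HasEdge t a c := by
  classical
  constructor
  · intro h a b hab
    have := h a
    rw [gr_apply, gr_apply, if_pos (exists_mem_iff_hasEdge.2 ⟨b, hab⟩)] at this
    rw [← exists_mem_iff_hasEdge]
    by_contra hcon
    rw [if_neg hcon] at this
    exact absurd this (by norm_num)
  · intro h a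
    rw [gr_apply, gr_apply]
    split_ifs with h1 h2 <;> simp
    obtain ⟨b, hb⟩ := exists_mem_iff_hasEdge.1 h1
    exact h2 (exists_mem_iff_hasEdge.2 (h a b hb))

/-- Toggling the pivot does not change the multidegree. -/
lemma IsPivot.gr_insert (hP : HasUniqueParents G) {u : EdgeSymbol G} {β : G.edgeSet}
    (h : IsPivot u β) : gr (Insert.insert β u) = gr (u.erase β) := by
  refine le_antisymm ?_ (gr_mono ((Finset.erase_subset _ _).trans (Finset.subset_insert _ _)))
  obtain ⟨x, z, hxz, -, hβ⟩ := exists_lt_eq β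
  obtain ⟨w, y, -, hw, -, -, hy, -⟩ := (h.erase hP).gapAt hP hβ hxz
  rw [gr_le_gr_iff]
  intro a b hab
  by_cases h1 : (β : Sym2 V) = s(a, b)
  · rw [hβ, Sym2.eq_iff] at h1
    rcases h1 with ⟨rfl, rfl⟩ | ⟨rfl, rfl⟩
    · exact ⟨y, hy⟩
    · exact ⟨w, hw⟩
  · obtain ⟨μ, hμ, hμab⟩ := hab
    refine ⟨b, μ, Finset.mem_erase.2 ⟨?_, (Finset.mem_insert.1 hμ).resolve_left ?_⟩, hμab⟩ <;>
    · rintro rfl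
      exact h1 hμab

/-- A symbol with neither bridges nor gaps is determined by its multidegree. -/
lemma eq_of_gr_eq [Finite V] (hP : HasUniqueParents G) {u t : EdgeSymbol G}
    (hu : symbolPivot u = none) (ht : symbolPivot t = none) (h : gr u = gr t) : u = t := by
  rw [symbolPivot_eq_none_iff_candAt hP] at hu ht
  by_contra hne
  -- Compare the two symbols at the smallest monomial that belongs to only one of them.
  obtain ⟨μ, hμ, hmax⟩ := Set.exists_max_image {μ : G.edgeSet | ¬ (μ ∈ u ↔ μ ∈ t)} id
    (Set.toFinite _) (by
      by_contra hcon
      rw [Set.not_nonempty_iff_eq_empty, Set.eq_empty_iff_forall_notMem] at hcon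
      exact hne (Finset.ext fun μ => not_not.1 (hcon μ)))
  obtain ⟨x, z, hxz, hadj, hμxz⟩ := exists_lt_eq μ
  have hlater : ∀ x' z', x' < z' → Later x z x' z' → (HasEdge u x' z' ↔ HasEdge t x' z') := by
    intro x' z' hxz' hl
    by_cases hadj' : G.Adj x' z'
    · set ν : G.edgeSet := ⟨s(x', z'), hadj'⟩
      have hν : (ν : Sym2 V) = s(x', z') := rfl
      rw [hasEdge_iff hν, hasEdge_iff hν]
      by_contra hcon
      exact absurd ((smaller_iff hμxz hν hxz hxz').2 hl)
        (@not_lt_of_ge _ (edgeOrder G).toPreorder _ _ (hmax ν hcon))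
    · exact ⟨fun h => absurd h.adj hadj', fun h => absurd h.adj hadj'⟩
  refine hμ ?_
  rw [← hasEdge_iff hμxz, ← hasEdge_iff hμxz]
  exact ⟨hasEdge_of_no_cand hP (gr_le_gr_iff.1 h.le) hu ht hxz hlater,
    hasEdge_of_no_cand hP (gr_le_gr_iff.1 h.ge) ht hu hxz
      fun x' z' h1 h2 => (hlater x' z' h1 h2).symm⟩

/-- The pivot of a symbol becomes smaller (or stays the same) when the symbol is enlarged without
changing its multidegree. -/
lemma exists_isPivot_of_subset [Finite V] (hP : HasUniqueParents G) {u t : EdgeSymbol G}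
    (hut : u ⊆ t) (hgr : gr u = gr t) {β : G.edgeSet} (h : IsPivot u β) :
    ∃ γ, IsPivot t γ ∧ (γ = β ∨ Smaller γ β) := by
  obtain ⟨x, z, hxz, hadj, hβ⟩ := exists_lt_eq β
  have hc := ((isPivot_iff hP hβ hxz).1 h).1
  obtain ⟨δ, hδ, hδβ⟩ : ∃ δ, (IsGapBridge t δ ∨ IsBridgeOf t δ) ∧ (δ = β ∨ Smaller δ β) := by
    rcases hc.exists_of_subset hP hut (gr_le_gr_iff.1 hgr.ge) hxz with hc' |
      ⟨x', z', hxz', ⟨δ, -, hδ⟩, hc', hl⟩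
    · exact ⟨β, (candAt_iff hP hβ hxz).2 hc', Or.inl rfl⟩
    · exact ⟨δ, (candAt_iff hP hδ hxz').2 hc', Or.inr ((smaller_iff hβ hδ hxz hxz').2 hl)⟩
  obtain ⟨γ, hγ⟩ := exists_isPivot hδ
  refine ⟨γ, hγ, ?_⟩
  rcases hγ.2 δ hδ with rfl | h1
  · exact hδβ
  · rcases hδβ with rfl | h2
    · exact Or.inr h1
    · exact Or.inr (lt_trans (b := toLex (edgeExp δ)) h1 h2)

end Pivot

section SymbolMatching

variable {V : Type u} [LinearOrder V] {G : SimpleGraph V}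

attribute [local instance] edgeOrder

/-! ### The matching on symbols -/

lemma mul_add_lt_mul_add {x y M c : ℕ} (c' : ℕ) (h : x < y) (hc : c < M) :
    x * M + c < y * M + c' := by
  have : (x + 1) * M ≤ y * M := Nat.mul_le_mul_right M h
  rw [Nat.add_mul, Nat.one_mul] at this
  omega

/-- The number of the pivot in the list of all edges; symbols without a pivot have position `0`. -/
noncomputable def pivotPosition (u : EdgeSymbol G) : ℕ :=
  (symbolPivot u).elim 0 fun β => {γ | Smaller β γ}.ncard + 1

lemma pivotPosition_lt [Finite V] (u : EdgeSymbol G) :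
    pivotPosition u < Nat.card G.edgeSet + 1 := by
  unfold pivotPosition
  rcases symbolPivot u with _ | β
  · simp
  · simp only [Option.elim_some]
    have : {γ | Smaller β γ} ≠ Set.univ := fun h => by
      have : β ∈ {γ | Smaller β γ} := h ▸ Set.mem_univ β
      exact lt_irrefl (toLex (edgeExp β)) this
    have := Set.ncard_lt_card this
    omega

lemma ncard_lt_of_smaller [Finite V] {β γ : G.edgeSet} (h : Smaller γ β) :
    {δ | Smaller β δ}.ncard < {δ | Smaller γ δ}.ncard := by
  refine Set.ncard_lt_ncard ⟨fun δ hδ => lt_trans (b := toLex (edgeExp β)) h hδ, fun hsub => ?_⟩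
    (Set.toFinite _)
  exact lt_irrefl (toLex (edgeExp β)) (hsub h)

/-- The lexicographic combination of the size of the support, the position of the pivot and the
number of elements other than the pivot. -/
noncomputable def symbolHeight (u : EdgeSymbol G) : ℕ :=
  ((gr u).support.card * (Nat.card G.edgeSet + 1) + pivotPosition u) * (Nat.card G.edgeSet + 1) +
    ((symbolPivot u).elim u fun β => u.erase β).card

lemma gr_support_card_lt {u t : EdgeSymbol G} (hut : u ⊆ t) (h : gr u ≠ gr t) :
    (gr u).support.card < (gr t).support.card := by
  refine Finset.card_lt_card ⟨Finsupp.support_mono (gr_mono hut), fun hsub => h ?_⟩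
  refine le_antisymm (gr_mono hut) fun v => ?_
  classical
  by_cases hv : v ∈ (gr t).support
  · have := Finsupp.mem_support_iff.1 (hsub hv)
    rw [gr_apply] at this ⊢
    rw [gr_apply]
    split_ifs at this ⊢ <;> simp_all
  · rw [Finsupp.notMem_support_iff.1 hv]
    exact Nat.zero_le _

/-- Along an inclusion the multidegree grows, or the pivot gets smaller, or both stay the same and
either an element other than the pivot is added or the two symbols are matched. -/
lemma symbolHeight_lt [Finite V] (hP : HasUniqueParents G) {u t : EdgeSymbol G} (hut : u ⊂ t)
    (hne : ∀ β, symbolPivot t = some β → u ≠ t.erase β) : symbolHeight u < symbolHeight t := by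
  have hcard : ∀ s : EdgeSymbol G,
      ((symbolPivot s).elim s fun β => s.erase β).card < Nat.card G.edgeSet + 1 := by
    intro s
    have := Fintype.ofFinite G.edgeSet
    rw [Nat.card_eq_fintype_card, Nat.lt_succ_iff]
    exact Finset.card_le_univ _
  unfold symbolHeight
  by_cases hgr : gr u = gr t
  · rw [hgr]
    have hlt : ∀ {a b : ℕ}, a < b → (gr t).support.card * (Nat.card G.edgeSet + 1) + a <
        (gr t).support.card * (Nat.card G.edgeSet + 1) + b := fun h => by omega
    rcases hu : symbolPivot u with _ | β
    · rcases ht : symbolPivot t with _ | γ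
      · rw [pivotPosition, pivotPosition, hu, ht]
        exact Nat.add_lt_add_left (Finset.card_lt_card hut) _
      · refine mul_add_lt_mul_add _ (hlt ?_) (by simpa [hu] using hcard u)
        rw [pivotPosition, pivotPosition, hu, ht]
        simp
    · obtain ⟨γ, hγ, hγβ⟩ := exists_isPivot_of_subset hP hut.1 hgr (symbolPivot_eq_some.1 hu)
      have ht := symbolPivot_eq_some.2 hγ
      rcases hγβ with rfl | hγβ
      · rw [pivotPosition, pivotPosition, hu, ht]
        refine Nat.add_lt_add_left (Finset.card_lt_card ?_) _
        refine ⟨Finset.erase_subset_erase _ hut.1, fun hsub => ?_⟩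
        have heq : u.erase γ = t.erase γ :=
          Finset.Subset.antisymm (Finset.erase_subset_erase _ hut.1) hsub
        by_cases hγu : γ ∈ u
        · refine hut.2 fun δ hδ => ?_
          by_cases hδγ : δ = γ
          · exact hδγ ▸ hγu
          · exact Finset.mem_of_mem_erase (hsub (Finset.mem_erase.2 ⟨hδγ, hδ⟩))
        · exact hne γ ht (by rw [← heq, Finset.erase_eq_of_notMem hγu])
      · refine mul_add_lt_mul_add _ (hlt ?_) (by simpa [hu] using hcard u)
        rw [pivotPosition, pivotPosition, hu, ht]
        exact Nat.add_lt_add_right (ncard_lt_of_smaller hγβ) 1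
  · refine mul_add_lt_mul_add _ (mul_add_lt_mul_add _ (gr_support_card_lt hut.1 hgr) ?_) (hcard u)
    exact pivotPosition_lt u

/-- The matching of the symbols by insertion and removal of the pivot. -/
noncomputable def symbolMatching [Finite V] (hP : HasUniqueParents G) :
    PivotMatching G.edgeSet where
  pivot := symbolPivot
  height := symbolHeight
  pivot_insert h := symbolPivot_eq_some.2 ((symbolPivot_eq_some.1 h).insert hP)
  pivot_erase h := symbolPivot_eq_some.2 ((symbolPivot_eq_some.1 h).erase hP)
  erase_nonempty {S β} h := by
    obtain ⟨x, z, hxz, -, hβ⟩ := exists_lt_eq β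
    obtain ⟨w, y, -, ⟨μ, hμ, -⟩, -⟩ := ((symbolPivot_eq_some.1 h).erase hP).gapAt hP hβ hxz
    exact ⟨μ, hμ⟩
  height_insert {S β} h := by
    have h' := symbolPivot_eq_some.1 h
    have h1 := symbolPivot_eq_some.2 (h'.insert hP)
    have h2 := symbolPivot_eq_some.2 (h'.erase hP)
    rw [symbolHeight, symbolHeight, pivotPosition, pivotPosition, h1, h2, h'.gr_insert hP]
    simp
  height_lt h hne := symbolHeight_lt hP h hne

variable [Finite V]

lemma symbolMatching_pivot (hP : HasUniqueParents G) {u : EdgeSymbol G} {β : G.edgeSet} :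
    (symbolMatching hP).pivot u = some β ↔ IsPivot u β := symbolPivot_eq_some

lemma symbolMatching_respects (hP : HasUniqueParents G) (m : V →₀ ℕ) {D : EdgeSymbol G}
    (hD : ∀ μ, μ ∈ D ↔ edgeExp μ ≤ m) : (symbolMatching hP).Respects D := by
  intro S β h hS
  have h' := (symbolMatching_pivot hP).1 h
  rw [hD]
  refine le_trans (Finset.le_sup (f := edgeExp) (Finset.mem_insert_self β S)) ?_
  change gr (Insert.insert β S) ≤ m
  rw [h'.gr_insert hP]
  exact Finset.sup_le fun μ hμ => (hD μ).1 (hS hμ)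

/-- The edges in `A` are those that insert a missing pivot: if the pivot is missing, it is the
bridge of a gap, and no bridge of the symbol is smaller. -/
lemma inA_iff {u u' : EdgeSymbol G} :
    InA u u' ↔ ∃ β, β ∉ u' ∧ IsPivot u' β ∧ u = insert β u' := by
  constructor
  · rintro ⟨⟨β', hβ', hmin⟩, β, hβ, hsm, rfl⟩
    have hnot : β ∉ u' := by
      obtain ⟨x, y, z, w, μ, ν, -, h, -⟩ := hβ
      exact h
    refine ⟨β, hnot, ⟨Or.inl hβ, fun γ hγ => ?_⟩, rfl⟩
    rcases hγ with hγ | hγ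
    · exact hsm γ hγ
    · rcases @eq_or_lt_of_le _ (edgeOrder G).toPartialOrder _ _
        (@le_of_not_gt _ (edgeOrder G) _ _ (hmin γ hγ)) with rfl | h
      · exact absurd hγ.1 (by
          obtain ⟨x, y, z, w, μ, ν, -, h, -⟩ := hβ'
          exact h)
      · rcases hsm β' hβ' with rfl | h'
        · exact Or.inr h
        · exact Or.inr (lt_trans (b := toLex (edgeExp β')) h' h)
  · rintro ⟨β, hβ, ⟨hc, hsm⟩, rfl⟩
    have hg : IsGapBridge u' β := hc.resolve_right fun h => hβ h.1
    refine ⟨⟨β, hg, fun κ hκ hs => ?_⟩, β, hg, fun γ hγ => hsm γ (Or.inl hγ), rfl⟩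
    rcases hsm κ (Or.inr hκ) with rfl | h
    · exact hβ hκ.1
    · exact lt_asymm (a := toLex (edgeExp κ)) hs h

lemma InA.isFacet {u u' : EdgeSymbol G} (h : InA u u') : IsFacet u u' := by
  obtain ⟨β, hβ, -, rfl⟩ := inA_iff.1 h
  exact ⟨Finset.subset_insert _ _, Finset.card_insert_of_notMem hβ⟩

lemma inA_erase (hP : HasUniqueParents G) {u : EdgeSymbol G} {β : G.edgeSet} (h : IsPivot u β)
    (hβ : β ∈ u) : InA u (u.erase β) :=
  inA_iff.2 ⟨β, Finset.notMem_erase β u, h.erase hP, (Finset.insert_erase hβ).symm⟩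

lemma IsFacet.exists_eq_erase {u u' : EdgeSymbol G} (h : IsFacet u u') :
    ∃ β ∈ u, u' = u.erase β := by
  obtain ⟨h1, h2⟩ := h
  have : (u \ u').card = 1 := by rw [Finset.card_sdiff_of_subset h1]; omega
  obtain ⟨β, hβ⟩ := Finset.card_eq_one.1 this
  have hmem : β ∈ u \ u' := hβ ▸ Finset.mem_singleton_self β
  refine ⟨β, (Finset.mem_sdiff.1 hmem).1, ?_⟩
  rw [← Finset.sdiff_singleton_eq_erase, ← hβ, Finset.sdiff_sdiff_eq_self h1]

lemma InA.upper (hP : HasUniqueParents G) {u u' : EdgeSymbol G} (h : InA u u') :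
    (symbolMatching hP).Upper u := by
  obtain ⟨β, hβ, hp, rfl⟩ := inA_iff.1 h
  exact ⟨β, Finset.mem_insert_self _ _, (symbolMatching_pivot hP).2 (hp.insert hP)⟩

lemma InA.lower (hP : HasUniqueParents G) {u u' : EdgeSymbol G} (h : InA u u') :
    (symbolMatching hP).Lower u' := by
  obtain ⟨β, hβ, hp, rfl⟩ := inA_iff.1 h
  exact ⟨β, hβ, (symbolMatching_pivot hP).2 hp⟩

lemma not_upper_of_lower {hP : HasUniqueParents G} {u : EdgeSymbol G}
    (h : (symbolMatching hP).Lower u) : ¬ (symbolMatching hP).Upper u := by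
  rintro ⟨z, hz, h'⟩
  obtain ⟨y, hy, h⟩ := h
  rw [h', Option.some.injEq] at h
  exact hy (h ▸ hz)

lemma InA.left_unique {u v u' : EdgeSymbol G} (h : InA u u') (h' : InA v u') : u = v := by
  obtain ⟨β, hβ, hp, rfl⟩ := inA_iff.1 h
  obtain ⟨γ, hγ, hp', rfl⟩ := inA_iff.1 h'
  rw [hp.unique hp']

lemma InA.right_unique (hP : HasUniqueParents G) {u u' v' : EdgeSymbol G} (h : InA u u')
    (h' : InA u v') : u' = v' := by
  obtain ⟨β, hβ, hp, rfl⟩ := inA_iff.1 h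
  obtain ⟨γ, hγ, hp', heq⟩ := inA_iff.1 h'
  have h1 := hp.insert hP
  rw [heq] at h1
  obtain rfl := h1.unique (hp'.insert hP)
  rw [← Finset.erase_insert hβ, heq, Finset.erase_insert hγ]

/-- The height is constant along the reversed steps and drops along all others. -/
lemma height_of_gradientStep (hP : HasUniqueParents G) {a b : EdgeSymbol G} (h : GradientStep a b) :
    symbolHeight b < symbolHeight a ∨ (symbolHeight b = symbolHeight a ∧ InA b a) := by
  rcases h with ⟨hf, hA⟩ | h
  · left
    refine symbolHeight_lt hP ⟨hf.1, fun hsub => ?_⟩ fun β hβ heq => ?_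
    · have := Finset.card_le_card hsub
      have := hf.2
      omega
    · have hp := symbolPivot_eq_some.1 hβ
      by_cases hβa : β ∈ a
      · exact hA (heq ▸ inA_erase hP hp hβa)
      · have := hf.2
        rw [heq, Finset.erase_eq_of_notMem hβa] at this
        omega
  · right
    refine ⟨?_, h⟩
    obtain ⟨β, hβ, hp, rfl⟩ := inA_iff.1 h
    have := (symbolMatching hP).height_insert ((symbolMatching_pivot hP).2 hp)
    rwa [Finset.erase_eq_of_notMem hβ] at this

/-- Heights rule out directed cycles, since two reversed steps cannot follow one another. -/
lemma not_transGen_self (hP : HasUniqueParents G) (u : EdgeSymbol G) :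
    ¬ Relation.TransGen GradientStep u u := by
  have key : ∀ b, Relation.TransGen GradientStep u b →
      symbolHeight b < symbolHeight u ∨ (symbolHeight b = symbolHeight u ∧ InA b u) := by
    intro b h
    induction h with
    | single h => exact height_of_gradientStep hP h
    | tail _ h ih =>
      left
      rcases ih with ih | ⟨ih, hA⟩ <;> rcases height_of_gradientStep hP h with h | ⟨h, hA'⟩
      · omega
      · omega
      · omega
      · exact absurd (hA.upper hP) (not_upper_of_lower (hA'.lower hP))
  intro h
  rcases key u h with h | ⟨-, h⟩
  · exact lt_irrefl _ h
  · have := h.isFacet.2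
    omega

theorem isAcyclicMatching (hP : HasUniqueParents G) : IsAcyclicMatching G := by
  refine ⟨fun u u' h => h.isFacet, fun u u' v v' h h' heq => ?_, not_transGen_self hP⟩
  rcases heq with rfl | rfl | rfl | rfl
  · exact ⟨rfl, h.right_unique hP h'⟩
  · exact absurd (h.upper hP) (not_upper_of_lower (h'.lower hP))
  · exact absurd (h'.upper hP) (not_upper_of_lower (h.lower hP))
  · exact ⟨h.left_unique h', rfl⟩

lemma symbolPivot_eq_none_iff_inA (hP : HasUniqueParents G) {u : EdgeSymbol G} :
    symbolPivot u = none ↔ ∀ v, ¬ InA u v ∧ ¬ InA v u := by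
  constructor
  · intro h v
    constructor
    · intro hA
      obtain ⟨β, -, hp⟩ := hA.upper hP
      rw [show symbolPivot u = some β from hp] at h
      exact absurd h (by simp)
    · intro hA
      obtain ⟨β, -, hp⟩ := hA.lower hP
      rw [show symbolPivot u = some β from hp] at h
      exact absurd h (by simp)
  · intro h
    rw [Option.eq_none_iff_forall_ne_some]
    intro β hβ
    rw [symbolPivot_eq_some] at hβ
    by_cases hβu : β ∈ u
    · exact (h _).1 (inA_erase hP hβ hβu)
    · exact (h _).2 (inA_iff.2 ⟨β, hβu, hβ, rfl⟩)

end SymbolMatching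

section Admissible

variable {V : Type u} [LinearOrder V] {G : SimpleGraph V}

/-! ### The unmatched symbols are the admissible ones -/

/-- `s` is an endpoint of the edge `hs` of `u` and of no other edge of `u`. -/
def IsLeafAt (u : EdgeSymbol G) (h s : V) : Prop :=
  HasEdge u h s ∧ ∀ t, HasEdge u s t → t = h

/-- `h` is the centre of a star that is a connected component of `u`; the centre of a single edge
is its endpoint closer to the root. -/
def IsCentre (u : EdgeSymbol G) (h : V) : Prop :=
  ∃ s, IsLeafAt u h s ∧ (h < s ∨ ∃ t, t ≠ s ∧ HasEdge u h t)

section NoCandidates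

variable {u : EdgeSymbol G}

/-- Without bridges, the connected components are stars. -/
lemma isLeafAt_or (hP : HasUniqueParents G) (hu : ∀ x z, G.Adj x z → x < z → ¬ CandAt u x z)
    {a b : V} (hab : HasEdge u a b) : IsLeafAt u a b ∨ IsLeafAt u b a := by
  have key : ∀ {a b : V}, HasEdge u a b → a < b → IsLeafAt u a b ∨ IsLeafAt u b a := by
    intro a b hab hlt
    by_contra hcon
    simp only [IsLeafAt, hab, hab.symm, true_and, not_or] at hcon
    push Not at hcon
    obtain ⟨⟨w, hw, hwa⟩, ⟨y, hy, hyb⟩⟩ := hcon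
    exact hu a b hab.adj hlt (Or.inl ⟨hab, w, y, hP.lt_of_ne hab.adj hlt hw.adj hwa, hw, hyb, hy⟩)
  rcases lt_or_gt_of_ne hab.adj.ne with h | h
  · exact key hab h
  · exact (key hab.symm h).symm

/-- Two adjacent centres would form a bridge or a gap. -/
lemma not_adj_of_isCentre (hP : HasUniqueParents G)
    (hu : ∀ x z, G.Adj x z → x < z → ¬ CandAt u x z) {h k : V} (hh : IsCentre u h)
    (hk : IsCentre u k) : ¬ G.Adj h k := by
  intro hadj
  wlog hlt : h < k generalizing h k
  · exact this hk hh hadj.symm (lt_of_le_of_ne (not_lt.1 hlt) hadj.ne')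
  obtain ⟨s, ⟨hs, hs'⟩, hhs⟩ := hh
  obtain ⟨l, ⟨hl, hl'⟩, hkl⟩ := hk
  by_cases hE : HasEdge u h k
  · by_cases hsk : s = k
    · subst hsk
      obtain rfl := hs' l hl
      rcases hkl with hkl | ⟨t, ht, hkt⟩
      · exact lt_asymm hkl hlt
      · exact ht (hs' t hkt)
    · have hlh : l ≠ h := by
        rintro rfl
        exact hsk (hl' s hs)
      exact hu h k hadj hlt (Or.inl ⟨hE, l, s, hP.lt_of_ne hadj hlt hl.adj hlh, hl, hsk, hs⟩)
  · have hlh : l ≠ h := by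
      rintro rfl
      exact hE hl.symm
    have hsk : s ≠ k := by
      rintro rfl
      exact hE hs
    exact hu h k hadj hlt
      (Or.inr ⟨hE, l, s, hP.lt_of_ne hadj hlt hl.adj hlh, hl, hl', hsk, hs, Or.inr hs'⟩)

/-- A leaf is not adjacent to a centre after its own. -/
lemma not_adj_leaf_of_isCentre (hP : HasUniqueParents G)
    (hu : ∀ x z, G.Adj x z → x < z → ¬ CandAt u x z) {h k s : V} (hs : IsLeafAt u h s)
    (hk : IsCentre u k) (hlt : h < k) : ¬ G.Adj s k := by
  intro hadj
  obtain ⟨hs, hs'⟩ := hs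
  obtain ⟨l, ⟨hl, hl'⟩, -⟩ := hk
  have hE : ¬ HasEdge u s k := fun h => hlt.ne' (hs' k h)
  rcases lt_or_gt_of_ne hadj.ne with h1 | h1
  · have hls : l ≠ s := by
      rintro rfl
      exact hE hl.symm
    exact hu s k hadj h1 (Or.inr ⟨hE, l, h, hP.lt_of_ne hadj h1 hl.adj hls, hl, hl', hlt.ne,
      hs.symm, Or.inl hlt⟩)
  · exact hlt.ne (hP hs.adj hadj.symm (hlt.trans h1) h1)

end NoCandidates

variable [Fintype V]

lemma mem_picked {B : Finset V} {μ : G.edgeSet} :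
    μ ∈ picked (G := G) B ↔ ∃ h ∈ B, h ∈ (μ : Sym2 V) := by
  simp [picked]

lemma mem_surviving {B : Finset V} {μ : G.edgeSet} :
    μ ∈ surviving (G := G) B ↔ (∃ h ∈ B, h ∈ (μ : Sym2 V)) ∧
      ∀ h ∈ B, ∀ k ∈ B, h < k → h ∈ (μ : Sym2 V) → ∀ ν : G.edgeSet, k ∈ (ν : Sym2 V) →
        ∀ x, x ∈ (μ : Sym2 V) → x ∉ (ν : Sym2 V) := by
  rw [surviving, Finset.mem_filter, mem_picked]
  refine and_congr_right fun _ => ?_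
  push Not
  constructor
  · intro H h hh k hk hlt hμ ν hν x hx
    exact H h hh k hk hlt hμ ν (mem_picked.2 ⟨k, hk, hν⟩) hν x hx
  · intro H h hh k hk hlt hμ ν _ hν x hx
    exact H h hh k hk hlt hμ ν hν x hx

/-- In a subsymbol of `surviving B`, edges that meet contain the same selected vertex, so the middle
edge of a path of three edges could not contain any. -/
lemma not_isBridgeOf_of_subset_surviving {B : Finset V} {u : EdgeSymbol G}
    (hu : u ⊆ surviving B) (β : G.edgeSet) : ¬ IsBridgeOf u β := by
  have key : ∀ μ ∈ u, ∀ ν ∈ u, ∀ h ∈ B, ∀ k ∈ B, ∀ x, h ∈ (μ : Sym2 V) → k ∈ (ν : Sym2 V) →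
      x ∈ (μ : Sym2 V) → x ∈ (ν : Sym2 V) → h = k := by
    intro μ hμ ν hν h hh k hk x hhμ hkν hx hx'
    rcases lt_trichotomy h k with hlt | heq | hlt
    · exact absurd hx' ((mem_surviving.1 (hu hμ)).2 h hh k hk hlt hhμ ν hkν x hx)
    · exact heq
    · exact absurd hx ((mem_surviving.1 (hu hν)).2 k hk h hh hlt hkν μ hhμ x hx')
  rintro ⟨hβ, x, y, z, w, μ, ν, hnd, hμ, hν, hβ', hμu, hνu, -⟩
  simp only [List.nodup_cons, List.mem_cons, List.not_mem_nil, not_or, or_false] at hnd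
  obtain ⟨⟨hxy, hxz, hxw⟩, ⟨hyz, hyw⟩, hzw, -⟩ := hnd
  obtain ⟨h, hh, hhβ⟩ := (mem_surviving.1 (hu hβ)).1
  obtain ⟨k, hk, hkμ⟩ := (mem_surviving.1 (hu hμu)).1
  obtain ⟨l, hl, hlν⟩ := (mem_surviving.1 (hu hνu)).1
  have h1 := key β hβ μ hμu h hh k hk x hhβ hkμ (by simp [hβ']) (by simp [hμ])
  have h2 := key β hβ ν hνu h hh l hl z hhβ hlν (by simp [hβ']) (by simp [hν])
  rw [hμ, Sym2.mem_iff, ← h1] at hkμ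
  rw [hν, Sym2.mem_iff, ← h2] at hlν
  rcases hkμ with rfl | rfl <;> rcases hlν with h3 | h3 <;> simp_all

/-- The connected components of an unmatched symbol are stars, whose centres serve as the selected
vertices. -/
theorem isFAdmissible_iff (hP : HasUniqueParents G) {u : EdgeSymbol G} :
    IsFAdmissible u ↔ symbolPivot u = none := by
  classical
  constructor
  · rintro ⟨⟨B, -, hB⟩, hgap⟩
    rw [symbolPivot_eq_none]
    exact fun β => ⟨fun h => hgap ⟨β, h⟩, not_isBridgeOf_of_subset_surviving hB β⟩
  · intro hu
    refine ⟨?_, fun ⟨β, hβ⟩ => (symbolPivot_eq_none.1 hu β).1 hβ⟩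
    rw [symbolPivot_eq_none_iff_candAt hP] at hu
    refine ⟨Finset.univ.filter (IsCentre u), fun h hh k hk => not_adj_of_isCentre hP hu
      (Finset.mem_filter.1 hh).2 (Finset.mem_filter.1 hk).2, fun μ hμ => ?_⟩
    rw [mem_surviving]
    constructor
    · obtain ⟨a, b, hlt, hadj, hab⟩ := exists_lt_eq μ
      have hE : HasEdge u a b := ⟨μ, hμ, hab⟩
      by_cases hb : IsLeafAt u a b
      · exact ⟨a, by simpa using ⟨b, hb, Or.inl hlt⟩, by simp [hab]⟩
      · have ha := (isLeafAt_or hP hu hE).resolve_left hb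
        simp only [IsLeafAt, hE, true_and] at hb
        push Not at hb
        obtain ⟨t, ht, hta⟩ := hb
        exact ⟨b, by simpa using ⟨a, ha, Or.inr ⟨t, hta, ht⟩⟩, by simp [hab]⟩
    · rintro h hh k hk hlt ⟨s, hs⟩ ν ⟨t, ht⟩ x hx hxν
      have hh := (Finset.mem_filter.1 hh).2
      have hk := (Finset.mem_filter.1 hk).2
      have hE : HasEdge u h s := ⟨μ, hμ, hs⟩
      have hadjν : G.Adj k t := by
        have := ν.2
        rwa [ht, SimpleGraph.mem_edgeSet] at this
      have hnot := not_adj_of_isCentre hP hu hh hk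
      have hleaf : IsLeafAt u h s := by
        rcases isLeafAt_or hP hu hE with h1 | h1
        · exact h1
        · obtain ⟨s', hs', -⟩ := hh
          rwa [← h1.2 s' hs'.1]
      rw [hs, Sym2.mem_iff] at hx
      rw [ht, Sym2.mem_iff] at hxν
      rcases hx with rfl | rfl <;> rcases hxν with rfl | rfl
      · exact lt_irrefl _ hlt
      · exact hnot hadjν.symm
      · exact hnot hE.adj
      · exact not_adj_leaf_of_isCentre hP hu hleaf hk hlt hadjν.symm

end Admissible

section GradientPaths

open PivotMatching

variable {V : Type u} [LinearOrder V] [Fintype V] {G : SimpleGraph V}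

attribute [local instance] edgeOrder

/-! ### Sums over gradient paths -/

/-- The total weight of the gradient paths from `a` to `b`. -/
noncomputable def gradientSum (a b : EdgeSymbol G) : ℤ :=
  ∑ P ∈ gradientPaths a b, pathWeight P.1

lemma mem_gradientPaths {a b : EdgeSymbol G} {l : {l : List (EdgeSymbol G) // l.Nodup}} :
    l ∈ gradientPaths a b ↔
      l.1.head? = some a ∧ l.1.getLast? = some b ∧ l.1.IsChain GradientStep := by
  simp [gradientPaths]

lemma reflTransGen_of_isChain {l : List (EdgeSymbol G)} {a b : EdgeSymbol G}
    (hl : (a :: l).IsChain GradientStep) (hb : b ∈ a :: l) :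
    Relation.ReflTransGen GradientStep a b := by
  induction l generalizing a with
  | nil =>
    rw [List.mem_singleton.1 hb]
  | cons c l ih =>
    rw [List.isChain_cons_cons] at hl
    rcases List.mem_cons.1 hb with rfl | hb
    · exact Relation.ReflTransGen.refl
    · exact Relation.ReflTransGen.head hl.1 (ih hl.2 hb)

lemma gradientSum_eq_zero {a b : EdgeSymbol G} (h : ¬ Relation.ReflTransGen GradientStep a b) :
    gradientSum a b = 0 := by
  refine Finset.sum_eq_zero fun P hP => absurd ?_ h
  obtain ⟨h1, h2, h3⟩ := mem_gradientPaths.1 hP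
  obtain ⟨l, hl⟩ : ∃ l, P.1 = a :: l := by
    rcases hP' : P.1 with _ | ⟨c, l⟩
    · simp [hP'] at h1
    · rw [hP', List.head?_cons, Option.some.injEq] at h1
      exact ⟨l, by rw [h1]⟩
  rw [hl] at h2 h3
  exact reflTransGen_of_isChain h3 (List.mem_of_getLast? h2)

lemma isChain_nodup (hP : HasUniqueParents G) {l : List (EdgeSymbol G)}
    (hl : l.IsChain GradientStep) : l.Nodup := by
  induction l with
  | nil => exact List.nodup_nil
  | cons a l ih =>
    rw [List.nodup_cons]
    rcases l with _ | ⟨c, l⟩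
    · simp
    · rw [List.isChain_cons_cons] at hl
      refine ⟨fun h => not_transGen_self hP a ?_, ih hl.2⟩
      exact Relation.TransGen.head' hl.1 (reflTransGen_of_isChain hl.2 h)

lemma gradientSum_self (a : EdgeSymbol G) : gradientSum a a = 1 := by
  classical
  have : gradientPaths a a = {⟨[a], List.nodup_singleton a⟩} := by
    ext ⟨l, hl⟩
    rw [mem_gradientPaths, Finset.mem_singleton, Subtype.mk.injEq]
    constructor
    · rintro ⟨h1, h2, h3⟩
      rcases l with _ | ⟨c, l⟩
      · simp at h1
      · rw [List.head?_cons, Option.some.injEq] at h1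
        subst h1
        rcases l with _ | ⟨d, l⟩
        · rfl
        · rw [List.getLast?_cons_cons] at h2
          exact absurd (List.mem_of_getLast? h2) (List.nodup_cons.1 hl).1
    · rintro rfl
      simp
  rw [gradientSum, this, Finset.sum_singleton]
  simp [pathWeight]

open scoped Classical in
/-- Splitting the gradient paths according to their first step. -/
lemma gradientSum_eq_sum (hP : HasUniqueParents G) {a b : EdgeSymbol G} (hab : a ≠ b) :
    gradientSum a b = ∑ c with GradientStep a c, stepWeight a c * gradientSum c b := by
  simp only [gradientSum, Finset.mul_sum]
  rw [Finset.sum_sigma']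
  have hcons : ∀ (c : EdgeSymbol G) (l : List (EdgeSymbol G)), GradientStep a c →
      l.head? = some c → l.IsChain GradientStep → (a :: l).IsChain GradientStep := by
    intro c l h1 h2 h3
    rcases l with _ | ⟨d, l⟩
    · simp
    · rw [List.head?_cons, Option.some.injEq] at h2
      subst h2
      exact List.isChain_cons_cons.2 ⟨h1, h3⟩
  symm
  refine Finset.sum_bij (fun p hp => ⟨a :: p.2.1, ?_⟩) ?_ ?_ ?_ ?_
  · rw [Finset.mem_sigma, Finset.mem_filter, mem_gradientPaths] at hp
    exact isChain_nodup hP (hcons _ _ hp.1.2 hp.2.1 hp.2.2.2)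
  · rintro ⟨c, l, hl⟩ hp
    rw [Finset.mem_sigma, Finset.mem_filter, mem_gradientPaths] at hp
    obtain ⟨⟨-, h0⟩, h1, h2, h3⟩ := hp
    rw [mem_gradientPaths]
    refine ⟨rfl, ?_, hcons _ _ h0 h1 h3⟩
    rcases l with _ | ⟨d, l⟩
    · simp at h1
    · exact List.getLast?_cons_cons.trans h2
  · rintro ⟨c, l, hl⟩ hp ⟨d, m, hm⟩ hp' heq
    rw [Finset.mem_sigma, Finset.mem_filter, mem_gradientPaths] at hp hp'
    obtain ⟨⟨-, -⟩, h1, -⟩ := hp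
    obtain ⟨⟨-, -⟩, h1', -⟩ := hp'
    obtain rfl : l = m := by simpa using heq
    obtain rfl : c = d := by
      have := h1.symm.trans h1'
      simpa using this
    rfl
  · rintro ⟨l, hl⟩ hp
    rw [mem_gradientPaths] at hp
    obtain ⟨h1, h2, h3⟩ := hp
    rcases l with _ | ⟨c, l⟩
    · simp at h1
    · simp only [List.head?_cons, Option.some.injEq] at h1
      subst h1
      rcases l with _ | ⟨d, l⟩
      · simp only [List.getLast?_singleton, Option.some.injEq] at h2
        exact absurd h2 hab
      · simp only [List.getLast?_cons_cons] at h2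
        rw [List.isChain_cons_cons] at h3
        refine ⟨⟨d, ⟨d :: l, (List.nodup_cons.1 hl).2⟩⟩, ?_, rfl⟩
        rw [Finset.mem_sigma, Finset.mem_filter, mem_gradientPaths]
        exact ⟨⟨Finset.mem_univ _, h3.1⟩, rfl, h2, h3.2⟩
  · rintro ⟨c, l, hl⟩ hp
    rw [Finset.mem_sigma, Finset.mem_filter, mem_gradientPaths] at hp
    obtain ⟨-, h1, -⟩ := hp
    rcases l with _ | ⟨d, l⟩
    · simp at h1
    · simp only [List.head?_cons, Option.some.injEq] at h1
      subst h1
      simp [pathWeight]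

lemma incidence_erase {u : EdgeSymbol G} {μ : G.edgeSet} (hμ : μ ∈ u) :
    incidence u (u.erase μ) = faceSign u μ := by
  classical
  rw [incidence, Finset.sum_eq_single_of_mem μ hμ]
  · rw [if_pos (by congr), faceSign]
    congr 2
    ext ν
    simp only [Finset.mem_filter]
    rfl
  · intro ν hν hne
    rw [if_neg]
    intro heq
    have : ν ∈ u.erase μ := Finset.mem_erase.2 ⟨hne, hν⟩
    rw [heq] at this
    simp at this

/-- A gradient path to an unmatched symbol cannot start below the dimension of its end, and not in
that dimension either if its first vertex is the larger symbol of a matched pair: going up is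
possible only from the smaller symbol of a matched pair to the larger one. -/
lemma card_le_of_reflTransGen (hP : HasUniqueParents G) {a b : EdgeSymbol G}
    (hb : (symbolMatching hP).Critical b) (h : Relation.ReflTransGen GradientStep a b) :
    b.card ≤ a.card ∧ ((symbolMatching hP).Upper a → b.card + 1 ≤ a.card) := by
  induction h using Relation.ReflTransGen.head_induction_on with
  | refl =>
    refine ⟨le_rfl, ?_⟩
    rintro ⟨z, -, hz⟩
    rw [Critical, hz] at hb
    exact absurd hb (by simp)
  | head h _ ih =>
    rcases h with ⟨h, -⟩ | h
    · have := h.2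
      exact ⟨by omega, fun _ => by omega⟩
    · have h1 := ih.2 (h.upper hP)
      have h2 := h.isFacet.2
      exact ⟨by omega, fun h3 => absurd h3 (not_upper_of_lower (h.lower hP))⟩

lemma gradientSum_eq_zero_of_card_lt (hP : HasUniqueParents G) {a b : EdgeSymbol G}
    (hb : (symbolMatching hP).Critical b) (h : a.card < b.card) : gradientSum a b = 0 :=
  gradientSum_eq_zero fun h' => absurd (card_le_of_reflTransGen hP hb h').1 (not_le.2 h)

lemma not_inA_of_critical (hP : HasUniqueParents G) {a c : EdgeSymbol G}
    (ha : (symbolMatching hP).Critical a) : ¬ InA c a :=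
  fun h => ((symbolPivot_eq_none_iff_inA hP).1 ha c).2 h

/-- The sums over gradient paths are a flow: the paths that contribute and start at the smaller
symbol of a matched pair pass to the larger symbol first. -/
theorem isFlow_gradientSum (hP : HasUniqueParents G) :
    (symbolMatching hP).IsFlow gradientSum where
  critical {a b} ha hb hab := by
    classical
    split_ifs with h
    · subst h
      exact gradientSum_self a
    · rw [gradientSum_eq_sum hP h]
      refine Finset.sum_eq_zero fun c hc => ?_
      rcases (Finset.mem_filter.1 hc).2 with ⟨hf, -⟩ | hA
      · have := hf.2
        rw [gradientSum_eq_zero_of_card_lt hP hb (by omega), mul_zero]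
      · exact absurd hA (not_inA_of_critical hP ha)
  upper {a b} ha hb hab := gradientSum_eq_zero fun h => by
    have := (card_le_of_reflTransGen hP hb h).2 ha
    omega
  boundary {u b} hu hb hab := by
    classical
    obtain ⟨z, hz, hp⟩ := id hu
    have hp' := (symbolMatching_pivot hP).1 hp
    have hA : InA u (u.erase z) := inA_erase hP hp' hz
    have hAu : ∀ c, ¬ InA c u := fun c h => not_upper_of_lower (h.lower hP) hu
    have h1 : gradientSum (u.erase z) b = -faceSign u z * gradientSum u b := by
      have hne : u.erase z ≠ b := by
        rintro rfl
        exact not_inA_of_critical hP hb hA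
      rw [gradientSum_eq_sum hP hne, Finset.sum_eq_single_of_mem u (by
        rw [Finset.mem_filter]
        exact ⟨Finset.mem_univ _, Or.inr hA⟩)]
      · rw [stepWeight, if_pos hA, incidence_erase hz]
      · intro c hc hcu
        rcases (Finset.mem_filter.1 hc).2 with ⟨hf, -⟩ | hA'
        · have := hf.2
          rw [Finset.card_erase_of_mem hz] at this
          rw [gradientSum_eq_zero_of_card_lt hP hb (by omega), mul_zero]
        · exact absurd (hA'.left_unique hA) hcu
    -- From the larger symbol all steps go down, and none of them removes the pivot.
    have h2 : gradientSum u b = ∑ e ∈ u.erase z, faceSign u e * gradientSum (u.erase e) b := by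
      have hne : u ≠ b := by
        rintro rfl
        omega
      rw [gradientSum_eq_sum hP hne]
      symm
      refine Finset.sum_bij (fun e _ => u.erase e) ?_ ?_ ?_ ?_
      · intro e he
        obtain ⟨hez, he⟩ := Finset.mem_erase.1 he
        rw [Finset.mem_filter]
        refine ⟨Finset.mem_univ _, Or.inl ⟨⟨Finset.erase_subset _ _, ?_⟩, fun h => hez ?_⟩⟩
        · rw [Finset.card_erase_add_one he]
        · have := h.right_unique hP hA
          by_contra hne
          have h3 : e ∈ u.erase z := Finset.mem_erase.2 ⟨hne, he⟩
          rw [← this] at h3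
          simp at h3
      · intro e he f hf heq
        by_contra hne
        have h3 : e ∈ u.erase f := Finset.mem_erase.2 ⟨hne, (Finset.mem_erase.1 he).2⟩
        rw [← heq] at h3
        simp at h3
      · intro c hc
        rcases (Finset.mem_filter.1 hc).2 with ⟨hf, hA'⟩ | hA'
        · obtain ⟨e, he, rfl⟩ := hf.exists_eq_erase
          refine ⟨e, Finset.mem_erase.2 ⟨?_, he⟩, rfl⟩
          rintro rfl
          exact hA' hA
        · exact absurd hA' (hAu c)
      · intro e he
        obtain ⟨hez, he⟩ := Finset.mem_erase.1 he
        have : ¬ InA (u.erase e) u := hAu _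
        rw [stepWeight, if_neg this, incidence_erase he]
    rw [← Finset.add_sum_erase _ _ hz, h1, h2]
    have := faceSign_mul_self u z
    linear_combination (-(∑ e ∈ u.erase z, faceSign u e * gradientSum (u.erase e) b)) * this

end GradientPaths

/-! ### Homogenization of matrices -/

section Homogenization

open MvPolynomial Finsupp

variable (K : Type v) [Field K] {V : Type w} {B B' B'' : Type u}

/-- The map of graded free modules obtained by homogenizing an integral matrix. -/
noncomputable def homogenizedMap [Fintype B'] (deg : B → V →₀ ℕ) (deg' : B' → V →₀ ℕ)
    (M : B → B' → ℤ) : (B →₀ MvPolynomial V K) →ₗ[MvPolynomial V K] (B' →₀ MvPolynomial V K) :=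
  Finsupp.linearCombination (MvPolynomial V K) fun b =>
    ∑ b', single b' (monomial (deg b - deg' b') (M b b' : K))

variable {K}

lemma homogenizedMap_single [Fintype B'] (deg : B → V →₀ ℕ) (deg' : B' → V →₀ ℕ)
    (M : B → B' → ℤ) (b : B) (p : MvPolynomial V K) :
    homogenizedMap K deg deg' M (single b p) =
      ∑ b', single b' (p * monomial (deg b - deg' b') (M b b' : K)) := by
  simp [homogenizedMap, Finset.smul_sum]

/-- The element of multidegree `m` with the given coefficients. -/
noncomputable def homogenize [Fintype B] (deg : B → V →₀ ℕ) (m : V →₀ ℕ) (z : B → K) :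
    B →₀ MvPolynomial V K :=
  ∑ b, single b (monomial (m - deg b) (z b))

lemma homogenize_apply [Fintype B] (deg : B → V →₀ ℕ) (m : V →₀ ℕ) (z : B → K) (b : B) :
    homogenize deg m z b = monomial (m - deg b) (z b) := by
  classical
  rw [homogenize, Finsupp.finsetSum_apply, Finset.sum_eq_single_of_mem b (Finset.mem_univ b),
    single_eq_same]
  intro c _ hc
  exact single_eq_of_ne hc.symm

open scoped Classical in
/-- The coefficients of the component of multidegree `m`. -/
noncomputable def component (deg : B → V →₀ ℕ) (m : V →₀ ℕ) :
    (B →₀ MvPolynomial V K) →+ (B → K) where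
  toFun f b := if deg b ≤ m then coeff (m - deg b) (f b) else 0
  map_zero' := by ext; simp
  map_add' f g := by
    ext b
    by_cases h : deg b ≤ m <;> simp [h]

lemma component_eq_zero {deg : B → V →₀ ℕ} {m : V →₀ ℕ} {f : B →₀ MvPolynomial V K} {b : B}
    (h : ¬ deg b ≤ m) : component deg m f b = 0 := if_neg h

open scoped Classical in
lemma component_homogenize [Fintype B] {deg : B → V →₀ ℕ} {m m' : V →₀ ℕ} {z : B → K}
    (hz : ∀ b, z b ≠ 0 → deg b ≤ m') :
    component deg m (homogenize deg m' z) = if m = m' then z else 0 := by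
  ext b
  have h0 : component deg m (homogenize deg m' z) b =
      if deg b ≤ m then coeff (m - deg b) (monomial (m' - deg b) (z b)) else 0 := by
    rw [← homogenize_apply]; rfl
  rw [h0]
  by_cases hzb : z b = 0
  · by_cases h : m = m' <;> simp [h, hzb]
  · have hm' := hz b hzb
    by_cases h : m = m'
    · subst h
      simp [hm']
    · rw [if_neg h, Pi.zero_apply]
      split_ifs with hm
      · rw [coeff_monomial, if_neg]
        intro heq
        apply h
        rw [← tsub_add_cancel_of_le hm, ← heq, tsub_add_cancel_of_le hm']
      · rfl

lemma exists_sum_homogenize_component [Fintype B] (deg : B → V →₀ ℕ)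
    (f : B →₀ MvPolynomial V K) :
    ∃ s : Finset (V →₀ ℕ), ∑ m ∈ s, homogenize deg m (component deg m f) = f := by
  classical
  refine ⟨Finset.univ.biUnion fun b => (f b).support.image (· + deg b), ?_⟩
  ext b e
  rw [Finsupp.finsetSum_apply, coeff_sum]
  simp only [homogenize_apply]
  rw [Finset.sum_eq_single (e + deg b)]
  · simp [component]
  · intro m _ hne
    rw [coeff_monomial]
    split_ifs with h
    · refine component_eq_zero fun hm => hne ?_
      rw [← h, tsub_add_cancel_of_le hm]
    · rfl
  · intro h
    have he : coeff e (f b) = 0 := by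
      by_contra hcon
      exact h (Finset.mem_biUnion.2 ⟨b, Finset.mem_univ b,
        Finset.mem_image.2 ⟨e, MvPolynomial.mem_support_iff.2 hcon, rfl⟩⟩)
    simp [component, he]

lemma eq_zero_of_component_eq_zero [Fintype B] (deg : B → V →₀ ℕ) {f : B →₀ MvPolynomial V K}
    (h : ∀ m, component deg m f = 0) : f = 0 := by
  obtain ⟨s, hs⟩ := exists_sum_homogenize_component deg f
  rw [← hs]
  refine Finset.sum_eq_zero fun m _ => ?_
  rw [h m]
  simp [homogenize]

/-- The homogenized matrix acts on the component of each multidegree as the matrix itself. -/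
lemma homogenizedMap_homogenize [Fintype B] [Fintype B'] {deg : B → V →₀ ℕ} {deg' : B' → V →₀ ℕ}
    {M : B → B' → ℤ} (hM : ∀ b b', M b b' ≠ 0 → deg' b' ≤ deg b) {m : V →₀ ℕ} {z : B → K}
    (hz : ∀ b, z b ≠ 0 → deg b ≤ m) :
    homogenizedMap K deg deg' M (homogenize deg m z) =
      homogenize deg' m fun b' => ∑ b, z b * (M b b' : K) := by
  classical
  rw [homogenize, map_sum]
  simp only [homogenizedMap_single, monomial_mul]
  rw [Finset.sum_comm, homogenize]
  refine Finset.sum_congr rfl fun b' _ => ?_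
  rw [map_sum, Finsupp.single_finsetSum]
  refine Finset.sum_congr rfl fun b _ => ?_
  by_cases hzb : z b = 0
  · simp [hzb]
  by_cases hMb : M b b' = 0
  · simp [hMb]
  rw [tsub_add_tsub_cancel (hz b hzb) (hM b b' hMb)]

lemma sum_mul_ne_zero_le [Fintype B] {deg : B → V →₀ ℕ} {deg' : B' → V →₀ ℕ}
    {M : B → B' → ℤ} (hM : ∀ b b', M b b' ≠ 0 → deg' b' ≤ deg b) {m : V →₀ ℕ} {z : B → K}
    (hz : ∀ b, z b ≠ 0 → deg b ≤ m) (b' : B') (h : ∑ b, z b * (M b b' : K) ≠ 0) :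
    deg' b' ≤ m := by
  obtain ⟨b, -, hb⟩ := Finset.exists_ne_zero_of_sum_ne_zero h
  refine (hM b b' fun h0 => hb ?_).trans (hz b (left_ne_zero_of_mul hb))
  rw [h0, Int.cast_zero, mul_zero]

lemma component_homogenizedMap [Fintype B] [Fintype B'] {deg : B → V →₀ ℕ} {deg' : B' → V →₀ ℕ}
    {M : B → B' → ℤ} (hM : ∀ b b', M b b' ≠ 0 → deg' b' ≤ deg b) (m : V →₀ ℕ)
    (f : B →₀ MvPolynomial V K) :
    component deg' m (homogenizedMap K deg deg' M f) =
      fun b' => ∑ b, component deg m f b * (M b b' : K) := by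
  classical
  obtain ⟨s, hs⟩ := exists_sum_homogenize_component deg f
  have hz : ∀ m b, component deg m f b ≠ 0 → deg b ≤ m := fun m b h => by
    by_contra hcon
    exact h (component_eq_zero hcon)
  have hf : component deg m f = if m ∈ s then component deg m f else 0 := by
    conv_lhs => rw [← hs]
    rw [map_sum, Finset.sum_congr rfl fun m' _ => component_homogenize (hz m')]
    simp
  rw [hf]
  conv_lhs => rw [← hs]
  rw [map_sum, Finset.sum_congr rfl fun m' _ => homogenizedMap_homogenize hM (hz m'), map_sum,
    Finset.sum_congr rfl fun m' _ => component_homogenize (sum_mul_ne_zero_le hM (hz m'))]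
  rw [Finset.sum_ite_eq]
  ext b'
  by_cases h : m ∈ s <;> simp [h]

/-- Exactness of homogenized matrices may be checked for the matrices over the field, restricted to
the generators of degree at most `m`, for every multidegree `m`. -/
theorem exact_homogenizedMap [Fintype B] [Fintype B'] [Fintype B''] {deg : B → V →₀ ℕ}
    {deg' : B' → V →₀ ℕ} {deg'' : B'' → V →₀ ℕ} {M : B → B' → ℤ} {M' : B' → B'' → ℤ}
    (hM : ∀ b b', M b b' ≠ 0 → deg' b' ≤ deg b)
    (hM' : ∀ b b', M' b b' ≠ 0 → deg'' b' ≤ deg' b)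
    (hzero : ∀ z : B → K, ∀ b'', ∑ b', (∑ b, z b * (M b b' : K)) * (M' b' b'' : K) = 0)
    (hexact : ∀ (m : V →₀ ℕ) (z : B' → K), (∀ b, z b ≠ 0 → deg' b ≤ m) →
      (∀ b'', ∑ b', z b' * (M' b' b'' : K) = 0) →
      ∃ y : B → K, (∀ b, y b ≠ 0 → deg b ≤ m) ∧ ∀ b', ∑ b, y b * (M b b' : K) = z b') :
    Function.Exact (homogenizedMap K deg deg' M) (homogenizedMap K deg' deg'' M') := by
  intro f
  constructor
  · intro hf
    have key : ∀ m, ∃ y : B → K, (∀ b, y b ≠ 0 → deg b ≤ m) ∧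
        ∀ b', ∑ b, y b * (M b b' : K) = component deg' m f b' := by
      intro m
      refine hexact m _ (fun b h => ?_) fun b'' => ?_
      · by_contra hcon
        exact h (component_eq_zero hcon)
      · have := congrFun (component_homogenizedMap hM' m f) b''
        rw [← this, hf, map_zero, Pi.zero_apply]
    choose y hy hy' using key
    obtain ⟨s, hs⟩ := exists_sum_homogenize_component deg' f
    refine ⟨∑ m ∈ s, homogenize deg m (y m), ?_⟩
    rw [map_sum, Finset.sum_congr rfl fun m _ => homogenizedMap_homogenize hM (hy m)]
    refine Eq.trans (Finset.sum_congr rfl fun m _ => ?_) hs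
    congr 1
    exact funext (hy' m)
  · rintro ⟨g, rfl⟩
    refine eq_zero_of_component_eq_zero deg'' fun m => ?_
    rw [component_homogenizedMap hM', component_homogenizedMap hM]
    exact funext (hzero _)

lemma IsHomogeneousElt.homogenizedMap [Fintype B] [Fintype B'] {deg : B → V →₀ ℕ}
    {deg' : B' → V →₀ ℕ} {M : B → B' → ℤ} (hM : ∀ b b', M b b' ≠ 0 → deg' b' ≤ deg b)
    {m : V →₀ ℕ} {f : B →₀ MvPolynomial V K} (hf : IsHomogeneousElt deg m f) :
    IsHomogeneousElt deg' m (homogenizedMap K deg deg' M f) := by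
  classical
  intro b' e he
  by_contra hne
  have h1 := congrFun (component_homogenizedMap hM (e + deg' b') f) b'
  have h2 : component deg (e + deg' b') f = 0 := by
    ext b
    by_cases hb : deg b ≤ e + deg' b'
    · have : component deg (e + deg' b') f b = coeff (e + deg' b' - deg b) (f b) := if_pos hb
      rw [this, Pi.zero_apply]
      by_contra hcon
      have := hf b _ (MvPolynomial.mem_support_iff.2 hcon)
      rw [tsub_add_cancel_of_le hb] at this
      exact hne this
    · exact component_eq_zero hb
  rw [h2] at h1
  refine MvPolynomial.mem_support_iff.1 he ?_
  simpa [component] using h1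

end Homogenization

section Resolution

open MvPolynomial Finsupp PivotMatching
open scoped Classical

variable {K : Type v} [Field K] {V : Type u} [LinearOrder V] [Fintype V] {G : SimpleGraph V}

attribute [local instance] edgeOrder

/-! ### The minimal resolution -/

/-- The coefficients of the differentials before homogenization. -/
noncomputable def morseMatrix (r : ℕ) (u : FSymbol G (r + 1)) (b : FSymbol G r) : ℤ :=
  morseIncidence gradientSum u.1 b.1

lemma differential_eq (r : ℕ) :
    differential G K r = homogenizedMap K (fun u : FSymbol G (r + 1) => gr u.1)
      (fun u : FSymbol G r => gr u.1) (morseMatrix r) := by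
  classical
  refine Finsupp.lhom_ext' fun u => LinearMap.ext_ring ?_
  simp only [LinearMap.comp_apply, Finsupp.lsingle_apply]
  rw [homogenizedMap_single, differential, Finsupp.linearCombination_single, one_smul,
    Finset.sum_comm]
  refine Finset.sum_congr rfl fun b _ => ?_
  rw [one_mul, morseMatrix, morseIncidence, Int.cast_sum, map_sum, Finsupp.single_finsetSum]
  have hpow : u.1.powersetCard r = u.1.image u.1.erase := by
    ext t
    rw [Finset.mem_powersetCard, Finset.mem_image]
    constructor
    · rintro ⟨h1, h2⟩
      obtain ⟨e, he, rfl⟩ := IsFacet.exists_eq_erase (u := u.1) ⟨h1, by rw [h2, u.2.2]⟩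
      exact ⟨e, he, rfl⟩
    · rintro ⟨e, he, rfl⟩
      exact ⟨Finset.erase_subset _ _, by rw [Finset.card_erase_of_mem he, u.2.2]; rfl⟩
  rw [hpow, Finset.sum_image (Finset.erase_injOn u.1)]
  refine Finset.sum_congr rfl fun e he => ?_
  rw [gradientSum, Finset.mul_sum, Int.cast_sum, map_sum, Finsupp.single_finsetSum]
  refine Finset.sum_congr rfl fun P _ => ?_
  rw [incidence_erase he]

lemma critical_iff (hP : HasUniqueParents G) {u : EdgeSymbol G} :
    (symbolMatching hP).Critical u ↔ IsFAdmissible u :=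
  (isFAdmissible_iff hP).symm

/-- The edges whose monomials divide the monomial of multidegree `m`. -/
noncomputable def edgesLE (G : SimpleGraph V) (m : V →₀ ℕ) : EdgeSymbol G :=
  (Set.toFinite {μ : G.edgeSet | edgeExp μ ≤ m}).toFinset

lemma subset_edgesLE {u : EdgeSymbol G} {m : V →₀ ℕ} : u ⊆ edgesLE G m ↔ gr u ≤ m := by
  rw [gr, Finset.sup_le_iff]
  simp [edgesLE, Finset.subset_iff]

lemma respects_edgesLE (hP : HasUniqueParents G) (m : V →₀ ℕ) :
    (symbolMatching hP).Respects (edgesLE G m) :=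
  symbolMatching_respects hP m fun μ => by simp [edgesLE]

/-- The coefficients can be homogenized, since the flow does not leave the simplex of the edges
whose monomials divide a given monomial. -/
lemma gr_le_of_morseMatrix_ne_zero (hP : HasUniqueParents G) (r : ℕ) (u : FSymbol G (r + 1))
    (b : FSymbol G r) (h : morseMatrix r u b ≠ 0) : gr b.1 ≤ gr u.1 := by
  obtain ⟨e, he, hne⟩ := Finset.exists_ne_zero_of_sum_ne_zero h
  rw [← subset_edgesLE]
  by_contra hcon
  refine right_ne_zero_of_mul hne (flow_eq_zero_of_not_subset (isFlow_gradientSum hP)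
    (respects_edgesLE hP (gr u.1)) ?_ ((critical_iff hP).2 b.2.1) ?_ hcon)
  · exact (Finset.erase_subset _ _).trans (subset_edgesLE.2 le_rfl)
  · rw [Finset.card_erase_of_mem he, u.2.2, b.2.2, Nat.add_sub_cancel]

/-- A vector of coefficients of the `F`-admissible symbols of length `r`, as a chain. -/
noncomputable def toChain (r : ℕ) (z : FSymbol G r → K) : EdgeSymbol G →₀ K :=
  ∑ u, single u.1 (z u)

lemma toChain_apply {r : ℕ} (z : FSymbol G r → K) (u : FSymbol G r) : toChain r z u.1 = z u := by
  classical
  rw [toChain, Finsupp.finsetSum_apply, Finset.sum_eq_single_of_mem u (Finset.mem_univ u),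
    single_eq_same]
  intro c _ hc
  exact single_eq_of_ne fun h => hc (Subtype.ext h.symm)

lemma toChain_mem (hP : HasUniqueParents G) {r : ℕ} {m : V →₀ ℕ} {z : FSymbol G r → K}
    (hz : ∀ u, z u ≠ 0 → gr u.1 ≤ m) :
    toChain r z ∈ chainsOn K (edgesLE G m) r (symbolMatching hP).Critical := by
  refine Submodule.sum_mem _ fun u _ => ?_
  by_cases h : z u = 0
  · simp [h]
  · exact single_mem_chainsOn (subset_edgesLE.2 (hz u h)) u.2.2 ((critical_iff hP).2 u.2.1) _

lemma eq_toChain (hP : HasUniqueParents G) {r : ℕ} {m : V →₀ ℕ} {y : EdgeSymbol G →₀ K}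
    (hy : y ∈ chainsOn K (edgesLE G m) r (symbolMatching hP).Critical) :
    y = toChain r fun u => y u.1 := by
  ext u
  by_cases h : IsFAdmissible u ∧ u.card = r
  · exact (toChain_apply (fun u => y u.1) ⟨u, h⟩).symm
  · have h1 : y u = 0 := by
      by_contra hcon
      obtain ⟨-, h1, h2⟩ := (Finsupp.mem_supported K y).1 hy (Finsupp.mem_support_iff.2 hcon)
      exact h ⟨(critical_iff hP).1 h2, h1⟩
    rw [h1, toChain, Finsupp.finsetSum_apply]
    refine (Finset.sum_eq_zero fun v _ => single_eq_of_ne ?_).symm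
    rintro rfl
    exact h v.2

lemma flowMap_simplexBoundary_toChain (hP : HasUniqueParents G) {r : ℕ}
    (z : FSymbol G (r + 1) → K) :
    flowMap K (symbolMatching hP) gradientSum (simplexBoundary K (toChain (r + 1) z)) =
      toChain r fun b => ∑ u, z u * (morseMatrix r u b : K) := by
  classical
  have h1 : ∀ u : FSymbol G (r + 1),
      flowMap K (symbolMatching hP) gradientSum (simplexBoundary K (single u.1 (z u))) =
        ∑ b : FSymbol G r, single b.1 (z u * (morseMatrix r u b : K)) := by
    intro u
    have : single u.1 (z u) = z u • single u.1 1 := by simp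
    rw [this, map_smul, map_smul, flowMap_simplexBoundary_single u.2.2, Finset.smul_sum,
      Finset.sum_subtype (p := fun b => IsFAdmissible b ∧ b.card = r) _ fun b => by
        rw [Finset.mem_filter, critical_iff hP]; simp]
    refine Finset.sum_congr rfl fun b _ => ?_
    rw [Finsupp.smul_single, smul_eq_mul, morseMatrix]
  rw [toChain, map_sum, map_sum, Finset.sum_congr rfl fun u _ => h1 u, Finset.sum_comm, toChain]
  refine Finset.sum_congr rfl fun b _ => ?_
  rw [Finsupp.single_finsetSum]

/-- In each multidegree the complex is the Morse complex of the full simplex on the edges whose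
monomials divide the monomial of that degree. -/
lemma exact_differential (hP : HasUniqueParents G) (r : ℕ) :
    Function.Exact (differential G K (r + 1)) (differential G K r) := by
  rw [differential_eq, differential_eq]
  refine exact_homogenizedMap (gr_le_of_morseMatrix_ne_zero hP _)
    (gr_le_of_morseMatrix_ne_zero hP _) (fun z b => ?_) fun m z hz h0 => ?_
  · have hz : ∀ u : FSymbol G (r + 2), z u ≠ 0 → gr u.1 ≤ gr (Finset.univ : EdgeSymbol G) :=
      fun u _ => gr_mono (Finset.subset_univ _)
    have := morse_comp_eq_zero (isFlow_gradientSum hP) (respects_edgesLE hP _)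
      (toChain_mem hP hz)
    rw [flowMap_simplexBoundary_toChain, flowMap_simplexBoundary_toChain] at this
    rw [← toChain_apply (fun b => ∑ b', (∑ u, z u * (morseMatrix (r + 1) u b' : K)) *
      (morseMatrix r b' b : K)) b, this, Finsupp.zero_apply]
  · obtain ⟨y, hy, hyz⟩ := morse_exact (isFlow_gradientSum hP) (respects_edgesLE hP m)
      (toChain_mem hP hz) (by
        rw [flowMap_simplexBoundary_toChain]
        simp [toChain, h0])
    refine ⟨fun u => y u.1, fun u hu => ?_, fun b => ?_⟩
    · obtain ⟨h1, -⟩ := (Finsupp.mem_supported K y).1 hy (Finsupp.mem_support_iff.2 hu)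
      exact subset_edgesLE.1 h1
    · rw [eq_toChain hP hy, flowMap_simplexBoundary_toChain] at hyz
      have := DFunLike.congr_fun hyz b.1
      rwa [toChain_apply, toChain_apply] at this

/-- Symbols with at most one element have neither bridges nor gaps. -/
lemma isFAdmissible_of_card_le_one (hP : HasUniqueParents G) {u : EdgeSymbol G}
    (hu : u.card ≤ 1) : IsFAdmissible u := by
  rw [isFAdmissible_iff hP, symbolPivot_eq_none_iff_candAt hP]
  intro x z _ hxz hc
  have : Bridged u x z := hc.elim And.right fun h => h.2.bridged
  obtain ⟨w, y, hzw, ⟨μ, hμ, hμ'⟩, hyz, ⟨ν, hν, hν'⟩⟩ := this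
  rw [Finset.card_le_one.1 hu μ hμ ν hν, hν', Sym2.eq_iff] at hμ'
  rcases hμ' with ⟨rfl, -⟩ | ⟨rfl, -⟩ <;> order

lemma gr_empty : gr (∅ : EdgeSymbol G) = 0 := rfl

lemma gr_singleton (μ : G.edgeSet) : gr ({μ} : EdgeSymbol G) = edgeExp μ := Finset.sup_singleton

lemma eq_empty_of_fSymbol_zero (u : FSymbol G 0) : u.1 = ∅ := Finset.card_eq_zero.1 u.2.2

lemma X_mul_X_eq_monomial {x y : V} {μ : G.edgeSet} (hμ : (μ : Sym2 V) = s(x, y)) :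
    (X x * X y : MvPolynomial V K) = monomial (edgeExp μ) 1 := by
  classical
  have hadj : G.Adj x y := by have := μ.2; rwa [hμ, SimpleGraph.mem_edgeSet] at this
  rw [X, X, monomial_mul, one_mul]
  refine congrArg (fun e => monomial e (1 : K)) (Finsupp.ext fun v => ?_)
  rw [edgeExp_apply, hμ, Finsupp.add_apply, Finsupp.single_apply, Finsupp.single_apply]
  have := hadj.ne
  by_cases h1 : x = v <;> by_cases h2 : y = v <;> simp_all [eq_comm]

lemma augmentation_single (b : FSymbol G 0) (p : MvPolynomial V K) :
    augmentation G K (single b p) = Ideal.Quotient.mk (edgeIdeal K G) p := by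
  rw [augmentation, Finsupp.linearCombination_single]
  change Ideal.Quotient.mk (edgeIdeal K G) (p * 1) = _
  rw [mul_one]

lemma morseMatrix_zero (u : FSymbol G 1) (b : FSymbol G 0) : morseMatrix 0 u b = 1 := by
  obtain ⟨μ, hμ⟩ := Finset.card_eq_one.1 u.2.2
  have herase : ({μ} : EdgeSymbol G).erase μ = ∅ := by simp
  have hfilter : ({μ} : EdgeSymbol G).filter (fun ν => (edgeOrder G).lt ν μ) = ∅ := by
    rw [Finset.filter_eq_empty_iff]
    intro ν hν
    rw [Finset.mem_singleton.1 hν]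
    exact lt_irrefl (toLex (edgeExp μ))
  rw [morseMatrix, morseIncidence, hμ, eq_empty_of_fSymbol_zero b, Finset.sum_singleton, herase,
    gradientSum_self, mul_one, faceSign, hfilter]
  rfl

lemma exact_augmentation (hP : HasUniqueParents G) :
    Function.Exact (differential G K 0) (augmentation G K) := by
  classical
  have hsub : ∀ b b' : FSymbol G 0, b = b' := fun b b' =>
    Subtype.ext ((eq_empty_of_fSymbol_zero b).trans (eq_empty_of_fSymbol_zero b').symm)
  let o : FSymbol G 0 := ⟨∅, isFAdmissible_of_card_le_one hP (by simp), rfl⟩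
  intro f
  obtain ⟨p, rfl⟩ : ∃ p, f = single o p := ⟨f o, by
    ext b : 1
    rw [hsub b o, single_eq_same]⟩
  rw [augmentation_single, Ideal.Quotient.eq_zero_iff_mem]
  constructor
  · intro hp
    have hle : edgeIdeal K G ≤
        (LinearMap.range (differential G K 0)).comap (Finsupp.lsingle o) := by
      rw [edgeIdeal, Ideal.span_le]
      rintro q ⟨x, y, hadj, rfl⟩
      set μ : G.edgeSet := ⟨s(x, y), hadj⟩
      let u : FSymbol G 1 := ⟨{μ}, isFAdmissible_of_card_le_one hP (by simp), by simp⟩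
      refine ⟨single u 1, ?_⟩
      rw [differential_eq, homogenizedMap_single, Finset.sum_eq_single_of_mem o (Finset.mem_univ _)
        fun b _ hb => absurd (hsub b o) hb, one_mul, X_mul_X_eq_monomial (μ := μ) rfl]
      have h2 : gr u.1 - gr o.1 = edgeExp μ := by
        rw [gr_empty, gr_singleton, tsub_zero]
      rw [morseMatrix_zero, h2, Int.cast_one]
      rfl
    exact hle hp
  · rintro ⟨g, hg⟩
    have h0 : augmentation G K ∘ₗ differential G K 0 = 0 := by
      refine Finsupp.lhom_ext' fun u => LinearMap.ext_ring ?_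
      simp only [LinearMap.comp_apply, Finsupp.lsingle_apply, LinearMap.zero_apply]
      rw [differential_eq, homogenizedMap_single, map_sum]
      refine Finset.sum_eq_zero fun b _ => ?_
      rw [augmentation_single, Ideal.Quotient.eq_zero_iff_mem, one_mul]
      obtain ⟨μ, hμ⟩ := Finset.card_eq_one.1 u.2.2
      obtain ⟨x, y, -, hadj, hxy⟩ := exists_lt_eq μ
      have h2 : gr u.1 - gr b.1 = edgeExp μ := by
        rw [eq_empty_of_fSymbol_zero b, hμ]
        rw [gr_empty, gr_singleton, tsub_zero]
      have h3 : monomial (edgeExp μ) ((morseMatrix 0 u b : ℤ) : K) =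
          C ((morseMatrix 0 u b : ℤ) : K) * (X x * X y) := by
        rw [X_mul_X_eq_monomial hxy, C_mul_monomial, mul_one]
      rw [h2, h3]
      exact Ideal.mul_mem_left _ _ (Ideal.subset_span ⟨x, y, hadj, rfl⟩)
    rw [← Ideal.Quotient.eq_zero_iff_mem, ← augmentation_single o p, ← hg]
    exact LinearMap.congr_fun h0 g

/-- The resolution is minimal since distinct `F`-admissible symbols have distinct multidegrees. -/
lemma range_differential_le (hP : HasUniqueParents G) (r : ℕ) :
    LinearMap.range (differential G K r) ≤
    (Ideal.span (Set.range (X : V → MvPolynomial V K))) •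
      (⊤ : Submodule (MvPolynomial V K) (FSymbol G r →₀ MvPolynomial V K)) := by
  classical
  rintro _ ⟨f, rfl⟩
  induction f using Finsupp.induction_linear with
  | zero => simp
  | add f g hf hg => rw [map_add]; exact Submodule.add_mem _ hf hg
  | single u p =>
    rw [differential_eq, homogenizedMap_single]
    refine Submodule.sum_mem _ fun b _ => ?_
    by_cases h : morseMatrix r u b = 0
    · simp [h]
    have hle := gr_le_of_morseMatrix_ne_zero hP r u b h
    have hne : gr u.1 - gr b.1 ≠ 0 := by
      intro h0
      have heq : u.1 = b.1 := eq_of_gr_eq hP ((isFAdmissible_iff hP).1 u.2.1)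
        ((isFAdmissible_iff hP).1 b.2.1) (le_antisymm (tsub_eq_zero_iff_le.1 h0) hle)
      have h1 := u.2.2
      have h2 := b.2.2
      rw [heq] at h1
      omega
    have : single b (p * monomial (gr u.1 - gr b.1) ((morseMatrix r u b : ℤ) : K)) =
        (p * monomial (gr u.1 - gr b.1) ((morseMatrix r u b : ℤ) : K)) • single b 1 := by
      simp
    rw [this]
    refine Submodule.smul_mem_smul (Ideal.mul_mem_left _ _ ?_) trivial
    obtain ⟨v, hv⟩ := Finsupp.ne_iff.1 hne
    rw [← Set.image_univ, mem_ideal_span_X_image]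
    intro e he
    have := MvPolynomial.support_monomial_subset he
    rw [Finset.mem_singleton.1 this]
    exact ⟨v, trivial, hv⟩

theorem isMinimalGradedFreeResolution (hP : HasUniqueParents G) :
    IsMinimalGradedFreeResolution (edgeIdeal K G) (B := fun r => FSymbol G r)
      (fun _ u => gr u.1) (differential G K) (augmentation G K) where
  finite r := inferInstance
  surjective q := by
    obtain ⟨p, rfl⟩ := Ideal.Quotient.mk_surjective q
    exact ⟨single ⟨∅, isFAdmissible_of_card_le_one hP (by simp), rfl⟩ p, augmentation_single _ p⟩
  exact_zero := exact_augmentation hP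
  exact_succ r := exact_differential hP r
  homogeneous r m f hf := by
    classical
    rw [differential_eq]
    exact hf.homogenizedMap (gr_le_of_morseMatrix_ne_zero hP r)
  homogeneous_aug m f hf := by
    have hsub : ∀ b b' : FSymbol G 0, b = b' := fun b b' =>
      Subtype.ext ((eq_empty_of_fSymbol_zero b).trans (eq_empty_of_fSymbol_zero b').symm)
    let o : FSymbol G 0 := ⟨∅, isFAdmissible_of_card_le_one hP (by simp), rfl⟩
    have hfo : f = single o (f o) := by
      ext b : 1
      rw [hsub b o, single_eq_same]
    refine ⟨coeff m (f o), ?_⟩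
    rw [hfo, augmentation_single, single_eq_same]
    congr 1
    ext e
    rw [coeff_monomial]
    split_ifs with h
    · rw [h]
    · by_contra hcon
      have := hf o e (MvPolynomial.mem_support_iff.2 hcon)
      exact h (this.symm.trans (add_zero e))
  minimal r := range_differential_le hP r

end Resolution

/-! ### Collapsing a simplex along a matching -/

section Collapse

open PivotMatching

variable {E : Type u} [LinearOrder E] [Fintype E]

open scoped Classical in
/-- The face of the simplex whose relative interior contains `p`. -/
noncomputable def carrier (p : stdSimplex ℝ E) : Finset E := Finset.univ.filter fun e => p e ≠ 0

lemma mem_carrier {p : stdSimplex ℝ E} {e : E} : e ∈ carrier p ↔ p e ≠ 0 := by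
  simp [carrier]

lemma notMem_carrier {p : stdSimplex ℝ E} {e : E} : e ∉ carrier p ↔ p e = 0 := by
  simp [carrier]

/-- The retraction of the simplex with vertices `insert z A` to the union of its proper faces that
contain `z`: move away from the barycentre of `A` until a coordinate in `A` vanishes. The formula
makes sense on any larger simplex. -/
noncomputable def retractToHorn (z : E) (A : Finset E) (hA : A.Nonempty) (hz : z ∉ A)
    (p : stdSimplex ℝ E) : stdSimplex ℝ E :=
  ⟨fun e => p e + (if e = z then (A.card : ℝ) else if e ∈ A then -1 else 0) * A.inf' hA p, by
    constructor
    · intro e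
      have h0 : 0 ≤ A.inf' hA p := by
        rw [Finset.le_inf'_iff]
        exact fun e _ => stdSimplex.zero_le p e
      have h1 := stdSimplex.zero_le p e
      beta_reduce
      split_ifs with h2 h3
      · positivity
      · have := Finset.inf'_le p h3
        linarith
      · linarith
    · rw [Finset.sum_add_distrib, stdSimplex.sum_eq_one, ← Finset.sum_mul]
      have : ∑ e, (if e = z then (A.card : ℝ) else if e ∈ A then -1 else 0) = 0 := by
        rw [← Finset.add_sum_erase _ _ (Finset.mem_univ z), if_pos rfl]
        have h1 : ∑ e ∈ Finset.univ.erase z, (if e = z then (A.card : ℝ) else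
            if e ∈ A then -1 else 0) = ∑ e ∈ Finset.univ.erase z, if e ∈ A then -1 else 0 :=
          Finset.sum_congr rfl fun e he => if_neg (Finset.ne_of_mem_erase he)
        rw [h1, ← Finset.sum_filter]
        have h2 : (Finset.univ.erase z).filter (· ∈ A) = A := by
          ext e
          simp only [Finset.mem_filter, Finset.mem_erase, Finset.mem_univ, and_true]
          exact ⟨And.right, fun h => ⟨fun h' => hz (h' ▸ h), h⟩⟩
        rw [h2]
        simp
      rw [this, zero_mul, add_zero]⟩

lemma retractToHorn_apply (z : E) (A : Finset E) (hA : A.Nonempty) (hz : z ∉ A)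
    (p : stdSimplex ℝ E) (e : E) : retractToHorn z A hA hz p e =
      p e + (if e = z then (A.card : ℝ) else if e ∈ A then -1 else 0) * A.inf' hA p := rfl

lemma continuous_retractToHorn (z : E) (A : Finset E) (hA : A.Nonempty) (hz : z ∉ A) :
    Continuous (retractToHorn z A hA hz) := by
  have hc : ∀ e : E, Continuous fun p : stdSimplex ℝ E => p e := fun e =>
    (continuous_apply e).comp continuous_subtype_val
  refine Continuous.subtype_mk (continuous_pi fun e => ?_) _
  refine (hc e).add (continuous_const.mul ?_)
  exact Continuous.finset_inf'_apply hA fun i _ => hc i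

lemma inf'_pos_iff {A : Finset E} (hA : A.Nonempty) (p : stdSimplex ℝ E) :
    0 < A.inf' hA p ↔ A ⊆ carrier p := by
  rw [Finset.lt_inf'_iff]
  refine forall₂_congr fun e _ => ?_
  rw [mem_carrier]
  exact ⟨ne_of_gt, fun h => lt_of_le_of_ne (stdSimplex.zero_le p e) (Ne.symm h)⟩

lemma retractToHorn_eq_self {z : E} {A : Finset E} (hA : A.Nonempty) (hz : z ∉ A)
    {p : stdSimplex ℝ E} (h : ¬ A ⊆ carrier p) : retractToHorn z A hA hz p = p := by
  have h0 : A.inf' hA p = 0 := by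
    refine le_antisymm (not_lt.1 (mt (inf'_pos_iff hA p).1 h)) ?_
    rw [Finset.le_inf'_iff]
    exact fun e _ => stdSimplex.zero_le p e
  refine stdSimplex.ext (funext fun e => ?_)
  rw [retractToHorn_apply, h0, mul_zero, add_zero]

lemma carrier_retractToHorn_subset {z : E} {A : Finset E} (hA : A.Nonempty) (hz : z ∉ A)
    {p : stdSimplex ℝ E} (hp : A ⊆ carrier p) :
    carrier (retractToHorn z A hA hz p) ⊆ insert z (carrier p) := by
  intro e he
  rw [Finset.mem_insert, or_iff_not_imp_left]
  intro hez
  by_contra hcon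
  have heA : e ∉ A := fun h => hcon (hp h)
  rw [mem_carrier, retractToHorn_apply, if_neg hez, if_neg heA, notMem_carrier.1 hcon] at he
  simp at he

lemma exists_notMem_carrier_retractToHorn {z : E} {A : Finset E} (hA : A.Nonempty) (hz : z ∉ A)
    (p : stdSimplex ℝ E) : ¬ A ⊆ carrier (retractToHorn z A hA hz p) := by
  obtain ⟨e, he, heq⟩ := A.exists_mem_eq_inf' hA p
  refine fun h => mem_carrier.1 (h he) ?_
  rw [retractToHorn_apply, if_neg (fun h : e = z => hz (h ▸ he)), if_pos he, heq]
  ring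

variable (M : PivotMatching E)

open scoped Classical in
/-- One step of the collapse: a point in the interior of a simplex belonging to a matched pair is
retracted to the horn of that pair. -/
noncomputable def collapseStep (p : stdSimplex ℝ E) : stdSimplex ℝ E :=
  if h : ∃ z, M.pivot (carrier p) = some z then
    retractToHorn h.choose ((carrier p).erase h.choose) (M.erase_nonempty h.choose_spec)
      (Finset.notMem_erase _ _) p
  else p

variable {M}

lemma collapseStep_of_critical {p : stdSimplex ℝ E} (h : M.Critical (carrier p)) :
    collapseStep M p = p := by
  rw [collapseStep, dif_neg]
  rintro ⟨z, hz⟩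
  rw [Critical, hz] at h
  exact absurd h (by simp)

lemma collapseStep_of_pivot {p : stdSimplex ℝ E} {z : E} {A : Finset E} (hA : A.Nonempty)
    (hz : z ∉ A) (h : M.pivot (carrier p) = some z) (hpA : (carrier p).erase z = A) :
    collapseStep M p = retractToHorn z A hA hz p := by
  subst hpA
  have hex : ∃ z, M.pivot (carrier p) = some z := ⟨z, h⟩
  have hch : hex.choose = z := Option.some.inj (hex.choose_spec.symm.trans h)
  rw [collapseStep, dif_pos hex]
  congr 1
  rw [hch]

/-- The image of a step lies in the union of the proper faces of the larger simplex of the matched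
pair other than the smaller simplex. -/
lemma carrier_collapseStep {p : stdSimplex ℝ E} {z : E} (h : M.pivot (carrier p) = some z) :
    carrier (collapseStep M p) ⊂ insert z (carrier p) ∧
      ¬ (carrier p).erase z ⊆ carrier (collapseStep M p) := by
  rw [collapseStep_of_pivot (M.erase_nonempty h) (Finset.notMem_erase _ _) h rfl]
  have hnot := exists_notMem_carrier_retractToHorn (M.erase_nonempty h)
    (Finset.notMem_erase z (carrier p)) p
  refine ⟨⟨carrier_retractToHorn_subset _ _ (Finset.erase_subset _ _), fun hsub => hnot ?_⟩, hnot⟩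
  exact (Finset.erase_subset _ _).trans ((Finset.subset_insert _ _).trans hsub)

lemma height_collapseStep_lt {p : stdSimplex ℝ E} (h : ¬ M.Critical (carrier p)) :
    M.height (carrier (collapseStep M p)) < M.height (carrier p) := by
  obtain ⟨z, hz⟩ := Option.ne_none_iff_exists'.1 h
  obtain ⟨h1, h2⟩ := carrier_collapseStep hz
  have h3 : M.height (insert z (carrier p)) = M.height (carrier p) := by
    by_cases hmem : z ∈ carrier p
    · rw [Finset.insert_eq_of_mem hmem]
    · exact height_eq_of_lower hz hmem
  rw [← h3]
  refine M.height_lt h1 fun y hy heq => h2 ?_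
  rw [M.pivot_insert hz, Option.some.injEq] at hy
  subst hy
  rw [heq]
  exact Finset.erase_subset_erase _ (Finset.subset_insert _ _)

lemma card_carrier_collapseStep_le (p : stdSimplex ℝ E) :
    (carrier (collapseStep M p)).card ≤ (carrier p).card := by
  by_cases h : M.Critical (carrier p)
  · rw [collapseStep_of_critical h]
  · obtain ⟨z, hz⟩ := Option.ne_none_iff_exists'.1 h
    have h1 := Finset.card_lt_card (carrier_collapseStep hz).1
    have h2 := Finset.card_insert_le z (carrier p)
    omega

lemma card_carrier_collapseStep_lt {p : stdSimplex ℝ E} (h : M.Upper (carrier p)) :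
    (carrier (collapseStep M p)).card < (carrier p).card := by
  obtain ⟨z, hmem, hz⟩ := h
  have h1 := Finset.card_lt_card (carrier_collapseStep hz).1
  rwa [Finset.insert_eq_of_mem hmem] at h1

lemma carrier_collapseStep_subset {D : Finset E} (hD : M.Respects D) {p : stdSimplex ℝ E}
    (hp : carrier p ⊆ D) : carrier (collapseStep M p) ⊆ D := by
  by_cases h : M.Critical (carrier p)
  · rwa [collapseStep_of_critical h]
  · obtain ⟨z, hz⟩ := Option.ne_none_iff_exists'.1 h
    exact (carrier_collapseStep hz).1.1.trans
      (Finset.insert_subset (hD hz ((Finset.erase_subset _ _).trans hp)) hp)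

variable (M)

/-- The map that collapses the simplex: the steps are repeated until a critical open simplex is
reached. It is not continuous, but its fibres define a Hausdorff quotient of the simplex. -/
noncomputable def collapse : stdSimplex ℝ E → stdSimplex ℝ E :=
  (collapseStep M)^[Finset.univ.sup M.height]

variable {M}

lemma iterate_collapseStep_of_critical {p : stdSimplex ℝ E} (h : M.Critical (carrier p)) (n : ℕ) :
    (collapseStep M)^[n] p = p :=
  Function.iterate_fixed (collapseStep_of_critical h) n

lemma critical_iterate_collapseStep (n : ℕ) (p : stdSimplex ℝ E) (h : M.height (carrier p) ≤ n) :
    M.Critical (carrier ((collapseStep M)^[n] p)) := by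
  induction n generalizing p with
  | zero =>
    by_contra hcon
    have := height_collapseStep_lt hcon
    rw [Function.iterate_zero, id] at this
    omega
  | succ n ih =>
    by_cases hc : M.Critical (carrier p)
    · rwa [iterate_collapseStep_of_critical hc]
    · rw [Function.iterate_succ_apply]
      have := height_collapseStep_lt hc
      exact ih _ (by omega)

lemma critical_carrier_collapse (p : stdSimplex ℝ E) : M.Critical (carrier (collapse M p)) :=
  critical_iterate_collapseStep _ p (Finset.le_sup (Finset.mem_univ _))

lemma collapse_of_critical {p : stdSimplex ℝ E} (h : M.Critical (carrier p)) :
    collapse M p = p :=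
  iterate_collapseStep_of_critical h _

lemma collapse_collapseStep (p : stdSimplex ℝ E) :
    collapse M (collapseStep M p) = collapse M p := by
  rw [collapse, ← Function.iterate_succ_apply, Function.iterate_succ_apply']
  exact collapseStep_of_critical (critical_carrier_collapse p)

lemma collapse_collapse (p : stdSimplex ℝ E) : collapse M (collapse M p) = collapse M p :=
  collapse_of_critical (critical_carrier_collapse p)

lemma card_carrier_iterate_le (n : ℕ) (p : stdSimplex ℝ E) :
    (carrier ((collapseStep M)^[n] p)).card ≤ (carrier p).card := by
  induction n generalizing p with
  | zero => rfl
  | succ n ih =>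
    rw [Function.iterate_succ_apply]
    exact (ih _).trans (card_carrier_collapseStep_le p)

lemma card_carrier_collapse_le (p : stdSimplex ℝ E) :
    (carrier (collapse M p)).card ≤ (carrier p).card := card_carrier_iterate_le _ p

lemma card_carrier_collapse_lt {u : Finset E} (hu : M.Upper u) {p : stdSimplex ℝ E}
    (hp : carrier p ⊆ u) : (carrier (collapse M p)).card < u.card := by
  by_cases h : carrier p = u
  · subst h
    rw [← collapse_collapseStep]
    exact (card_carrier_collapse_le _).trans_lt (card_carrier_collapseStep_lt hu)
  · exact (card_carrier_collapse_le _).trans_lt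
      (Finset.card_lt_card (Finset.ssubset_iff_subset_ne.2 ⟨hp, h⟩))

lemma carrier_collapse_subset {D : Finset E} (hD : M.Respects D) {p : stdSimplex ℝ E}
    (hp : carrier p ⊆ D) : carrier (collapse M p) ⊆ D := by
  unfold collapse
  induction Finset.univ.sup M.height generalizing p with
  | zero => exact hp
  | succ n ih =>
    rw [Function.iterate_succ_apply]
    exact ih (carrier_collapseStep_subset hD hp)

/-- On the closed simplex of a matched pair, the collapse factors through the continuous retraction
to the horn. -/
lemma collapse_retractToHorn {S : Finset E} {z : E} (h : M.pivot S = some z) {p : stdSimplex ℝ E}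
    (hp : carrier p ⊆ S) :
    collapse M (retractToHorn z (S.erase z) (M.erase_nonempty h) (Finset.notMem_erase _ _) p) =
      collapse M p := by
  by_cases hA : S.erase z ⊆ carrier p
  · have hpA : (carrier p).erase z = S.erase z := by
      refine Finset.Subset.antisymm (Finset.erase_subset_erase _ hp) fun e he => ?_
      exact Finset.mem_erase.2 ⟨Finset.ne_of_mem_erase he, hA he⟩
    have hpiv : M.pivot (carrier p) = some z := by
      by_cases hz : z ∈ carrier p
      · have : carrier p = insert z S := by
          rw [← Finset.insert_erase hz, hpA]
          ext e
          by_cases he : e = z <;> simp [he]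
        rw [this]
        exact M.pivot_insert h
      · rw [← Finset.erase_eq_of_notMem hz, hpA]
        exact M.pivot_erase h
    rw [← collapseStep_of_pivot (M.erase_nonempty h) (Finset.notMem_erase _ _) hpiv hpA,
      collapse_collapseStep]
  · rw [retractToHorn_eq_self _ _ hA]

lemma isClosed_carrier_subset (S : Finset E) : IsClosed {p : stdSimplex ℝ E | carrier p ⊆ S} := by
  have : {p : stdSimplex ℝ E | carrier p ⊆ S} = ⋂ e ∈ Sᶜ, {p : stdSimplex ℝ E | p e = 0} := by
    ext p
    simp only [Set.mem_ofPred_eq, Set.mem_iInter, Finset.mem_compl]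
    constructor
    · exact fun h e he => notMem_carrier.1 fun h' => he (h h')
    · intro h e he
      by_contra hcon
      exact mem_carrier.1 he (h e hcon)
  rw [this]
  refine isClosed_biInter fun e _ => isClosed_eq ?_ continuous_const
  exact (continuous_apply e).comp continuous_subtype_val

variable (M)

/-- Pairs of points with the same collapse in two given open simplices. -/
def collapsePairs (S T : Finset E) : Set (stdSimplex ℝ E × stdSimplex ℝ E) :=
  {x | carrier x.1 = S ∧ carrier x.2 = T ∧ collapse M x.1 = collapse M x.2}

variable {M}

/-- By induction on the heights, retracting to horns until both simplices are critical, where the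
relation is equality. -/
lemma closure_collapsePairs_subset (S T : Finset E) :
    closure (collapsePairs M S T) ⊆ {x | collapse M x.1 = collapse M x.2} := by
  induction h : M.height S + M.height T using Nat.strong_induction_on generalizing S T with
  | _ n ih =>
  by_cases hS : M.Critical S
  · by_cases hT : M.Critical T
    · have h1 : collapsePairs M S T ⊆ {x | x.1 = x.2} := by
        rintro ⟨p, q⟩ ⟨rfl, rfl, h3⟩
        rwa [collapse_of_critical hS, collapse_of_critical hT] at h3
      have h2 := closure_minimal h1 (isClosed_eq continuous_fst continuous_snd)
      intro x hx
      exact congrArg (collapse M) (h2 hx)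
    · obtain ⟨z, hz⟩ := Option.ne_none_iff_exists'.1 hT
      set ρ := retractToHorn z (T.erase z) (M.erase_nonempty hz) (Finset.notMem_erase _ _) with hρ
      set U := ⋃ T' ∈ {T' : Finset E | M.height T' < M.height T}, closure (collapsePairs M S T')
      have hU : IsClosed U := (Set.toFinite _).isClosed_biUnion fun _ _ => isClosed_closure
      have hUsub : U ⊆ {x | collapse M x.1 = collapse M x.2} := Set.iUnion₂_subset fun T' hT' =>
        ih _ (by have : M.height T' < M.height T := hT'; omega) S T' rfl
      have hmap : collapsePairs M S T ⊆
          (fun x => (x.1, ρ x.2)) ⁻¹' U ∩ {x | carrier x.2 ⊆ T} := by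
        rintro ⟨p, q⟩ ⟨rfl, rfl, h3⟩
        refine ⟨?_, Finset.Subset.refl _⟩
        have hstep := collapseStep_of_pivot (M.erase_nonempty hz) (Finset.notMem_erase _ _) hz rfl
        refine Set.mem_biUnion (x := carrier (ρ q)) ?_
          (subset_closure ⟨rfl, rfl, ?_⟩)
        · rw [hρ, ← hstep]
          exact height_collapseStep_lt hT
        · exact h3.trans (collapse_retractToHorn hz (Finset.Subset.refl _)).symm
      have hcont : Continuous fun x : stdSimplex ℝ E × stdSimplex ℝ E => (x.1, ρ x.2) :=
        continuous_fst.prodMk ((continuous_retractToHorn _ _ _ _).comp continuous_snd)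
      have h2 := closure_minimal hmap ((hU.preimage hcont).inter
        ((isClosed_carrier_subset T).preimage continuous_snd))
      intro x hx
      obtain ⟨hx1, hx2⟩ := h2 hx
      exact (hUsub hx1).trans (collapse_retractToHorn hz hx2)
  · obtain ⟨z, hz⟩ := Option.ne_none_iff_exists'.1 hS
    set ρ := retractToHorn z (S.erase z) (M.erase_nonempty hz) (Finset.notMem_erase _ _) with hρ
    set U := ⋃ S' ∈ {S' : Finset E | M.height S' < M.height S}, closure (collapsePairs M S' T)
    have hU : IsClosed U := (Set.toFinite _).isClosed_biUnion fun _ _ => isClosed_closure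
    have hUsub : U ⊆ {x | collapse M x.1 = collapse M x.2} := Set.iUnion₂_subset fun S' hS' =>
      ih _ (by have : M.height S' < M.height S := hS'; omega) S' T rfl
    have hmap : collapsePairs M S T ⊆
        (fun x => (ρ x.1, x.2)) ⁻¹' U ∩ {x | carrier x.1 ⊆ S} := by
      rintro ⟨p, q⟩ ⟨rfl, rfl, h3⟩
      refine ⟨?_, Finset.Subset.refl _⟩
      have hstep := collapseStep_of_pivot (M.erase_nonempty hz) (Finset.notMem_erase _ _) hz rfl
      refine Set.mem_biUnion (x := carrier (ρ p)) ?_ (subset_closure ⟨rfl, rfl, ?_⟩)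
      · rw [hρ, ← hstep]
        exact height_collapseStep_lt hS
      · exact (collapse_retractToHorn hz (Finset.Subset.refl _)).trans h3
    have hcont : Continuous fun x : stdSimplex ℝ E × stdSimplex ℝ E => (ρ x.1, x.2) :=
      ((continuous_retractToHorn _ _ _ _).comp continuous_fst).prodMk continuous_snd
    have h2 := closure_minimal hmap ((hU.preimage hcont).inter
      ((isClosed_carrier_subset S).preimage continuous_fst))
    intro x hx
    obtain ⟨hx1, hx2⟩ := h2 hx
    exact (collapse_retractToHorn hz hx2).symm.trans (hUsub hx1)

lemma isClosed_collapse_eq :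
    IsClosed {x : stdSimplex ℝ E × stdSimplex ℝ E | collapse M x.1 = collapse M x.2} := by
  have : {x : stdSimplex ℝ E × stdSimplex ℝ E | collapse M x.1 = collapse M x.2} =
      ⋃ S : Finset E, ⋃ T : Finset E, closure (collapsePairs M S T) := by
    refine Set.Subset.antisymm (fun x hx => ?_)
      (Set.iUnion₂_subset fun S T => closure_collapsePairs_subset S T)
    exact Set.mem_iUnion₂.2 ⟨carrier x.1, carrier x.2, subset_closure ⟨rfl, rfl, hx⟩⟩
  rw [this]
  exact isClosed_iUnion_of_finite fun _ => isClosed_iUnion_of_finite fun _ => isClosed_closure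

end Collapse

/-- The quotient of a compact Hausdorff space by a closed equivalence relation is Hausdorff. -/
lemma t2Space_quotient_of_isClosed {Y : Type u} [TopologicalSpace Y] [CompactSpace Y] [T2Space Y]
    (s : Setoid Y) (hs : IsClosed {x : Y × Y | s x.1 x.2}) : T2Space (Quotient s) := by
  set q : Y → Quotient s := Quotient.mk s
  have hq : Topology.IsQuotientMap q := isQuotientMap_quotient_mk'
  have hclosed : IsClosedMap q := by
    intro C hC
    rw [← hq.isClosed_preimage]
    have : q ⁻¹' (q '' C) = Prod.snd '' ({x : Y × Y | s x.1 x.2} ∩ Prod.fst ⁻¹' C) := by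
      ext y
      constructor
      · rintro ⟨x, hx, hxy⟩
        exact ⟨(x, y), ⟨Quotient.exact hxy, hx⟩, rfl⟩
      · rintro ⟨⟨x, y⟩, ⟨h1, h2⟩, rfl⟩
        exact ⟨x, h2, Quotient.sound h1⟩
    rw [this]
    exact ((hs.inter (hC.preimage continuous_fst)).isCompact.image continuous_snd).isClosed
  have hfib : ∀ x, IsClosed (q ⁻¹' {x}) := by
    intro x
    obtain ⟨y, rfl⟩ := hq.surjective x
    have := hclosed {y} isClosed_singleton
    rw [Set.image_singleton] at this
    exact this.preimage hq.continuous
  refine ⟨fun x y hxy => ?_⟩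
  have hdis : Disjoint (q ⁻¹' {x}) (q ⁻¹' {y}) :=
    Disjoint.preimage q (Set.disjoint_singleton.2 hxy)
  obtain ⟨U, W, hU, hW, hxU, hyW, hUW⟩ := normal_separation (hfib x) (hfib y) hdis
  refine ⟨(q '' Uᶜ)ᶜ, (q '' Wᶜ)ᶜ, (hclosed _ hU.isClosed_compl).isOpen_compl,
    (hclosed _ hW.isClosed_compl).isOpen_compl, ?_, ?_, ?_⟩
  · rintro ⟨a, ha, rfl⟩
    exact ha (hxU rfl)
  · rintro ⟨a, ha, rfl⟩
    exact ha (hyW rfl)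
  · rw [Set.disjoint_left]
    intro z hz hz'
    obtain ⟨a, rfl⟩ := hq.surjective z
    have h1 : a ∈ U := by
      by_contra h
      exact hz ⟨a, h, rfl⟩
    have h2 : a ∈ W := by
      by_contra h
      exact hz' ⟨a, h, rfl⟩
    exact Set.disjoint_left.1 hUW h1 h2

/-! ### The standard simplex as a model cell -/

section ModelCell

open Set Metric

/-- The projection of the standard simplex that forgets the coordinate `0`. -/
def solidSimplex (n : ℕ) : Set (Fin n → ℝ) := {x | (∀ i, 0 ≤ x i) ∧ ∑ i, x i ≤ 1}

lemma convex_solidSimplex (n : ℕ) : Convex ℝ (solidSimplex n) := by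
  intro x hx y hy a b ha hb hab
  refine ⟨fun i => ?_, ?_⟩
  · have := mul_nonneg ha (hx.1 i)
    have := mul_nonneg hb (hy.1 i)
    simp only [Pi.add_apply, Pi.smul_apply, smul_eq_mul]
    linarith
  · simp only [Pi.add_apply, Pi.smul_apply, smul_eq_mul, Finset.sum_add_distrib, ← Finset.mul_sum]
    nlinarith [mul_le_mul_of_nonneg_left hx.2 ha, mul_le_mul_of_nonneg_left hy.2 hb]

lemma isClosed_solidSimplex (n : ℕ) : IsClosed (solidSimplex n) := by
  refine IsClosed.inter ?_ ?_
  · have : {x : Fin n → ℝ | ∀ i, 0 ≤ x i} = ⋂ i, {x | 0 ≤ x i} := by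
      ext x
      simp
    change IsClosed {x : Fin n → ℝ | ∀ i, 0 ≤ x i}
    rw [this]
    exact isClosed_iInter fun i => isClosed_le continuous_const (continuous_apply i)
  · exact isClosed_le (continuous_finsetSum _ fun i _ => continuous_apply i) continuous_const

lemma isBounded_solidSimplex (n : ℕ) : Bornology.IsBounded (solidSimplex n) := by
  refine (isBounded_iff_subset_closedBall 0).2 ⟨1, fun x hx => ?_⟩
  rw [mem_closedBall, dist_pi_le_iff zero_le_one]
  intro i
  rw [Pi.zero_apply, Real.dist_0_eq_abs, abs_of_nonneg (hx.1 i)]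
  exact (Finset.single_le_sum (fun j _ => hx.1 j) (Finset.mem_univ i)).trans hx.2

lemma interior_solidSimplex (n : ℕ) :
    interior (solidSimplex n) = {x | (∀ i, 0 < x i) ∧ ∑ i, x i < 1} := by
  refine Subset.antisymm (fun x hx => ?_) (interior_maximal ?_ ?_)
  · obtain ⟨ε, hε, hball⟩ := isOpen_iff.1 isOpen_interior x hx
    have hmove : ∀ δ : ℝ, |δ| = ε / 2 → (fun i => x i + δ) ∈ solidSimplex n := by
      intro δ hδ
      refine interior_subset (hball ?_)
      rw [mem_ball]
      refine ((dist_pi_le_iff (by positivity : (0 : ℝ) ≤ ε / 2)).2 fun i => ?_).trans_lt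
        (half_lt_self hε)
      rw [Real.dist_eq, add_sub_cancel_left, hδ]
    have h1 := hmove (-(ε / 2)) (by rw [abs_neg, abs_of_pos (half_pos hε)])
    have h2 := hmove (ε / 2) (abs_of_pos (half_pos hε))
    refine ⟨fun i => by have := h1.1 i; linarith, ?_⟩
    rcases n.eq_zero_or_pos with rfl | hn
    · simp
    · have h3 := h2.2
      rw [Finset.sum_add_distrib, Finset.sum_const, Finset.card_univ, Fintype.card_fin,
        nsmul_eq_mul] at h3
      have : (0 : ℝ) < n * (ε / 2) := by positivity
      linarith
  · exact fun x hx => ⟨fun i => (hx.1 i).le, hx.2.le⟩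
  · refine IsOpen.inter ?_ ?_
    · have : {x : Fin n → ℝ | ∀ i, 0 < x i} = ⋂ i, {x | 0 < x i} := by
        ext x
        simp
      change IsOpen {x : Fin n → ℝ | ∀ i, 0 < x i}
      rw [this]
      exact isOpen_iInter_of_finite fun i => isOpen_lt continuous_const (continuous_apply i)
    · exact isOpen_lt (continuous_finsetSum _ fun i _ => continuous_apply i) continuous_const

lemma interior_solidSimplex_nonempty (n : ℕ) : (interior (solidSimplex n)).Nonempty := by
  rw [interior_solidSimplex]
  refine ⟨fun _ => 1 / ((n : ℝ) + 1), fun _ => by positivity, ?_⟩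
  rw [Finset.sum_const, Finset.card_univ, Fintype.card_fin, nsmul_eq_mul, mul_one_div,
    div_lt_one (by positivity)]
  linarith

/-- The standard simplex is homeomorphic to its projection. -/
noncomputable def homeomorphSolidSimplex (n : ℕ) :
    stdSimplex ℝ (Fin (n + 1)) ≃ₜ solidSimplex n where
  toFun p := ⟨fun i => p i.succ, fun i => p.2.1 _, by
    have := p.2.2
    rw [Fin.sum_univ_succ] at this
    have h0 := p.2.1 0
    change ∑ i : Fin n, p.1 i.succ ≤ 1
    linarith⟩
  invFun x := ⟨Fin.cons (1 - ∑ i, x.1 i) x.1, by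
    refine ⟨fun i => ?_, ?_⟩
    · refine Fin.cases ?_ (fun j => ?_) i
      · simpa using x.2.2
      · simpa using x.2.1 j
    · rw [Fin.sum_univ_succ]
      simp⟩
  left_inv p := by
    refine Subtype.ext (funext fun i => ?_)
    refine Fin.cases ?_ (fun j => ?_) i
    · have := p.2.2
      rw [Fin.sum_univ_succ] at this
      change 1 - ∑ i : Fin n, p.1 i.succ = p.1 0
      linarith
    · rfl
  right_inv x := rfl
  continuous_toFun := by
    refine Continuous.subtype_mk (continuous_pi fun i => ?_) _
    exact (continuous_apply _).comp continuous_subtype_val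
  continuous_invFun := by
    refine Continuous.subtype_mk (continuous_pi fun i => ?_) _
    refine Fin.cases ?_ (fun j => ?_) i
    · exact continuous_const.sub (continuous_finsetSum _ fun i _ =>
        (continuous_apply i).comp continuous_subtype_val)
    · exact (continuous_apply j).comp continuous_subtype_val

/-- The model cell is homeomorphic to the standard simplex, interiors corresponding to each
other. -/
lemma exists_homeomorph_closedBall (n : ℕ) :
    ∃ θ : stdSimplex ℝ (Fin (n + 1)) ≃ₜ closedBall (0 : Fin n → ℝ) 1,
      ∀ p, (θ p : Fin n → ℝ) ∈ ball (0 : Fin n → ℝ) 1 ↔ ∀ i, 0 < p i := by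
  obtain ⟨h, h1, h2, -⟩ := exists_homeomorph_image_interior_closure_frontier_eq_unitBall
    (convex_solidSimplex n) (interior_solidSimplex_nonempty n) (isBounded_solidSimplex n)
  rw [(isClosed_solidSimplex n).closure_eq] at h2
  refine ⟨(homeomorphSolidSimplex n).trans ((h.image _).trans (Homeomorph.setCongr h2)),
    fun p => ?_⟩
  change h (homeomorphSolidSimplex n p).1 ∈ _ ↔ _
  rw [← h1, h.injective.mem_set_image, interior_solidSimplex]
  change (∀ i : Fin n, 0 < p.1 i.succ) ∧ ∑ i : Fin n, p.1 i.succ < 1 ↔ ∀ i, 0 < p.1 i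
  have := p.2.2
  rw [Fin.sum_univ_succ] at this
  rw [Fin.forall_fin_succ]
  exact ⟨fun ⟨h, h'⟩ => ⟨by linarith, h⟩, fun ⟨h, h'⟩ => ⟨h', by linarith⟩⟩

end ModelCell

/-! ### The CW structure on the collapsed simplex -/

/-- A continuous map on a compact set that is injective on a saturated subset has continuous
inverse there. -/
lemma continuousOn_invFunOn_of_isCompact {Y X : Type*} [TopologicalSpace Y] [TopologicalSpace X]
    [T2Space X] [Nonempty Y] {f : Y → X} {K s : Set Y} (hK : IsCompact K) (hf : ContinuousOn f K)
    (hs : s ⊆ K) (hinj : Set.InjOn f s) (hsat : ∀ x ∈ s, ∀ y ∈ K, f x = f y → y ∈ s) :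
    ContinuousOn (Function.invFunOn f s) (f '' s) := by
  rw [continuousOn_iff_isClosed]
  intro C hC
  refine ⟨f '' (K ∩ C), ((hK.inter_right hC).image_of_continuousOn
    (hf.mono Set.inter_subset_left)).isClosed, ?_⟩
  ext y
  constructor
  · rintro ⟨hy, x, hx, rfl⟩
    rw [Set.mem_preimage, hinj.leftInvOn_invFunOn hx] at hy
    exact ⟨⟨x, ⟨hs hx, hy⟩, rfl⟩, x, hx, rfl⟩
  · rintro ⟨⟨c, ⟨hcK, hcC⟩, hc⟩, x, hx, rfl⟩
    have hcs := hsat x hx c hcK hc.symm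
    refine ⟨?_, x, hx, rfl⟩
    rw [Set.mem_preimage, hinj.leftInvOn_invFunOn hx, ← hinj hcs hx hc]
    exact hcC

section Face

variable {E : Type u} [LinearOrder E] [Fintype E]

/-- The affine parametrization of a face of the simplex that preserves the order of the
vertices. -/
noncomputable def faceMap {n : ℕ} (u : Finset E) (h : u.card = n + 1)
    (p : stdSimplex ℝ (Fin (n + 1))) : stdSimplex ℝ E :=
  stdSimplex.map (u.orderEmbOfFin h) p

lemma continuous_faceMap {n : ℕ} (u : Finset E) (h : u.card = n + 1) : Continuous (faceMap u h) :=
  stdSimplex.continuous_map _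

lemma faceMap_apply {n : ℕ} (u : Finset E) (h : u.card = n + 1) (p : stdSimplex ℝ (Fin (n + 1)))
    (i : Fin (n + 1)) : faceMap u h p (u.orderEmbOfFin h i) = p i := by
  rw [faceMap, stdSimplex.map_coe, FunOnFinite.linearMap_apply_apply, Finset.sum_eq_single i]
  · intro j hj hji
    exact absurd ((u.orderEmbOfFin h).injective (Finset.mem_filter.1 hj).2) hji
  · intro hi
    simp at hi

lemma carrier_faceMap_subset {n : ℕ} (u : Finset E) (h : u.card = n + 1)
    (p : stdSimplex ℝ (Fin (n + 1))) : carrier (faceMap u h p) ⊆ u := by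
  intro e he
  rw [mem_carrier, faceMap, stdSimplex.map_coe, FunOnFinite.linearMap_apply_apply] at he
  obtain ⟨i, hi, -⟩ := Finset.exists_ne_zero_of_sum_ne_zero he
  rw [← (Finset.mem_filter.1 hi).2]
  exact Finset.orderEmbOfFin_mem u h i

lemma carrier_faceMap_eq_iff {n : ℕ} (u : Finset E) (h : u.card = n + 1)
    (p : stdSimplex ℝ (Fin (n + 1))) : carrier (faceMap u h p) = u ↔ ∀ i, 0 < p i := by
  constructor
  · intro heq i
    have hmem : u.orderEmbOfFin h i ∈ carrier (faceMap u h p) := by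
      rw [heq]
      exact Finset.orderEmbOfFin_mem u h i
    have := mem_carrier.1 hmem
    rw [faceMap_apply] at this
    exact lt_of_le_of_ne (stdSimplex.zero_le p i) this.symm
  · intro hpos
    refine Finset.Subset.antisymm (carrier_faceMap_subset u h p) fun e he => ?_
    obtain ⟨i, rfl⟩ : e ∈ Set.range (u.orderEmbOfFin h) := by
      rwa [Finset.range_orderEmbOfFin]
    rw [mem_carrier, faceMap_apply]
    exact (hpos i).ne'

lemma faceMap_injective {n : ℕ} (u : Finset E) (h : u.card = n + 1) :
    Function.Injective (faceMap u h) := by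
  intro p q hpq
  refine stdSimplex.ext (funext fun i => ?_)
  rw [← faceMap_apply u h p, hpq, faceMap_apply]

lemma exists_faceMap_eq {n : ℕ} (u : Finset E) (h : u.card = n + 1) {p : stdSimplex ℝ E}
    (hp : carrier p ⊆ u) : ∃ p', faceMap u h p' = p := by
  have hsum : ∑ i, p (u.orderEmbOfFin h i) = 1 := by
    rw [← stdSimplex.sum_eq_one p, ← Finset.sum_subset (Finset.subset_univ u)
      fun e _ he => notMem_carrier.1 fun h' => he (hp h')]
    conv_rhs => rw [← Finset.map_orderEmbOfFin_univ u h, Finset.sum_map]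
    rfl
  refine ⟨⟨fun i => p (u.orderEmbOfFin h i), fun i => stdSimplex.zero_le p _, hsum⟩, ?_⟩
  refine stdSimplex.ext (funext fun e => ?_)
  by_cases he : e ∈ u
  · obtain ⟨i, rfl⟩ : e ∈ Set.range (u.orderEmbOfFin h) := by
      rwa [Finset.range_orderEmbOfFin]
    rw [faceMap_apply]
    rfl
  · rw [notMem_carrier.1 fun h' => he (carrier_faceMap_subset u h _ h'),
      notMem_carrier.1 fun h' => he (hp h')]

lemma carrier_nonempty (p : stdSimplex ℝ E) : (carrier p).Nonempty := by
  by_contra h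
  have h0 : ∀ e, p e = 0 := fun e => notMem_carrier.1 fun he => h ⟨e, he⟩
  have := stdSimplex.sum_eq_one p
  simp [h0] at this

end Face

section Quotient

variable {E : Type u} [LinearOrder E] [Fintype E] (M : PivotMatching E)

/-- The quotient of the simplex by the fibres of the collapse. -/
def CollapsedSimplex : Type u := Quotient (Setoid.ker (collapse M))

instance : TopologicalSpace (CollapsedSimplex M) :=
  inferInstanceAs (TopologicalSpace (Quotient (Setoid.ker (collapse M))))

instance : CompactSpace (stdSimplex ℝ E) := isCompact_iff_compactSpace.1 (isCompact_stdSimplex ℝ E)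

instance : T2Space (CollapsedSimplex M) :=
  t2Space_quotient_of_isClosed (Setoid.ker (collapse M)) isClosed_collapse_eq

/-- The projection of the simplex to the collapsed simplex. -/
noncomputable def proj (p : stdSimplex ℝ E) : CollapsedSimplex M :=
  Quotient.mk (Setoid.ker (collapse M)) p

/-- The critical face whose interior contains a given point of the collapsed simplex. -/
noncomputable def CollapsedSimplex.support (x : CollapsedSimplex M) : Finset E :=
  Quotient.lift (fun p => carrier (collapse M p)) (fun _ _ h => congrArg carrier h) x

variable {M}

lemma continuous_proj : Continuous (proj M) := continuous_quotient_mk'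

lemma exists_proj_eq (x : CollapsedSimplex M) : ∃ p, proj M p = x := Quotient.exists_rep x

lemma proj_eq_proj {p q : stdSimplex ℝ E} : proj M p = proj M q ↔ collapse M p = collapse M q :=
  Quotient.eq (r := Setoid.ker (collapse M))

lemma support_proj (p : stdSimplex ℝ E) : (proj M p).support = carrier (collapse M p) := rfl

lemma critical_support (x : CollapsedSimplex M) : M.Critical x.support := by
  obtain ⟨p, rfl⟩ := exists_proj_eq x
  exact critical_carrier_collapse p

lemma support_nonempty (x : CollapsedSimplex M) : x.support.Nonempty := by
  obtain ⟨p, rfl⟩ := exists_proj_eq x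
  exact carrier_nonempty _

/-- The homeomorphism of the standard simplex with the model cell. -/
noncomputable def modelHomeomorph (n : ℕ) :
    stdSimplex ℝ (Fin (n + 1)) ≃ₜ Metric.closedBall (0 : Fin n → ℝ) 1 :=
  (exists_homeomorph_closedBall n).choose

lemma modelHomeomorph_mem_ball {n : ℕ} (p : stdSimplex ℝ (Fin (n + 1))) :
    (modelHomeomorph n p : Fin n → ℝ) ∈ Metric.ball (0 : Fin n → ℝ) 1 ↔ ∀ i, 0 < p i :=
  (exists_homeomorph_closedBall n).choose_spec p

variable (M)

open scoped Classical in
/-- The characteristic map of the cell of the collapsed simplex that belongs to a critical face `u`,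
extended by a constant outside of the model cell. -/
noncomputable def characteristicMap {n : ℕ} (u : Finset E) (h : u.card = n + 1) (x : Fin n → ℝ) :
    CollapsedSimplex M :=
  if hx : x ∈ Metric.closedBall (0 : Fin n → ℝ) 1 then
    proj M (faceMap u h ((modelHomeomorph n).symm ⟨x, hx⟩))
  else proj M (faceMap u h (stdSimplex.vertex 0))

variable {M}

lemma characteristicMap_modelHomeomorph {n : ℕ} (u : Finset E) (h : u.card = n + 1)
    (p : stdSimplex ℝ (Fin (n + 1))) :
    characteristicMap M u h (modelHomeomorph n p) = proj M (faceMap u h p) := by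
  rw [characteristicMap, dif_pos (modelHomeomorph n p).2]
  simp

lemma exists_modelHomeomorph_eq {n : ℕ} {x : Fin n → ℝ}
    (hx : x ∈ Metric.closedBall (0 : Fin n → ℝ) 1) :
    ∃ p, (modelHomeomorph n p : Fin n → ℝ) = x :=
  ⟨(modelHomeomorph n).symm ⟨x, hx⟩, by simp⟩

lemma continuousOn_characteristicMap {n : ℕ} (u : Finset E) (h : u.card = n + 1) :
    ContinuousOn (characteristicMap M u h) (Metric.closedBall 0 1) := by
  rw [continuousOn_iff_continuous_domRestrict]
  have : (Metric.closedBall (0 : Fin n → ℝ) 1).domRestrict (characteristicMap M u h) =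
      fun x => proj M (faceMap u h ((modelHomeomorph n).symm x)) := by
    ext x
    rw [Set.domRestrict_apply, characteristicMap, dif_pos x.2]
  rw [this]
  exact continuous_proj.comp ((continuous_faceMap u h).comp (modelHomeomorph n).symm.continuous)

lemma support_characteristicMap_eq_iff {n : ℕ} {u : Finset E} (hu : M.Critical u)
    (h : u.card = n + 1) {x : Fin n → ℝ} (hx : x ∈ Metric.closedBall (0 : Fin n → ℝ) 1) :
    (characteristicMap M u h x).support = u ↔ x ∈ Metric.ball (0 : Fin n → ℝ) 1 := by
  obtain ⟨p, rfl⟩ := exists_modelHomeomorph_eq hx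
  rw [characteristicMap_modelHomeomorph, modelHomeomorph_mem_ball, support_proj,
    ← carrier_faceMap_eq_iff u h]
  constructor
  · intro heq
    refine Finset.eq_of_subset_of_card_le (carrier_faceMap_subset u h p) ?_
    conv_lhs => rw [← heq]
    exact card_carrier_collapse_le _
  · intro heq
    rw [collapse_of_critical (by rwa [heq]), heq]

lemma card_support_characteristicMap_lt {n : ℕ} {u : Finset E} (h : u.card = n + 1)
    {x : Fin n → ℝ} (hx : x ∈ Metric.sphere (0 : Fin n → ℝ) 1) :
    (characteristicMap M u h x).support.card < u.card := by
  have hx' := Metric.sphere_subset_closedBall hx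
  have hxb : x ∉ Metric.ball (0 : Fin n → ℝ) 1 :=
    fun hb => (Metric.mem_ball.1 hb).ne (Metric.mem_sphere.1 hx)
  obtain ⟨p, rfl⟩ := exists_modelHomeomorph_eq hx'
  rw [characteristicMap_modelHomeomorph, support_proj]
  rw [modelHomeomorph_mem_ball, ← carrier_faceMap_eq_iff u h] at hxb
  exact (card_carrier_collapse_le _).trans_lt
    (Finset.card_lt_card (Finset.ssubset_iff_subset_ne.2 ⟨carrier_faceMap_subset u h p, hxb⟩))

lemma injOn_characteristicMap {n : ℕ} {u : Finset E} (hu : M.Critical u) (h : u.card = n + 1) :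
    Set.InjOn (characteristicMap M u h) (Metric.ball 0 1) := by
  intro x hx y hy hxy
  obtain ⟨p, rfl⟩ := exists_modelHomeomorph_eq (Metric.ball_subset_closedBall hx)
  obtain ⟨q, rfl⟩ := exists_modelHomeomorph_eq (Metric.ball_subset_closedBall hy)
  rw [modelHomeomorph_mem_ball, ← carrier_faceMap_eq_iff u h] at hx hy
  rw [characteristicMap_modelHomeomorph, characteristicMap_modelHomeomorph, proj_eq_proj,
    collapse_of_critical (by rwa [hx]), collapse_of_critical (by rwa [hy])] at hxy
  rw [faceMap_injective u h hxy]

lemma mem_image_characteristicMap_ball {n : ℕ} {u : Finset E} (hu : M.Critical u)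
    (h : u.card = n + 1) (x : CollapsedSimplex M) :
    x ∈ characteristicMap M u h '' Metric.ball 0 1 ↔ x.support = u := by
  constructor
  · rintro ⟨y, hy, rfl⟩
    exact (support_characteristicMap_eq_iff hu h (Metric.ball_subset_closedBall hy)).2 hy
  · intro hx
    obtain ⟨p, rfl⟩ := exists_proj_eq x
    obtain ⟨q, hq⟩ := exists_faceMap_eq u h (p := collapse M p) (by rw [← hx, support_proj])
    have hpq : characteristicMap M u h (modelHomeomorph n q) = proj M p := by
      rw [characteristicMap_modelHomeomorph, hq, proj_eq_proj, collapse_collapse]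
    refine ⟨modelHomeomorph n q, ?_, hpq⟩
    rw [← support_characteristicMap_eq_iff hu h (modelHomeomorph n q).2, hpq, hx]

lemma mem_image_characteristicMap_support (x : CollapsedSimplex M) :
    ∃ n, ∃ h : x.support.card = n + 1,
      x ∈ characteristicMap M x.support h '' Metric.closedBall 0 1 := by
  obtain ⟨n, hn⟩ : ∃ n, x.support.card = n + 1 :=
    Nat.exists_eq_succ_of_ne_zero (Finset.card_pos.2 (support_nonempty x)).ne'
  exact ⟨n, hn, Set.image_mono Metric.ball_subset_closedBall
    ((mem_image_characteristicMap_ball (critical_support x) hn x).2 rfl)⟩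

variable (M)

/-- The CW structure of the collapsed simplex: its `n`-cells are the critical faces with `n + 1`
vertices. -/
noncomputable instance collapsedCWComplex :
    Topology.CWComplex (Set.univ : Set (CollapsedSimplex M)) :=
  Topology.CWComplex.mkFinite (Set.univ : Set (CollapsedSimplex M))
    (cell := fun n => {u : Finset E // M.Critical u ∧ u.card = n + 1})
    (map := fun _ u => (injOn_characteristicMap u.2.1 u.2.2).toPartialEquiv _ _)
    (eventually_isEmpty_cell := Filter.eventually_atTop.2 ⟨Fintype.card E, fun n hn => ⟨fun u => by
      have h1 := u.2.2
      have h2 := Finset.card_le_univ u.1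
      omega⟩⟩)
    (finite_cell := fun _ => inferInstance)
    (source_eq := fun _ _ => rfl)
    (continuousOn := fun _ u => continuousOn_characteristicMap u.1 u.2.2)
    (continuousOn_symm := fun n u => by
      refine continuousOn_invFunOn_of_isCompact (isCompact_closedBall (0 : Fin n → ℝ) 1)
        (continuousOn_characteristicMap u.1 u.2.2) Metric.ball_subset_closedBall
        (injOn_characteristicMap u.2.1 u.2.2) fun x hx y hy hxy => ?_
      rw [← support_characteristicMap_eq_iff u.2.1 u.2.2 hy, ← hxy]
      exact (support_characteristicMap_eq_iff u.2.1 u.2.2 (Metric.ball_subset_closedBall hx)).2 hx)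
    (pairwiseDisjoint' := by
      rintro ⟨m, u⟩ - ⟨n, v⟩ - huv
      refine Set.disjoint_left.2 fun x hx hx' => huv ?_
      have h1 := (mem_image_characteristicMap_ball u.2.1 u.2.2 x).1 hx
      have h2 := (mem_image_characteristicMap_ball v.2.1 v.2.2 x).1 hx'
      obtain ⟨u, hu, hum⟩ := u
      obtain ⟨v, hv, hvn⟩ := v
      obtain rfl : u = v := h1.symm.trans h2
      obtain rfl : m = n := by omega
      rfl)
    (mapsTo_iff_image_subset := fun n u x hx => by
      have hlt := card_support_characteristicMap_lt (M := M) u.2.2 hx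
      obtain ⟨m, hm, hmem⟩ := mem_image_characteristicMap_support (characteristicMap M u.1 u.2.2 x)
      have hu := u.2.2
      simp only [Set.mem_iUnion]
      exact ⟨m, by omega, ⟨_, critical_support _, hm⟩, hmem⟩)
    (union' := by
      refine Set.eq_univ_of_forall fun x => ?_
      obtain ⟨m, hm, hmem⟩ := mem_image_characteristicMap_support x
      simp only [Set.mem_iUnion]
      exact ⟨m, ⟨_, critical_support _, hm⟩, hmem⟩)

variable {M}

open Topology RelCWComplex

variable (M) in
/-- The critical face whose interior is a given open cell. -/
noncomputable def cellEquiv (n : ℕ) : cell (Set.univ : Set (CollapsedSimplex M)) n ≃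
    {u : Finset E // M.Critical u ∧ u.card = n + 1} := Equiv.refl _

lemma mem_openCell_iff {n : ℕ} (e : cell (Set.univ : Set (CollapsedSimplex M)) n)
    (x : CollapsedSimplex M) : x ∈ openCell n e ↔ x.support = (cellEquiv M n e).1 :=
  mem_image_characteristicMap_ball (cellEquiv M n e).2.1 (cellEquiv M n e).2.2 x

lemma exists_carrier_subset_of_mem_closedCell {n : ℕ}
    (e : cell (Set.univ : Set (CollapsedSimplex M)) n) {x : CollapsedSimplex M}
    (hx : x ∈ closedCell n e) : ∃ p, carrier p ⊆ (cellEquiv M n e).1 ∧ proj M p = x := by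
  obtain ⟨y, hy, rfl⟩ := hx
  obtain ⟨p, rfl⟩ := exists_modelHomeomorph_eq hy
  exact ⟨faceMap _ (cellEquiv M n e).2.2 p, carrier_faceMap_subset _ _ _,
    (characteristicMap_modelHomeomorph _ (cellEquiv M n e).2.2 p).symm⟩

lemma mem_skeletonLT {n : ℕ} {x : CollapsedSimplex M} (hx : x.support.card ≤ n) :
    x ∈ skeletonLT (Set.univ : Set (CollapsedSimplex M)) (n : ℕ) := by
  obtain ⟨m, hm, hmem⟩ := mem_image_characteristicMap_support x
  have h1 := closedCell_subset_skeletonLT m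
    ((cellEquiv M m).symm ⟨_, critical_support x, hm⟩) hmem
  refine skeletonLT_mono ?_ h1
  norm_cast
  omega

end Quotient

/-! ### Incidence numbers of the collapsed simplex -/

section Incidence

open Finsupp PivotMatching Topology RelCWComplex

variable {E : Type u} [LinearOrder E] [Fintype E] (M : PivotMatching E)

/-- The singular simplex of the collapsed simplex defined by a face. -/
noncomputable def faceSimplex {n : ℕ} (u : Finset E) (h : u.card = n + 1) :
    C(stdSimplex ℝ (Fin (n + 1)), CollapsedSimplex M) :=
  ⟨fun p => proj M (faceMap u h p), continuous_proj.comp (continuous_faceMap u h)⟩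

/-- The singular chain of the collapsed simplex defined by a set of vertices, which is `0` if the
dimension does not fit. -/
noncomputable def faceChain (n : ℕ) (u : Finset E) : SingularChain (CollapsedSimplex M) n :=
  if h : u.card = n + 1 then single (faceSimplex M u h) 1 else 0

variable {M}

lemma faceChain_of_card {n : ℕ} {u : Finset E} (h : u.card = n + 1) :
    faceChain M n u = single (faceSimplex M u h) 1 := dif_pos h

lemma faceSimplex_comp_face {n : ℕ} (u : Finset E) (h : u.card = n + 2) (i : Fin (n + 2))
    (h' : (u.erase (u.orderEmbOfFin h i)).card = n + 1) :
    (faceSimplex M u h).comp (face n i) = faceSimplex M (u.erase (u.orderEmbOfFin h i)) h' := by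
  have hemb : (u.orderEmbOfFin h) ∘ i.succAbove =
      (u.erase (u.orderEmbOfFin h i)).orderEmbOfFin h' := by
    refine Finset.orderEmbOfFin_unique h' (fun j => ?_) ?_
    · refine Finset.mem_erase.2 ⟨fun heq => ?_, Finset.orderEmbOfFin_mem u h _⟩
      exact Fin.succAbove_ne i j ((u.orderEmbOfFin h).injective heq)
    · exact (u.orderEmbOfFin h).strictMono.comp (Fin.strictMono_succAbove i)
  ext p
  change proj M (stdSimplex.map _ (stdSimplex.map _ p)) = proj M (stdSimplex.map _ p)
  rw [stdSimplex.map_comp_apply, ← hemb]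

lemma faceSign_orderEmbOfFin {n : ℕ} (u : Finset E) (h : u.card = n) (i : Fin n) :
    faceSign u (u.orderEmbOfFin h i) = (-1) ^ (i : ℕ) := by
  have : u.filter (· < u.orderEmbOfFin h i) =
      (Finset.Iio i).map (u.orderEmbOfFin h).toEmbedding := by
    conv_lhs => enter [2]; rw [← Finset.map_orderEmbOfFin_univ u h]
    rw [Finset.filter_map]
    congr 1
    ext j
    simp
  rw [faceSign, this, Finset.card_map, Fin.card_Iio]

lemma singularBoundary_faceChain {n : ℕ} {u : Finset E} (h : u.card = n + 2) :
    singularBoundary (CollapsedSimplex M) n (faceChain M (n + 1) u) =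
      ∑ e ∈ u, faceSign u e • faceChain M n (u.erase e) := by
  rw [faceChain_of_card h, singularBoundary, Finsupp.linearCombination_single, one_smul]
  have hsum : ∑ e ∈ u, faceSign u e • faceChain M n (u.erase e) =
      ∑ i, faceSign u (u.orderEmbOfFin h i) •
        faceChain M n (u.erase (u.orderEmbOfFin h i)) := by
    conv_lhs => enter [1]; rw [← Finset.map_orderEmbOfFin_univ u h]
    rw [Finset.sum_map]
    rfl
  rw [hsum]
  refine Finset.sum_congr rfl fun i _ => ?_
  have h' : (u.erase (u.orderEmbOfFin h i)).card = n + 1 := by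
    rw [Finset.card_erase_of_mem (Finset.orderEmbOfFin_mem u h i), h]
    rfl
  rw [faceSimplex_comp_face u h i h', faceSign_orderEmbOfFin, faceChain_of_card h', smul_single,
    smul_eq_mul, mul_one]

/-- An upper face of a matched pair is collapsed into a skeleton of smaller dimension. -/
lemma faceChain_mem_chainsIn_of_upper {n : ℕ} {u : Finset E} (hu : M.Upper u)
    (h : u.card = n + 1) : faceChain M n u ∈
      chainsIn (skeletonLT (Set.univ : Set (CollapsedSimplex M)) (n : ℕ) :
        Set (CollapsedSimplex M)) n := by
  rw [faceChain_of_card h]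
  refine Finsupp.single_mem_supported ℤ _ ?_
  rintro _ ⟨p, rfl⟩
  refine mem_skeletonLT ?_
  change (proj M (faceMap u h p)).support.card ≤ n
  rw [support_proj]
  have := card_carrier_collapse_lt hu (carrier_faceMap_subset u h p)
  omega

variable (M)

/-- The `n`-chains that represent `0` in the homology of the `n`-skeleton relative to the
`(n - 1)`-skeleton. -/
noncomputable def nullChains (n : ℕ) : Submodule ℤ (SingularChain (CollapsedSimplex M) n) :=
  (chainsIn (skeletonLT (Set.univ : Set (CollapsedSimplex M)) (n + 1 : ℕ) :
      Set (CollapsedSimplex M)) (n + 1)).map (singularBoundary (CollapsedSimplex M) n) ⊔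
    chainsIn (skeletonLT (Set.univ : Set (CollapsedSimplex M)) (n : ℕ) :
      Set (CollapsedSimplex M)) n

open scoped Classical in
/-- The difference of a face and the combination of critical faces prescribed by a flow. -/
noncomputable def flowDefect (Γ : Finset E → Finset E → ℤ) (n : ℕ) (v : Finset E) :
    SingularChain (CollapsedSimplex M) n :=
  faceChain M n v - ∑ b with M.Critical b ∧ b.card = n + 1, Γ v b • faceChain M n b

variable {M}

open scoped Classical in
lemma sum_faceSign_smul_flowDefect (Γ : Finset E → Finset E → ℤ) {n : ℕ} {u : Finset E}
    (h : u.card = n + 2) :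
    ∑ e ∈ u, faceSign u e • flowDefect M Γ n (u.erase e) =
      singularBoundary (CollapsedSimplex M) n (faceChain M (n + 1) u) -
        ∑ b with M.Critical b ∧ b.card = n + 1, morseIncidence Γ u b • faceChain M n b := by
  simp only [flowDefect, smul_sub, Finset.sum_sub_distrib, Finset.smul_sum, smul_smul]
  rw [singularBoundary_faceChain h, Finset.sum_comm]
  congr 1
  refine Finset.sum_congr rfl fun b _ => ?_
  rw [morseIncidence, Finset.sum_smul]

/-- Modulo boundaries and lower skeleta a face agrees with the combination of critical faces
prescribed by a flow, since the boundary of the upper face of a matched pair is null. -/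
lemma flowDefect_mem_nullChains {Γ : Finset E → Finset E → ℤ} (hΓ : M.IsFlow Γ) {n : ℕ}
    {v : Finset E} (h : v.card = n + 1) : flowDefect M Γ n v ∈ nullChains M n := by
  classical
  induction hm : M.height v using Nat.strong_induction_on generalizing v with
  | _ m ih =>
  subst hm
  rcases M.critical_or_upper_or_lower v with hc | hu | hl
  · have : flowDefect M Γ n v = 0 := by
      rw [flowDefect, Finset.sum_eq_single v]
      · rw [hΓ.critical hc hc rfl, if_pos rfl, one_smul, sub_self]
      · intro b hb hbv
        have hb' := (Finset.mem_filter.1 hb).2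
        rw [hΓ.critical hc hb'.1 (by omega), if_neg (Ne.symm hbv), zero_smul]
      · intro hv
        exact absurd (Finset.mem_filter.2 ⟨Finset.mem_univ _, hc, h⟩) hv
    rw [this]
    exact Submodule.zero_mem _
  · rw [flowDefect, Finset.sum_eq_zero, sub_zero]
    · exact Submodule.mem_sup_right (faceChain_mem_chainsIn_of_upper hu h)
    · intro b hb
      have hb' := (Finset.mem_filter.1 hb).2
      rw [hΓ.upper hu hb'.1 (by omega), zero_smul]
  · obtain ⟨z, hz, hpiv⟩ := hl
    have hpiv' : M.pivot (insert z v) = some z := M.pivot_insert hpiv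
    have hup : M.Upper (insert z v) := ⟨z, Finset.mem_insert_self _ _, hpiv'⟩
    have hcard : (insert z v).card = n + 2 := by rw [Finset.card_insert_of_notMem hz, h]
    have htotal : ∑ e ∈ insert z v, faceSign (insert z v) e •
        flowDefect M Γ n ((insert z v).erase e) ∈ nullChains M n := by
      rw [sum_faceSign_smul_flowDefect Γ hcard, Finset.sum_eq_zero, sub_zero]
      · exact Submodule.mem_sup_left
          (Submodule.mem_map_of_mem (faceChain_mem_chainsIn_of_upper hup hcard))
      · intro b hb
        have hb' := (Finset.mem_filter.1 hb).2
        rw [morseIncidence, hΓ.boundary hup hb'.1 (by omega), zero_smul]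
    rw [Finset.sum_insert hz, Finset.erase_insert hz] at htotal
    have hrest : ∑ e ∈ v, faceSign (insert z v) e •
        flowDefect M Γ n ((insert z v).erase e) ∈ nullChains M n := by
      refine Submodule.sum_mem _ fun e he => Submodule.smul_mem _ _ ?_
      have hmem : e ∈ insert z v := Finset.mem_insert_of_mem he
      refine ih _ ?_ (by rw [Finset.card_erase_of_mem hmem, hcard]; rfl) rfl
      rw [← height_eq_of_lower hpiv hz]
      refine M.height_lt (Finset.erase_ssubset hmem) fun y hy heq => ?_
      obtain rfl : z = y := Option.some.inj (hpiv'.symm.trans hy)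
      rw [Finset.erase_insert hz] at heq
      exact Finset.notMem_erase e _ (heq.symm ▸ he)
    have h1 := Submodule.smul_mem (nullChains M n) (faceSign (insert z v) z)
      ((Submodule.add_mem_iff_left _ hrest).1 htotal)
    rwa [smul_smul, faceSign_mul_self, one_smul] at h1

open scoped Classical in
/-- The boundary of a face is, in relative homology, the combination of critical faces whose
coefficients are those of the Morse differential. -/
lemma singularBoundary_sub_mem_nullChains {Γ : Finset E → Finset E → ℤ} (hΓ : M.IsFlow Γ) {n : ℕ}
    {u : Finset E} (h : u.card = n + 2) :
    singularBoundary (CollapsedSimplex M) n (faceChain M (n + 1) u) -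
      ∑ b with M.Critical b ∧ b.card = n + 1, morseIncidence Γ u b • faceChain M n b ∈
        nullChains M n := by
  rw [← sum_faceSign_smul_flowDefect Γ h]
  refine Submodule.sum_mem _ fun e he => Submodule.smul_mem _ _ ?_
  exact flowDefect_mem_nullChains hΓ (by rw [Finset.card_erase_of_mem he, h]; rfl)

lemma charSimplex_eq {n : ℕ} (e : cell (Set.univ : Set (CollapsedSimplex M)) n) :
    charSimplex n (modelHomeomorph n) e = faceSimplex M _ (cellEquiv M n e).2.2 := by
  ext p
  exact characteristicMap_modelHomeomorph _ (cellEquiv M n e).2.2 p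

end Incidence

/-! ### The resolution is cellular -/

section Cellular

open MvPolynomial Finsupp PivotMatching Topology RelCWComplex
open scoped Classical

variable {K : Type v} [Field K] {V : Type u} [LinearOrder V] [Fintype V] {G : SimpleGraph V}

attribute [local instance] edgeOrder

/-- The `n`-cells of the collapsed simplex of all edges are the `F`-admissible symbols of length
`n + 1`. -/
noncomputable def cellLabel (hP : HasUniqueParents G) (n : ℕ) :
    cell (Set.univ : Set (CollapsedSimplex (symbolMatching hP))) n ≃ FSymbol G (n + 1) :=
  (cellEquiv (symbolMatching hP) n).trans
    (Equiv.subtypeEquivRight fun _ => and_congr_left' (critical_iff hP))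

lemma cellLabel_val (hP : HasUniqueParents G) {n : ℕ}
    (e : cell (Set.univ : Set (CollapsedSimplex (symbolMatching hP))) n) :
    (cellLabel hP n e).1 = (cellEquiv (symbolMatching hP) n e).1 := rfl

lemma gr_cellLabel_le (hP : HasUniqueParents G) {m n : ℕ}
    {e : cell (Set.univ : Set (CollapsedSimplex (symbolMatching hP))) m}
    {e' : cell (Set.univ : Set (CollapsedSimplex (symbolMatching hP))) n}
    (h : (closedCell m e ∩ openCell n e').Nonempty) :
    gr (cellLabel hP n e').1 ≤ gr (cellLabel hP m e).1 := by
  obtain ⟨x, hx, hx'⟩ := h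
  obtain ⟨p, hp, rfl⟩ := exists_carrier_subset_of_mem_closedCell e hx
  rw [mem_openCell_iff, support_proj] at hx'
  rw [← subset_edgesLE, cellLabel_val, ← hx']
  exact carrier_collapse_subset (respects_edgesLE hP _) (hp.trans (subset_edgesLE.2 le_rfl))

lemma singularBoundary_charSimplex (hP : HasUniqueParents G) (n : ℕ)
    (e : cell (Set.univ : Set (CollapsedSimplex (symbolMatching hP))) (n + 1)) :
    singularBoundary (CollapsedSimplex (symbolMatching hP)) n
        (single (charSimplex (n + 1) (modelHomeomorph (n + 1)) e) 1) -
      (Finsupp.equivFunOnFinite.symm (morseMatrix (n + 1) (cellLabel hP (n + 1) e))).mapDomain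
        (fun b => charSimplex n (modelHomeomorph n) ((cellLabel hP n).symm b)) ∈
      nullChains (symbolMatching hP) n := by
  have hcard := (cellEquiv (symbolMatching hP) (n + 1) e).2.2
  have hmain := singularBoundary_sub_mem_nullChains (isFlow_gradientSum hP) (n := n) hcard
  rw [faceChain_of_card hcard, ← charSimplex_eq] at hmain
  have hsum : (Finsupp.equivFunOnFinite.symm
      (morseMatrix (n + 1) (cellLabel hP (n + 1) e))).mapDomain
        (fun b => charSimplex n (modelHomeomorph n) ((cellLabel hP n).symm b)) =
      ∑ b with (symbolMatching hP).Critical b ∧ b.card = n + 1,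
        morseIncidence gradientSum (cellEquiv (symbolMatching hP) (n + 1) e).1 b •
          faceChain (symbolMatching hP) n b := by
    rw [Finset.sum_subtype (p := fun b : EdgeSymbol G => IsFAdmissible b ∧ b.card = n + 1) _
      fun b => by rw [Finset.mem_filter, critical_iff hP]; simp, Finsupp.mapDomain,
      Finsupp.sum_fintype _ _ fun _ => single_zero _]
    refine Finset.sum_congr rfl fun b _ => ?_
    rw [faceChain_of_card b.2.2, charSimplex_eq, smul_single, smul_eq_mul, mul_one]
    rfl
  rwa [hsum]

lemma isCellular (hP : HasUniqueParents G) :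
    IsCellular (K := K) (B := fun r => FSymbol G r) (fun _ u => gr u.1) (differential G K) := by
  let o : FSymbol G 0 := ⟨∅, isFAdmissible_of_card_le_one hP (by simp), rfl⟩
  have ho : ∀ b, b = o := fun b => Subtype.ext (eq_empty_of_fSymbol_zero b)
  refine ⟨CollapsedSimplex (symbolMatching hP), inferInstance, inferInstance, inferInstance,
    cellLabel hP, ⟨⟨o⟩, ho⟩, modelHomeomorph,
    fun r u => Finsupp.equivFunOnFinite.symm (morseMatrix r u), fun _ _ _ _ => gr_cellLabel_le hP,
    fun b => ?_, fun n e => singularBoundary_charSimplex hP n e, fun r b b' hb' => ?_,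
    fun r b => ?_⟩
  · ext b'
    obtain rfl := ho b'
    change morseMatrix 0 b o = single o 1 o
    rw [morseMatrix_zero, single_eq_same]
  · exact gr_le_of_morseMatrix_ne_zero hP r b b' (Finsupp.mem_support_iff.1 hb')
  · rw [differential_eq, homogenizedMap_single, Finsupp.sum_fintype]
    · exact Finset.sum_congr rfl fun b' _ => by rw [one_mul]; rfl
    · simp

end Cellular

end ForestResolution

theorem mainTheorem1 {K : Type*} [Field K] {V : Type*} [Fintype V] [LinearOrder V]
    (G : SimpleGraph V) (hG : G.IsAcyclic) (root : G.ConnectedComponent → V)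
    (hroot : ForestResolution.IsRankArrangement G root) :
    ForestResolution.IsAcyclicMatching G ∧
    (∀ u : ForestResolution.EdgeSymbol G, ForestResolution.IsFAdmissible u ↔
      ∀ v, ¬ ForestResolution.InA u v ∧ ¬ ForestResolution.InA v u) ∧
    ForestResolution.IsMinimalGradedFreeResolution (ForestResolution.edgeIdeal K G)
      (B := fun r => ForestResolution.FSymbol G r)
      (fun _ u => ForestResolution.gr u.1)
      (ForestResolution.differential G K) (ForestResolution.augmentation G K) ∧
    ForestResolution.IsCellular (K := K) (B := fun r => ForestResolution.FSymbol G r)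
      (fun _ u => ForestResolution.gr u.1)
      (ForestResolution.differential G K) := by
  have hP := hroot.hasUniqueParents hG
  exact ⟨ForestResolution.isAcyclicMatching hP,
    fun u => (ForestResolution.isFAdmissible_iff hP).trans
      (ForestResolution.symbolPivot_eq_none_iff_inA hP),
    ForestResolution.isMinimalGradedFreeResolution hP,
    ForestResolution.isCellular hP⟩
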